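/- Algebras are associative, not necessarily unital, over $\mathbb{C}$; $M(B)$ denotes the multiplier algebra of $B$. Let $(A,\Delta)$ be a weak multiplier Hopf algebra (not necessarily regular). That is, $A$ has a non-degenerate product and $A^2=A$; $\Delta:A\to M(A\otimes A)$ is a homomorphism such that $T_1(a\otimes b)=\Delta(a)(1\otimes b)$ and $T_2(a\otimes b)=(a\otimes 1)\Delta(b)$ lie in $A\otimes A$, which is coassociative, $(c\otimes1\otimes1)(\Delta\otimes\iota)(\Delta(a)(1\otimes b))=(\iota\otimes\Delta)((c\otimes1)\Delta(a))(1\otimes1\otimes b)$, and full (the smallest subspaces $V,W\subseteq A$ with $\Delta(A)(1\otimes A)\subseteq V\otimes A$ and $(A\otimes 1)\Delta(A)\subseteq A\otimes W$ are $A$); there is a counit, i.e. a linear map $\varepsilon:A\to\mathbb{C}$ with $(\varepsilon\otimes\iota)(\Delta(a)(1\otimes b))=ab=(\iota\otimes\varepsilon)((a\otimes1)\Delta(b))$; there is an idempotent $E\in M(A\otimes A)$ with $E(A\otimes A)=T_1(A\otimes A)$, $(A\otimes A)E=T_2(A\otimes A)$ and $(\iota\otimes\Delta)E=(E\otimes1)(1\otimes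 E)=(1\otimes E)(E\otimes1)$ (where $\iota\otimes\Delta$ is extended to $M(A\otimes A)$ with $1\mapsto 1\otimes E$); and $\operatorname{Ker}T_i=(1-G_i)(A\otimes A)$ for $i=1,2$, where the linear maps $G_1,G_2$ on $A\otimes A$ are given by $(G_1\otimes\iota)(\Delta_{13}(a)(1\otimes b\otimes c))=\Delta_{13}(a)(1\otimes E)(1\otimes b\otimes c)$ and $(\iota\otimes G_2)((a\otimes b\otimes1)\Delta_{13}(c))=(a\otimes b\otimes1)(E\otimes1)\Delta_{13}(c)$. Let $R_1,R_2$ be the generalized inverses of $T_1,T_2$ determined by $T_1R_1=E\,\cdot\,$, $R_1T_1=G_1$, $R_1T_1R_1=R_1$ and $T_2R_2=\,\cdot\,E$, $R_2T_2=G_2$, $R_2T_2R_2=R_2$. The antipode $S:A\to M(A)$ is given by $S(a)b=(\varepsilon\otimes\iota)R_1(a\otimes b)$ and $bS(a)=(\iota\otimes\varepsilon)R_2(b\otimes a)$; it is extended to $M(A)$ by $S(m)S(a)=S(am)$ and $S(a)S(m)=S(ma)$ for $a\in A$. The source map is $\varepsilon_s:A\to M(A)$, $\varepsilon_s(a)=(\iota\otimes\varepsilon)((1\otimes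 a)E)$, and $\varepsilon_s(A)$ is the source algebra. Let $R$ be a left $A$-module algebra: an algebra $R$ with a bilinear action $a\otimes r\mapsto a\rhd r$ satisfying $(ab)\rhd r=a\rhd(b\rhd r)$, which is unital ($R$ is spanned by the elements $a\rhd r$), and such that $$a\rhd (xy)=m(\Delta(a)\rhd(x\otimes y))\qquad (a\in A,\ x,y\in R),$$ where $m:R\otimes R\to R$ is the multiplication of $R$. Here a multiplier $\mu\in M(B)$ acts on a unital left $B$-module by $\mu\rhd(b\rhd x)=(\mu b)\rhd x$, and this is applied to the $A$-module $R$ and to the $A\otimes A$-module $R\otimes R$ with $(a\otimes b)\rhd(r\otimes r')=(a\rhd r)\otimes(b\rhd r')$. Then for all $r,r'\in R$ and all $y\in\varepsilon_s(A)$, $$m(E\rhd(r\otimes r'))=rr'\qquad\text{and}\qquad (y\rhd r)\,r'=r\,(S(y)\rhd r').$$ -/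

import Mathlib

open scoped TensorProduct

noncomputable section

namespace WMHA

section Multipliers

/-- The multiplier algebra `M(B)` of a (possibly non-unital) complex algebra `B`. A multiplier is
a pair `(l, r)` of a left multiplier `l` and a right multiplier `r` with `r(a) b = a l(b)`. The
second component lives in the opposite algebra, so that the product is
`(l, r)(l', r') = (l ∘ l', r' ∘ r)`. -/
def multiplierAlgebra (B : Type*) [NonUnitalRing B] [Module ℂ B] [IsScalarTower ℂ B B]
    [SMulCommClass ℂ B B] : Subalgebra ℂ (Module.End ℂ B × (Module.End ℂ B)ᵐᵒᵖ) where
  carrier := {p | (∀ a b, p.1 (a * b) = p.1 a * b) ∧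
    (∀ a b, p.2.unop (a * b) = a * p.2.unop b) ∧ ∀ a b, p.2.unop a * b = a * p.1 b}
  mul_mem' := by
    rintro p q ⟨h1, h2, h3⟩ ⟨k1, k2, k3⟩
    refine ⟨fun a b => ?_, fun a b => ?_, fun a b => ?_⟩
    · simp [k1, h1]
    · simp [k2, h2]
    · simp [k3, h3]
  add_mem' := by
    rintro p q ⟨h1, h2, h3⟩ ⟨k1, k2, k3⟩
    refine ⟨fun a b => ?_, fun a b => ?_, fun a b => ?_⟩
    · simp [k1, h1, add_mul]
    · simp [k2, h2, mul_add]
    · simp [k3, h3, add_mul, mul_add]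
  algebraMap_mem' := by
    intro z
    refine ⟨fun a b => ?_, fun a b => ?_, fun a b => ?_⟩
    · simp [Algebra.algebraMap_eq_smul_one, smul_mul_assoc]
    · simp [Algebra.algebraMap_eq_smul_one, mul_smul_comm]
    · simp [Algebra.algebraMap_eq_smul_one, smul_mul_assoc, mul_smul_comm]

/-- `M(B)` as a type; it is a unital complex algebra. -/
abbrev Multiplier (B : Type*) [NonUnitalRing B] [Module ℂ B] [IsScalarTower ℂ B B]
    [SMulCommClass ℂ B B] : Type _ := ↥(multiplierAlgebra B)

variable {B : Type*} [NonUnitalRing B] [Module ℂ B] [IsScalarTower ℂ B B] [SMulCommClass ℂ B B]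
variable {C : Type*} [NonUnitalRing C] [Module ℂ C] [IsScalarTower ℂ C C] [SMulCommClass ℂ C C]

/-- `m.left b` is the product `m b`. -/
def Multiplier.left (m : Multiplier B) : Module.End ℂ B := m.1.1

/-- `m.right b` is the product `b m`. -/
def Multiplier.right (m : Multiplier B) : Module.End ℂ B := m.1.2.unop

/-- The multiplier with given left and right multiplications. -/
def Multiplier.mk (l r : Module.End ℂ B) (hl : ∀ a b, l (a * b) = l a * b)
    (hr : ∀ a b, r (a * b) = a * r b) (h : ∀ a b, r a * b = a * l b) : Multiplier B :=
  ⟨(l, MulOpposite.op r), hl, hr, h⟩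

/-- The canonical map `B → M(B)`. -/
def Multiplier.of (B : Type*) [NonUnitalRing B] [Module ℂ B] [IsScalarTower ℂ B B]
    [SMulCommClass ℂ B B] : B →ₗ[ℂ] Multiplier B where
  toFun b := Multiplier.mk (LinearMap.mulLeft ℂ b) (LinearMap.mulRight ℂ b)
    (fun x y => by simp [mul_assoc]) (fun x y => by simp [mul_assoc])
    (fun x y => by simp [mul_assoc])
  map_add' x y := by
    refine Subtype.ext (Prod.ext ?_ (MulOpposite.unop_injective ?_)) <;>
      · ext z; simp [Multiplier.mk, add_mul, mul_add]
  map_smul' c x := by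
    refine Subtype.ext (Prod.ext ?_ (MulOpposite.unop_injective ?_)) <;>
      · ext z; simp [Multiplier.mk, smul_mul_assoc, mul_smul_comm]

/-- The multiplier `m ⊗ n` of `B ⊗ C`. -/
def Multiplier.tmul (m : Multiplier B) (n : Multiplier C) : Multiplier (B ⊗[ℂ] C) :=
  Multiplier.mk (TensorProduct.map m.left n.left) (TensorProduct.map m.right n.right)
    (by
      intro x y
      induction x using TensorProduct.induction_on with
      | zero => simp
      | add x x' hx hx' => simp only [add_mul, map_add, hx, hx']
      | tmul b c =>
        induction y using TensorProduct.induction_on with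
        | zero => simp
        | add y y' hy hy' => simp only [mul_add, map_add, hy, hy']
        | tmul b' c' =>
          simp [Multiplier.left, Algebra.TensorProduct.tmul_mul_tmul, m.2.1, n.2.1])
    (by
      intro x y
      induction x using TensorProduct.induction_on with
      | zero => simp
      | add x x' hx hx' => simp only [add_mul, map_add, hx, hx']
      | tmul b c =>
        induction y using TensorProduct.induction_on with
        | zero => simp
        | add y y' hy hy' => simp only [mul_add, map_add, hy, hy']
        | tmul b' c' =>
          simp [Multiplier.right, Algebra.TensorProduct.tmul_mul_tmul, m.2.2.1, n.2.2.1])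
    (by
      intro x y
      induction x using TensorProduct.induction_on with
      | zero => simp
      | add x x' hx hx' => simp only [add_mul, map_add, hx, hx']
      | tmul b c =>
        induction y using TensorProduct.induction_on with
        | zero => simp
        | add y y' hy hy' => simp only [mul_add, map_add, hy, hy']
        | tmul b' c' =>
          simp [Multiplier.left, Multiplier.right, Algebra.TensorProduct.tmul_mul_tmul,
            m.2.2.2, n.2.2.2])

/-- The natural map `M(B) ⊗ M(C) → M(B ⊗ C)`, as a bilinear map. -/
def Multiplier.tmulₗ (B C : Type*) [NonUnitalRing B] [Module ℂ B] [IsScalarTower ℂ B B]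
    [SMulCommClass ℂ B B] [NonUnitalRing C] [Module ℂ C] [IsScalarTower ℂ C C]
    [SMulCommClass ℂ C C] :
    Multiplier B →ₗ[ℂ] Multiplier C →ₗ[ℂ] Multiplier (B ⊗[ℂ] C) :=
  LinearMap.mk₂ ℂ Multiplier.tmul
    (fun _ _ _ => Subtype.ext (Prod.ext (TensorProduct.map_add_left _ _ _)
      (MulOpposite.unop_injective (TensorProduct.map_add_left _ _ _))))
    (fun _ _ _ => Subtype.ext (Prod.ext (TensorProduct.map_smul_left _ _ _)
      (MulOpposite.unop_injective (TensorProduct.map_smul_left _ _ _))))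
    (fun _ _ _ => Subtype.ext (Prod.ext (TensorProduct.map_add_right _ _ _)
      (MulOpposite.unop_injective (TensorProduct.map_add_right _ _ _))))
    (fun _ _ _ => Subtype.ext (Prod.ext (TensorProduct.map_smul_right _ _ _)
      (MulOpposite.unop_injective (TensorProduct.map_smul_right _ _ _))))

/-- Transport of multipliers along an isomorphism of algebras. -/
def Multiplier.transport (e : B ≃ₗ[ℂ] C) (he : ∀ x y, e (x * y) = e x * e y)
    (m : Multiplier B) : Multiplier C :=
  have he' : ∀ x y, e.symm (x * y) = e.symm x * e.symm y := fun x y => by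
    apply e.injective; simp [he]
  Multiplier.mk (e.toLinearMap ∘ₗ m.left ∘ₗ e.symm.toLinearMap)
    (e.toLinearMap ∘ₗ m.right ∘ₗ e.symm.toLinearMap)
    (fun x y => by simp [Multiplier.left, he', he, m.2.1])
    (fun x y => by simp [Multiplier.right, he', he, m.2.2.1])
    (fun x y => by
      have h := congrArg e (m.2.2.2 (e.symm x) (e.symm y))
      simpa [he, Multiplier.left, Multiplier.right] using h)

/-- The value at the multiplier `m` of the extension to `M(B)` of a homomorphism `Φ : B → M(C)`
whose extension sends `1` to the idempotent `e`: the multiplier `X = e X = X e` of `C` such that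
`X Φ(b) = Φ(m b)` and `Φ(b) X = Φ(b m)` for all `b`. It is unique when `Φ(B) C = e C`. -/
def IsExtensionAt (Φ : B →ₗ[ℂ] Multiplier C) (e : Multiplier C) (m : Multiplier B)
    (X : Multiplier C) : Prop :=
  e * X = X ∧ X * e = X ∧ (∀ b, X * Φ b = Φ (m.left b)) ∧ ∀ b, Φ b * X = Φ (m.right b)

end Multipliers

theorem assoc_mul (A : Type*) [NonUnitalRing A] [Module ℂ A] [IsScalarTower ℂ A A]
    [SMulCommClass ℂ A A] (x y : (A ⊗[ℂ] A) ⊗[ℂ] A) :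
    TensorProduct.assoc ℂ A A A (x * y) =
      TensorProduct.assoc ℂ A A A x * TensorProduct.assoc ℂ A A A y := by
  induction x using TensorProduct.induction_on with
  | zero => simp
  | add x x' hx hx' => simp only [add_mul, map_add, hx, hx']
  | tmul p c =>
    induction y using TensorProduct.induction_on with
    | zero => simp
    | add y y' hy hy' => simp only [mul_add, map_add, hy, hy']
    | tmul q d =>
      induction p using TensorProduct.induction_on with
      | zero => simp
      | add x x' hx hx' => simp only [TensorProduct.add_tmul, add_mul, map_add, hx, hx']
      | tmul a b =>
        induction q using TensorProduct.induction_on with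
        | zero => simp
        | add x x' hx hx' => simp only [TensorProduct.add_tmul, mul_add, map_add, hx, hx']
        | tmul a' b' => simp [Algebra.TensorProduct.tmul_mul_tmul]

section Legs

variable {A : Type*} [NonUnitalRing A] [Module ℂ A] [IsScalarTower ℂ A A] [SMulCommClass ℂ A A]

/-- `F ⊗ 1` in `M(A ⊗ A ⊗ A)`, for `F` in `M(A ⊗ A)`. -/
def leg12 (F : Multiplier (A ⊗[ℂ] A)) : Multiplier (A ⊗[ℂ] (A ⊗[ℂ] A)) :=
  Multiplier.transport (TensorProduct.assoc ℂ A A A) (assoc_mul A)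
    (Multiplier.tmul F (1 : Multiplier A))

/-- `1 ⊗ F` in `M(A ⊗ A ⊗ A)`, for `F` in `M(A ⊗ A)`. -/
def leg23 (F : Multiplier (A ⊗[ℂ] A)) : Multiplier (A ⊗[ℂ] (A ⊗[ℂ] A)) :=
  Multiplier.tmul (1 : Multiplier A) F

/-- `ι ⊗ Δ : A ⊗ A → M(A ⊗ A ⊗ A)`. -/
def idTensor (Δ : A →ₗ[ℂ] Multiplier (A ⊗[ℂ] A)) :
    A ⊗[ℂ] A →ₗ[ℂ] Multiplier (A ⊗[ℂ] (A ⊗[ℂ] A)) :=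
  TensorProduct.lift ((Multiplier.tmulₗ A (A ⊗[ℂ] A)).compl₁₂ (Multiplier.of A) Δ)

/-- An operator `T` on `A ⊗ A`, acting on the first and third factor of `A ⊗ A ⊗ A`. -/
def leg13 (T : Module.End ℂ (A ⊗[ℂ] A)) : Module.End ℂ (A ⊗[ℂ] (A ⊗[ℂ] A)) :=
  (TensorProduct.leftComm ℂ A A A).toLinearMap ∘ₗ T.lTensor A ∘ₗ
    (TensorProduct.leftComm ℂ A A A).toLinearMap

/-- `φ ⊗ ι : A ⊗ A → A`. -/
def sliceLeft (φ : A →ₗ[ℂ] ℂ) : A ⊗[ℂ] A →ₗ[ℂ] A :=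
  (TensorProduct.lid ℂ A).toLinearMap ∘ₗ φ.rTensor A

/-- `ι ⊗ φ : A ⊗ A → A`. -/
def sliceRight (φ : A →ₗ[ℂ] ℂ) : A ⊗[ℂ] A →ₗ[ℂ] A :=
  (TensorProduct.rid ℂ A).toLinearMap ∘ₗ φ.lTensor A

end Legs

/-- A weak multiplier Hopf algebra (not necessarily regular) with underlying algebra `A`. Besides
the coproduct `Δ`, the structure records the canonical maps `T₁`, `T₂`, the counit `ε`, the
canonical idempotent `E` and the maps `G₁`, `G₂`, all of which are determined by `Δ`. -/
structure WeakMultiplierHopfAlgebra (A : Type*) [NonUnitalRing A] [Module ℂ A]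
    [IsScalarTower ℂ A A] [SMulCommClass ℂ A A] where
  /-- The product is non-degenerate. -/
  left_nondeg : ∀ a : A, (∀ b, a * b = 0) → a = 0
  right_nondeg : ∀ a : A, (∀ b, b * a = 0) → a = 0
  /-- `A² = A`. -/
  idempotent : Submodule.span ℂ {x : A | ∃ a b, x = a * b} = ⊤
  /-- The coproduct, a homomorphism `A → M(A ⊗ A)`. -/
  Δ : A →ₙₐ[ℂ] Multiplier (A ⊗[ℂ] A)
  /-- The canonical map `T₁(a ⊗ b) = Δ(a)(1 ⊗ b)`; in particular this lies in `A ⊗ A`. -/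
  T₁ : Module.End ℂ (A ⊗[ℂ] A)
  T₁_spec : ∀ a b, Multiplier.of (A ⊗[ℂ] A) (T₁ (a ⊗ₜ b)) =
    Δ a * Multiplier.tmul (1 : Multiplier A) (Multiplier.of A b)
  /-- The canonical map `T₂(a ⊗ b) = (a ⊗ 1)Δ(b)`; in particular this lies in `A ⊗ A`. -/
  T₂ : Module.End ℂ (A ⊗[ℂ] A)
  T₂_spec : ∀ a b, Multiplier.of (A ⊗[ℂ] A) (T₂ (a ⊗ₜ b)) =
    Multiplier.tmul (Multiplier.of A a) (1 : Multiplier A) * Δ b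
  /-- Coassociativity:
  `(c ⊗ 1 ⊗ 1)(Δ ⊗ ι)(Δ(a)(1 ⊗ b)) = (ι ⊗ Δ)((c ⊗ 1)Δ(a))(1 ⊗ 1 ⊗ b)`. -/
  coassoc : ∀ a b c : A,
    TensorProduct.assoc ℂ A A A
        (T₂.rTensor A ((TensorProduct.assoc ℂ A A A).symm (c ⊗ₜ T₁ (a ⊗ₜ b)))) =
      T₁.lTensor A (TensorProduct.assoc ℂ A A A (T₂ (c ⊗ₜ a) ⊗ₜ b))
  /-- Fullness: the smallest `V` with `Δ(A)(1 ⊗ A) ⊆ V ⊗ A` is `A`. -/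
  full_left : ∀ V : Submodule ℂ A,
    LinearMap.range T₁ ≤ LinearMap.range (V.subtype.rTensor A) → V = ⊤
  /-- Fullness: the smallest `W` with `(A ⊗ 1)Δ(A) ⊆ A ⊗ W` is `A`. -/
  full_right : ∀ W : Submodule ℂ A,
    LinearMap.range T₂ ≤ LinearMap.range (W.subtype.lTensor A) → W = ⊤
  /-- The counit. -/
  ε : A →ₗ[ℂ] ℂ
  counit_left : ∀ a b, sliceLeft ε (T₁ (a ⊗ₜ b)) = a * b
  counit_right : ∀ a b, sliceRight ε (T₂ (a ⊗ₜ b)) = a * b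
  /-- The canonical idempotent. -/
  E : Multiplier (A ⊗[ℂ] A)
  E_idem : E * E = E
  /-- `E(A ⊗ A) = T₁(A ⊗ A)`. -/
  range_T₁ : LinearMap.range E.left = LinearMap.range T₁
  /-- `(A ⊗ A)E = T₂(A ⊗ A)`. -/
  range_T₂ : LinearMap.range E.right = LinearMap.range T₂
  /-- `(ι ⊗ Δ)E = (E ⊗ 1)(1 ⊗ E)`, for the extension of `ι ⊗ Δ` to `M(A ⊗ A)`. -/
  idTensor_E : IsExtensionAt (idTensor (Δ : A →ₗ[ℂ] Multiplier (A ⊗[ℂ] A))) (leg23 E) E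
    (leg12 E * leg23 E)
  /-- `(E ⊗ 1)(1 ⊗ E) = (1 ⊗ E)(E ⊗ 1)`. -/
  E_comm : leg12 E * leg23 E = leg23 E * leg12 E
  /-- `(G₁ ⊗ ι)(Δ₁₃(a)(1 ⊗ b ⊗ c)) = Δ₁₃(a)(1 ⊗ E)(1 ⊗ b ⊗ c)`; here
  `Δ₁₃(a)(1 ⊗ b ⊗ c)` is `T₁` applied to the outer factors of `a ⊗ b ⊗ c`. -/
  G₁ : Module.End ℂ (A ⊗[ℂ] A)
  G₁_spec : ∀ a b c : A,
    TensorProduct.assoc ℂ A A A (G₁.rTensor A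
        ((TensorProduct.assoc ℂ A A A).symm (leg13 T₁ (a ⊗ₜ (b ⊗ₜ c))))) =
      leg13 T₁ (a ⊗ₜ E.left (b ⊗ₜ c))
  /-- `Ker T₁ = (1 - G₁)(A ⊗ A)`. -/
  ker_T₁ : LinearMap.ker T₁ = LinearMap.range (1 - G₁)
  /-- `(ι ⊗ G₂)((a ⊗ b ⊗ 1)Δ₁₃(c)) = (a ⊗ b ⊗ 1)(E ⊗ 1)Δ₁₃(c)`; here
  `(a ⊗ b ⊗ 1)Δ₁₃(c)` is `T₂` applied to the outer factors of `a ⊗ b ⊗ c`. -/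
  G₂ : Module.End ℂ (A ⊗[ℂ] A)
  G₂_spec : ∀ a b c : A,
    G₂.lTensor A (leg13 T₂ (a ⊗ₜ (b ⊗ₜ c))) =
      leg13 T₂ (TensorProduct.assoc ℂ A A A (E.right (a ⊗ₜ b) ⊗ₜ c))
  /-- `Ker T₂ = (1 - G₂)(A ⊗ A)`. -/
  ker_T₂ : LinearMap.ker T₂ = LinearMap.range (1 - G₂)

/-- `R` is the generalized inverse of `T` with `T R = P` and `R T = G`. It is unique. -/
def IsGeneralizedInverse {V : Type*} [AddCommGroup V] [Module ℂ V] (T P G R : Module.End ℂ V) :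
    Prop :=
  T * R = P ∧ R * T = G ∧ R * T * R = R

namespace WeakMultiplierHopfAlgebra

variable {A : Type*} [NonUnitalRing A] [Module ℂ A] [IsScalarTower ℂ A A] [SMulCommClass ℂ A A]

/-- `S : A → M(A)` is the antipode: with `R₁(a ⊗ b) = ∑ a₍₁₎ ⊗ S(a₍₂₎)b` and
`R₂(a ⊗ b) = ∑ a S(b₍₁₎) ⊗ b₍₂₎` the generalized inverses of `T₁` and `T₂` that belong to
`E`, `G₁` and `E`, `G₂`, it is given by `S(a)b = (ε ⊗ ι)R₁(a ⊗ b)` and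
`b S(a) = (ι ⊗ ε)R₂(b ⊗ a)`. -/
def IsAntipode (H : WeakMultiplierHopfAlgebra A) (S : A →ₗ[ℂ] Multiplier A) : Prop :=
  ∃ R₁ R₂ : Module.End ℂ (A ⊗[ℂ] A),
    IsGeneralizedInverse H.T₁ H.E.left H.G₁ R₁ ∧
    IsGeneralizedInverse H.T₂ H.E.right H.G₂ R₂ ∧
    (∀ a b, (S a).left b = sliceLeft H.ε (R₁ (a ⊗ₜ b))) ∧
    ∀ a b, (S a).right b = sliceRight H.ε (R₂ (b ⊗ₜ a))

/-- The antipode `S : A → M(A)`, the unique map with `IsAntipode`. -/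
def antipode (H : WeakMultiplierHopfAlgebra A) : A →ₗ[ℂ] Multiplier A :=
  Classical.epsilon H.IsAntipode

/-- The antipode on `M(A)`: the unique extension of `S` to an anti-homomorphism, that is, `S(m)`
is the multiplier with `S(m)S(a) = S(am)` and `S(a)S(m) = S(ma)` for all `a` in `A`. -/
def antipodeM (H : WeakMultiplierHopfAlgebra A) (m : Multiplier A) : Multiplier A :=
  Classical.epsilon fun z => ∀ a : A,
    z * H.antipode a = H.antipode (m.right a) ∧ H.antipode a * z = H.antipode (m.left a)

/-- The source map `ε_s(a) = (ι ⊗ ε)((1 ⊗ a)E) = ∑ S(a₍₁₎)a₍₂₎` in `M(A)`, that is,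
`b ε_s(a) = (ι ⊗ ε)((b ⊗ a)E)` for all `b` in `A`; this determines the multiplier. -/
def sourceMap (H : WeakMultiplierHopfAlgebra A) (a : A) : Multiplier A :=
  Classical.epsilon fun y => ∀ b : A, y.right b = sliceRight H.ε (H.E.right (b ⊗ₜ a))

/-- The source algebra `ε_s(A)`. -/
def sourceAlgebra (H : WeakMultiplierHopfAlgebra A) : Set (Multiplier A) :=
  Set.range H.sourceMap

end WeakMultiplierHopfAlgebra

section Modules

/-- The action of `M(B)` on a unital left `B`-module `V`: the multiplier `m` acts by the linear
map with `m (b x) = (m b) x` for all `b` in `B` and `x` in `V`. Such a map is unique because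
`B V = V`, and it exists when the module is non-degenerate. -/
def multiplierAct {B : Type*} [NonUnitalRing B] [Module ℂ B] [IsScalarTower ℂ B B]
    [SMulCommClass ℂ B B] {V : Type*} [AddCommGroup V] [Module ℂ V]
    (act : B →ₗ[ℂ] V →ₗ[ℂ] V) (m : Multiplier B) : V →ₗ[ℂ] V :=
  Classical.epsilon fun f : V →ₗ[ℂ] V => ∀ b x, f (act b x) = act (m.left b) x

/-- The action `(a ⊗ b)(r ⊗ s) = a r ⊗ b s` of `A ⊗ A` on `R ⊗ R`. -/
def tensorAct {A : Type*} [NonUnitalRing A] [Module ℂ A] {R : Type*} [AddCommGroup R]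
    [Module ℂ R] (act : A →ₗ[ℂ] R →ₗ[ℂ] R) :
    A ⊗[ℂ] A →ₗ[ℂ] R ⊗[ℂ] R →ₗ[ℂ] R ⊗[ℂ] R :=
  TensorProduct.homTensorHomMap (RingHom.id ℂ) R R R R ∘ₗ TensorProduct.map act act

variable {A : Type*} [NonUnitalRing A] [Module ℂ A] [IsScalarTower ℂ A A] [SMulCommClass ℂ A A]
variable {R : Type*} [NonUnitalRing R] [Module ℂ R] [IsScalarTower ℂ R R] [SMulCommClass ℂ R R]

/-- The algebra `R` is a left module algebra for the action `a ▷ r = act a r`: a unital left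
`A`-module with `a ▷ m(x ⊗ y) = m(Δ(a) ▷ (x ⊗ y))`, where `m` is the product of `R`. -/
structure IsModuleAlgebra (H : WeakMultiplierHopfAlgebra A) (act : A →ₗ[ℂ] R →ₗ[ℂ] R) :
    Prop where
  mul_act : ∀ a b r, act (a * b) r = act a (act b r)
  unital : Submodule.span ℂ {x : R | ∃ a r, x = act a r} = ⊤
  act_mul : ∀ a x y, act a (x * y) =
    LinearMap.mul' ℂ R (multiplierAct (tensorAct act) (H.Δ a) (x ⊗ₜ y))

end Modules

end WMHA

end

/-!
The extended action on `R` is governed by local units: every finite subset of `A` has a left unit.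
Once this is known, `Δ(a)E = Δ(a)` and the module algebra property give
`a ▷ m(E ▷ (r ⊗ r')) = a ▷ (rr')` for all `a`, hence the first identity, and the second one follows
by applying `E(y ⊗ 1) = E(1 ⊗ S(y))`, for `y = ε_s(p)`, inside `m(E ▷ ·)`.

All relations between `E`, `Gᵢ`, `Tᵢ` and `Rᵢ` are written as identities between operators on
`A ⊗ A ⊗ A`, so that they can be sliced by functionals. Coassociativity becomes the pentagon
`(T₂)₁₂ (T₁)₂₃ = (T₁)₂₃ (T₂)₁₂` together with pentagons for `T₁` and `T₂`, and
`E(y ⊗ 1) = E(1 ⊗ S(y))` comes from the pentagon for `T₂` and the behaviour of `E` under `Δ ⊗ ι`.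

For the local units, the pentagon for `T₁` shows that `ε_t(A)q` is finite-dimensional, so
`E(1 ⊗ q)` is a finite sum `∑ yᵢ ⊗ vᵢ` with `yᵢ ∈ ε_s(A)` and `vᵢ ∈ ε_t(A)q`, which gives
`q = ∑ S(yᵢ)vᵢ`. Since `T₁R₁ = E ·` and `R₁(A ⊗ q)` lies in `A ⊗ N` with `AN ⊆ Aq`, also
`ε_t(A)q ⊆ Aq`, and therefore `q ∈ Aq`.
-/

noncomputable section

namespace WMHA

section Slices

variable {K V V' W : Type*} [CommRing K] [AddCommGroup V] [Module K V] [AddCommGroup V']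
  [Module K V'] [AddCommGroup W] [Module K W] [Module.Free K W] {ι : Type*}

theorem eq_zero_of_forall_rTensor_eq_zero {g : ι → V →ₗ[K] V'}
    (hg : ∀ v, (∀ i, g i v = 0) → v = 0) {t : V ⊗[K] W} (ht : ∀ i, (g i).rTensor W t = 0) :
    t = 0 := by
  let b := Module.Free.chooseBasis K W
  have coeff_rTensor (i) (s : V ⊗[K] W) (k) :
      TensorProduct.equivFinsuppOfBasisRight b ((g i).rTensor W s) k =
        g i (TensorProduct.equivFinsuppOfBasisRight b s k) := by
    induction s with
    | zero => simp
    | add x y hx hy => simp only [map_add, Finsupp.add_apply, hx, hy]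
    | tmul v w => simp
  refine (TensorProduct.equivFinsuppOfBasisRight b).map_eq_zero_iff.1 (Finsupp.ext fun k => ?_)
  exact hg _ fun i => by rw [← coeff_rTensor, ht, map_zero, Finsupp.zero_apply]

theorem eq_zero_of_forall_lTensor_eq_zero {g : ι → V →ₗ[K] V'}
    (hg : ∀ v, (∀ i, g i v = 0) → v = 0) {t : W ⊗[K] V} (ht : ∀ i, (g i).lTensor W t = 0) :
    t = 0 := by
  refine (TensorProduct.comm K W V).map_eq_zero_iff.1
    (eq_zero_of_forall_rTensor_eq_zero hg fun i => ?_)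
  rw [← LinearMap.comm_comp_lTensor_comp_comm_eq]
  simp [ht]

end Slices

section Factorization

theorem exists_mul_eq_of_range_le {K V : Type*} [Field K] [AddCommGroup V] [Module K V]
    {P T : Module.End K V} (h : LinearMap.range P ≤ LinearMap.range T) : ∃ f, T * f = P := by
  obtain ⟨f, hf⟩ := Module.projective_lifting_property T.rangeRestrict
    (P.codRestrict _ fun v => h (LinearMap.mem_range_self P v)) T.surjective_rangeRestrict
  exact ⟨f, LinearMap.ext fun v => congrArg Subtype.val (LinearMap.congr_fun hf v)⟩

theorem exists_comp_eq_of_ker_le {R M N P : Type*} [Ring R] [AddCommGroup M] [AddCommGroup N]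
    [AddCommGroup P] [Module R M] [Module R N] [Module R P] {α : M →ₗ[R] N} {β : M →ₗ[R] P}
    (hα : Function.Surjective α) (h : LinearMap.ker α ≤ LinearMap.ker β) :
    ∃ f : N →ₗ[R] P, f ∘ₗ α = β :=
  ⟨(LinearMap.ker α).liftQ β h ∘ₗ (α.quotKerEquivOfSurjective hα).symm.toLinearMap,
    LinearMap.ext fun v => by
      rw [LinearMap.comp_assoc, LinearMap.comp_apply, LinearMap.comp_apply, LinearEquiv.coe_coe,
        (LinearEquiv.symm_apply_eq _).mpr (α.quotKerEquivOfSurjective_apply_mk hα v).symm,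
        Submodule.liftQ_apply]⟩

end Factorization

section Multipliers

variable {B : Type*} [NonUnitalRing B] [Module ℂ B] [IsScalarTower ℂ B B] [SMulCommClass ℂ B B]
variable {C : Type*} [NonUnitalRing C] [Module ℂ C] [IsScalarTower ℂ C C] [SMulCommClass ℂ C C]

namespace Multiplier

theorem left_apply_mul (m : Multiplier B) (a b : B) : m.left (a * b) = m.left a * b := m.2.1 a b

theorem right_apply_mul (m : Multiplier B) (a b : B) : m.right (a * b) = a * m.right b :=
  m.2.2.1 a b

theorem right_mul_eq_mul_left (m : Multiplier B) (a b : B) : m.right a * b = a * m.left b :=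
  m.2.2.2 a b

@[simp] theorem left_mul (m n : Multiplier B) : (m * n).left = m.left * n.left := rfl

@[simp] theorem right_mul (m n : Multiplier B) : (m * n).right = n.right * m.right := rfl

@[simp] theorem left_of (b : B) : (of B b).left = LinearMap.mulLeft ℂ b := rfl

@[simp] theorem right_of (b : B) : (of B b).right = LinearMap.mulRight ℂ b := rfl

@[simp] theorem left_tmul (m : Multiplier B) (n : Multiplier C) :
    (tmul m n).left = TensorProduct.map m.left n.left := rfl

@[simp] theorem right_tmul (m : Multiplier B) (n : Multiplier C) :
    (tmul m n).right = TensorProduct.map m.right n.right := rfl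

theorem ext {m n : Multiplier B} (hl : m.left = n.left) (hr : m.right = n.right) : m = n :=
  Subtype.ext (Prod.ext hl (MulOpposite.unop_injective hr))

theorem of_mul (m : Multiplier B) (b : B) : of B b * m = of B (m.right b) :=
  ext (LinearMap.ext fun c => (right_mul_eq_mul_left m b c).symm)
    (LinearMap.ext fun c => right_apply_mul m c b)

theorem mul_of (m : Multiplier B) (b : B) : m * of B b = of B (m.left b) :=
  ext (LinearMap.ext fun c => left_apply_mul m b c)
    (LinearMap.ext fun c => right_mul_eq_mul_left m c b)

theorem tmul_mul_tmul (m m' : Multiplier B) (n n' : Multiplier C) :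
    tmul m n * tmul m' n' = tmul (m * m') (n * n') :=
  ext (TensorProduct.map_mul _ _ _ _).symm (TensorProduct.map_mul _ _ _ _).symm

theorem commute_tmul_one_one_tmul (m : Multiplier B) (n : Multiplier C) :
    Commute (tmul m 1) (tmul 1 n) := by
  rw [commute_iff_eq, tmul_mul_tmul, tmul_mul_tmul, mul_one, one_mul, one_mul, mul_one]

theorem tmul_one_one : tmul (1 : Multiplier B) (1 : Multiplier C) = 1 :=
  ext TensorProduct.map_one TensorProduct.map_one

theorem tmul_of_of (b : B) (c : C) : tmul (of B b) (of C c) = of (B ⊗[ℂ] C) (b ⊗ₜ c) :=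
  ext (TensorProduct.ext' fun _ _ => by simp) (TensorProduct.ext' fun _ _ => by simp)

theorem one_tmul_of_mul (b : B) (c : C) :
    tmul 1 (of C c) * tmul (of B b) 1 = of (B ⊗[ℂ] C) (b ⊗ₜ c) := by
  rw [tmul_mul_tmul, one_mul, mul_one, tmul_of_of]

theorem transport_mul (e : B ≃ₗ[ℂ] C) (he) (m n : Multiplier B) :
    transport e he (m * n) = transport e he m * transport e he n :=
  ext (map_mul (e.conjAlgEquiv ℂ) m.left n.left) (map_mul (e.conjAlgEquiv ℂ) n.right m.right)

theorem transport_of (e : B ≃ₗ[ℂ] C) (he : ∀ x y, e (x * y) = e x * e y) (b : B) :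
    transport e he (of B b) = of C (e b) :=
  ext (LinearMap.ext fun c => (he b (e.symm c)).trans (by simp))
    (LinearMap.ext fun c => (he (e.symm c) b).trans (by simp))

/-- Transport of multipliers along an isomorphism of algebras, as a linear map. -/
def transportₗ (e : B ≃ₗ[ℂ] C) (he : ∀ x y, e (x * y) = e x * e y) :
    Multiplier B →ₗ[ℂ] Multiplier C where
  toFun := transport e he
  map_add' m n := ext (map_add e.conj m.left n.left) (map_add e.conj m.right n.right)
  map_smul' z m := ext (map_smul e.conj z m.left) (map_smul e.conj z m.right)

end Multiplier

/-- Non-degeneracy of the product of an algebra: neither left nor right multiplication by a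
non-zero element vanishes identically. -/
structure NonDegenerate (B : Type*) [NonUnitalRing B] : Prop where
  left : ∀ a : B, (∀ b, a * b = 0) → a = 0
  right : ∀ a : B, (∀ b, b * a = 0) → a = 0

namespace NonDegenerate

theorem eq_of_forall_mul_right {B : Type*} [NonUnitalRing B] (hB : NonDegenerate B) {a b : B}
    (h : ∀ c, a * c = b * c) : a = b :=
  sub_eq_zero.1 (hB.left _ fun c => by rw [sub_mul, h, sub_self])

theorem eq_of_forall_mul_left {B : Type*} [NonUnitalRing B] (hB : NonDegenerate B) {a b : B}
    (h : ∀ c, c * a = c * b) : a = b :=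
  sub_eq_zero.1 (hB.right _ fun c => by rw [mul_sub, h, sub_self])

variable (hB : NonDegenerate B)
include hB

theorem of_injective : Function.Injective (Multiplier.of B) := fun _ _ h =>
  hB.eq_of_forall_mul_right (LinearMap.congr_fun (congrArg Multiplier.left h))

theorem multiplier_ext_left {m n : Multiplier B} (h : m.left = n.left) : m = n :=
  Multiplier.ext h (LinearMap.ext fun b => hB.eq_of_forall_mul_right fun c => by
    rw [Multiplier.right_mul_eq_mul_left, Multiplier.right_mul_eq_mul_left, h])

theorem multiplier_ext_right {m n : Multiplier B} (h : m.right = n.right) : m = n :=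
  Multiplier.ext (LinearMap.ext fun b => hB.eq_of_forall_mul_left fun c => by
    rw [← Multiplier.right_mul_eq_mul_left, ← Multiplier.right_mul_eq_mul_left, h]) h

theorem multiplier_eq_of_forall_of_mul {m n : Multiplier B}
    (h : ∀ b, Multiplier.of B b * m = Multiplier.of B b * n) : m = n :=
  hB.multiplier_ext_right (LinearMap.ext fun b => hB.of_injective (by
    rw [← Multiplier.of_mul, ← Multiplier.of_mul, h]))

theorem multiplier_eq_of_forall_mul_of {m n : Multiplier B}
    (h : ∀ b, m * Multiplier.of B b = n * Multiplier.of B b) : m = n :=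
  hB.multiplier_ext_left (LinearMap.ext fun b => hB.of_injective (by
    rw [← Multiplier.mul_of, ← Multiplier.mul_of, h]))

theorem commute_left_right (m n : Multiplier B) : Commute m.left n.right :=
  LinearMap.ext fun b => hB.eq_of_forall_mul_right fun c => hB.eq_of_forall_mul_left fun d => by
    simp only [Module.End.mul_apply]
    rw [← Multiplier.left_apply_mul, Multiplier.right_mul_eq_mul_left,
      Multiplier.right_mul_eq_mul_left, Multiplier.left_apply_mul]

theorem tensor (hC : NonDegenerate C) : NonDegenerate (B ⊗[ℂ] C) where
  left t ht := by
    refine eq_zero_of_forall_lTensor_eq_zero (g := LinearMap.mulRight ℂ) hC.left fun c =>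
      eq_zero_of_forall_rTensor_eq_zero (g := LinearMap.mulRight ℂ) hB.left fun b => ?_
    rw [← ht (b ⊗ₜ c), ← LinearMap.comp_apply, LinearMap.rTensor_comp_lTensor]
    exact LinearMap.congr_fun
      (congrArg Multiplier.right (Multiplier.tmul_of_of b c)) t
  right t ht := by
    refine eq_zero_of_forall_lTensor_eq_zero (g := LinearMap.mulLeft ℂ) hC.right fun c =>
      eq_zero_of_forall_rTensor_eq_zero (g := LinearMap.mulLeft ℂ) hB.right fun b => ?_
    rw [← ht (b ⊗ₜ c), ← LinearMap.comp_apply, LinearMap.rTensor_comp_lTensor]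
    exact LinearMap.congr_fun
      (congrArg Multiplier.left (Multiplier.tmul_of_of b c)) t

omit hB

theorem eq_of_forall_of_tmul_one_mul (hBC : NonDegenerate (B ⊗[ℂ] C))
    {m n : Multiplier (B ⊗[ℂ] C)}
    (h : ∀ b, Multiplier.tmul (Multiplier.of B b) 1 * m =
      Multiplier.tmul (Multiplier.of B b) 1 * n) : m = n := by
  refine hBC.multiplier_eq_of_forall_of_mul fun t => ?_
  induction t with
  | zero => simp only [map_zero, zero_mul]
  | add x y hx hy => simp only [map_add, add_mul, hx, hy]
  | tmul b c =>
    rw [← Multiplier.one_tmul_of_mul, mul_assoc, mul_assoc, h]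

theorem eq_of_forall_mul_one_tmul_of (hBC : NonDegenerate (B ⊗[ℂ] C))
    {m n : Multiplier (B ⊗[ℂ] C)}
    (h : ∀ c, m * Multiplier.tmul 1 (Multiplier.of C c) =
      n * Multiplier.tmul 1 (Multiplier.of C c)) : m = n := by
  refine hBC.multiplier_eq_of_forall_mul_of fun t => ?_
  induction t with
  | zero => simp only [map_zero, mul_zero]
  | add x y hx hy => simp only [map_add, mul_add, hx, hy]
  | tmul b c =>
    rw [← Multiplier.one_tmul_of_mul, ← mul_assoc, ← mul_assoc, h]

end NonDegenerate

end Multipliers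

section LegOperators

variable {A : Type*} [AddCommGroup A] [Module ℂ A]

/-- Operators on `A ⊗ A`, acting on the first two factors of `A ⊗ A ⊗ A`. -/
def op12 : Module.End ℂ (A ⊗[ℂ] A) →ₐ[ℂ] Module.End ℂ (A ⊗[ℂ] (A ⊗[ℂ] A)) :=
  ((TensorProduct.assoc ℂ A A A).conjAlgEquiv ℂ).toAlgHom.comp
    (Module.End.rTensorAlgHom ℂ (A ⊗[ℂ] A) A)

/-- Operators on `A ⊗ A`, acting on the last two factors of `A ⊗ A ⊗ A`. -/
def op23 : Module.End ℂ (A ⊗[ℂ] A) →ₐ[ℂ] Module.End ℂ (A ⊗[ℂ] (A ⊗[ℂ] A)) :=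
  Module.End.lTensorAlgHom ℂ (A ⊗[ℂ] A) A

theorem op12_assoc (T : Module.End ℂ (A ⊗[ℂ] A)) (t : (A ⊗[ℂ] A) ⊗[ℂ] A) :
    op12 T (TensorProduct.assoc ℂ A A A t) = TensorProduct.assoc ℂ A A A (T.rTensor A t) :=
  congrArg (fun s => TensorProduct.assoc ℂ A A A (T.rTensor A s)) (by simp)

@[simp] theorem op12_tmul (T : Module.End ℂ (A ⊗[ℂ] A)) (a b c : A) :
    op12 T (a ⊗ₜ (b ⊗ₜ c)) = TensorProduct.assoc ℂ A A A (T (a ⊗ₜ b) ⊗ₜ c) :=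
  op12_assoc T ((a ⊗ₜ b) ⊗ₜ c)

@[simp] theorem op23_tmul (T : Module.End ℂ (A ⊗[ℂ] A)) (a : A) (t : A ⊗[ℂ] A) :
    op23 T (a ⊗ₜ t) = a ⊗ₜ T t := rfl

end LegOperators

section Legs

variable {A : Type*} [NonUnitalRing A] [Module ℂ A] [IsScalarTower ℂ A A] [SMulCommClass ℂ A A]

@[simp] theorem left_leg12 (F : Multiplier (A ⊗[ℂ] A)) : (leg12 F).left = op12 F.left := rfl

@[simp] theorem right_leg12 (F : Multiplier (A ⊗[ℂ] A)) : (leg12 F).right = op12 F.right := rfl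

@[simp] theorem left_leg23 (F : Multiplier (A ⊗[ℂ] A)) : (leg23 F).left = op23 F.left := rfl

@[simp] theorem right_leg23 (F : Multiplier (A ⊗[ℂ] A)) : (leg23 F).right = op23 F.right := rfl

theorem leg12_mul (F G : Multiplier (A ⊗[ℂ] A)) : leg12 (F * G) = leg12 F * leg12 G :=
  Multiplier.ext (map_mul op12 F.left G.left) (map_mul op12 G.right F.right)

theorem leg23_mul (F G : Multiplier (A ⊗[ℂ] A)) : leg23 (F * G) = leg23 F * leg23 G :=
  Multiplier.ext (map_mul op23 F.left G.left) (map_mul op23 G.right F.right)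

theorem transport_assoc_tmul (k m n : Multiplier A) :
    Multiplier.transport (TensorProduct.assoc ℂ A A A) (assoc_mul A)
      (Multiplier.tmul (Multiplier.tmul k m) n) = Multiplier.tmul k (Multiplier.tmul m n) :=
  Multiplier.ext (TensorProduct.ext_threefold' fun _ _ _ => rfl)
    (TensorProduct.ext_threefold' fun _ _ _ => rfl)

/-- The multiplier `c ⊗ 1 ⊗ 1`. -/
def inFirst (c : A) : Multiplier (A ⊗[ℂ] (A ⊗[ℂ] A)) :=
  Multiplier.tmul (Multiplier.of A c) 1

/-- The multiplier `1 ⊗ 1 ⊗ b`. -/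
def inThird (b : A) : Multiplier (A ⊗[ℂ] (A ⊗[ℂ] A)) :=
  Multiplier.tmul 1 (Multiplier.tmul 1 (Multiplier.of A b))

theorem inThird_eq_transport (b : A) :
    inThird b = Multiplier.transport (TensorProduct.assoc ℂ A A A) (assoc_mul A)
      (Multiplier.tmul 1 (Multiplier.of A b)) := by
  rw [← Multiplier.tmul_one_one, transport_assoc_tmul, inThird]

theorem inFirst_eq_leg12 (c : A) :
    inFirst c = leg12 (Multiplier.tmul (Multiplier.of A c) 1) := by
  rw [leg12, transport_assoc_tmul, Multiplier.tmul_one_one, inFirst]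

theorem commute_inFirst_leg23 (c : A) (F : Multiplier (A ⊗[ℂ] A)) :
    Commute (inFirst c) (leg23 F) :=
  Multiplier.commute_tmul_one_one_tmul _ _

theorem leg12_mul_inThird (F : Multiplier (A ⊗[ℂ] A)) (b : A) :
    leg12 F * inThird b = Multiplier.transport (TensorProduct.assoc ℂ A A A) (assoc_mul A)
      (Multiplier.tmul F (Multiplier.of A b)) := by
  rw [leg12, inThird_eq_transport, ← Multiplier.transport_mul, Multiplier.tmul_mul_tmul, mul_one,
    one_mul]

theorem commute_leg12_inThird (F : Multiplier (A ⊗[ℂ] A)) (b : A) :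
    Commute (leg12 F) (inThird b) := by
  rw [commute_iff_eq, leg12, inThird_eq_transport, ← Multiplier.transport_mul,
    Multiplier.commute_tmul_one_one_tmul, Multiplier.transport_mul]

theorem inThird_mul_inThird (a b : A) : inThird a * inThird b = inThird (a * b) := by
  simp only [inThird, Multiplier.tmul_mul_tmul, mul_one, Multiplier.mul_of, Multiplier.left_of,
    LinearMap.mulLeft_apply]

theorem of_assoc_tmul (t : A ⊗[ℂ] A) (c : A) :
    Multiplier.of _ (TensorProduct.assoc ℂ A A A (t ⊗ₜ c)) =
      leg12 (Multiplier.of (A ⊗[ℂ] A) t) * inThird c := by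
  rw [leg12_mul_inThird, Multiplier.tmul_of_of, Multiplier.transport_of]

theorem of_tmul (a : A) (t : A ⊗[ℂ] A) :
    Multiplier.of (A ⊗[ℂ] (A ⊗[ℂ] A)) (a ⊗ₜ t) =
      inFirst a * leg23 (Multiplier.of (A ⊗[ℂ] A) t) := by
  rw [commute_inFirst_leg23, leg23, inFirst, Multiplier.one_tmul_of_mul]

/-- The map `Δ ⊗ ι : A ⊗ A → M(A ⊗ A ⊗ A)`, the companion of `idTensor`. -/
def tensorId (Δ : A →ₗ[ℂ] Multiplier (A ⊗[ℂ] A)) :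
    A ⊗[ℂ] A →ₗ[ℂ] Multiplier (A ⊗[ℂ] (A ⊗[ℂ] A)) :=
  Multiplier.transportₗ (TensorProduct.assoc ℂ A A A) (assoc_mul A) ∘ₗ
    TensorProduct.lift ((Multiplier.tmulₗ (A ⊗[ℂ] A) A).compl₁₂ Δ (Multiplier.of A))

end Legs

namespace WeakMultiplierHopfAlgebra

variable {A : Type*} [NonUnitalRing A] [Module ℂ A] [IsScalarTower ℂ A A] [SMulCommClass ℂ A A]

section Comultiplication

variable (H : WeakMultiplierHopfAlgebra A)

include H in
theorem nondeg : NonDegenerate A := ⟨H.left_nondeg, H.right_nondeg⟩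

include H in
theorem nondeg₂ : NonDegenerate (A ⊗[ℂ] A) := H.nondeg.tensor H.nondeg

include H in
theorem nondeg₃ : NonDegenerate (A ⊗[ℂ] (A ⊗[ℂ] A)) := H.nondeg.tensor H.nondeg₂

/-- The coproduct as a linear map. -/
abbrev Δₗ : A →ₗ[ℂ] Multiplier (A ⊗[ℂ] A) := (H.Δ : A →ₗ[ℂ] Multiplier (A ⊗[ℂ] A))

theorem tensorId_tmul (a b : A) : tensorId H.Δₗ (a ⊗ₜ b) = leg12 (H.Δ a) * inThird b := by
  rw [leg12_mul_inThird]
  rfl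

theorem idTensor_tmul (a b : A) : idTensor H.Δₗ (a ⊗ₜ b) = inFirst a * leg23 (H.Δ b) := by
  rw [inFirst, leg23, Multiplier.tmul_mul_tmul, mul_one, one_mul]
  rfl

theorem E_left_mul_T₁ : H.E.left * H.T₁ = H.T₁ := by
  refine LinearMap.ext fun t => ?_
  obtain ⟨s, hs⟩ : H.T₁ t ∈ LinearMap.range H.E.left := H.range_T₁ ▸ LinearMap.mem_range_self _ t
  rw [Module.End.mul_apply, ← hs, ← Module.End.mul_apply, ← Multiplier.left_mul, H.E_idem]

theorem E_right_mul_T₂ : H.E.right * H.T₂ = H.T₂ := by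
  refine LinearMap.ext fun t => ?_
  obtain ⟨s, hs⟩ : H.T₂ t ∈ LinearMap.range H.E.right := H.range_T₂ ▸ LinearMap.mem_range_self _ t
  rw [Module.End.mul_apply, ← hs, ← Module.End.mul_apply, ← Multiplier.right_mul, H.E_idem]

theorem exists_T₁_mul_eq_E_left : ∃ f, H.T₁ * f = H.E.left :=
  exists_mul_eq_of_range_le H.range_T₁.le

theorem exists_T₂_mul_eq_E_right : ∃ f, H.T₂ * f = H.E.right :=
  exists_mul_eq_of_range_le H.range_T₂.le

theorem E_mul_Δ (a : A) : H.E * H.Δ a = H.Δ a :=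
  NonDegenerate.eq_of_forall_mul_one_tmul_of H.nondeg₂ fun b => by
    rw [mul_assoc, ← H.T₁_spec, Multiplier.mul_of, ← Module.End.mul_apply, H.E_left_mul_T₁]

theorem Δ_mul_E (a : A) : H.Δ a * H.E = H.Δ a :=
  NonDegenerate.eq_of_forall_of_tmul_one_mul H.nondeg₂ fun b => by
    rw [← mul_assoc, ← H.T₂_spec, Multiplier.of_mul, ← Module.End.mul_apply, H.E_right_mul_T₂]

theorem leg12_E_mul_tensorId (t : A ⊗[ℂ] A) :
    leg12 H.E * tensorId H.Δₗ t = tensorId H.Δₗ t := by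
  induction t with
  | zero => simp only [map_zero, mul_zero]
  | add x y hx hy => simp only [map_add, mul_add, hx, hy]
  | tmul a b => rw [tensorId_tmul, ← mul_assoc, ← leg12_mul, E_mul_Δ]

theorem tensorId_mul_leg12_E (t : A ⊗[ℂ] A) :
    tensorId H.Δₗ t * leg12 H.E = tensorId H.Δₗ t := by
  induction t with
  | zero => simp only [map_zero, zero_mul]
  | add x y hx hy => simp only [map_add, add_mul, hx, hy]
  | tmul a b =>
    rw [tensorId_tmul, (commute_leg12_inThird _ b).eq, mul_assoc, ← leg12_mul, Δ_mul_E]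

theorem leg23_E_mul_idTensor (t : A ⊗[ℂ] A) :
    leg23 H.E * idTensor H.Δₗ t = idTensor H.Δₗ t := by
  induction t with
  | zero => simp only [map_zero, mul_zero]
  | add x y hx hy => simp only [map_add, mul_add, hx, hy]
  | tmul a b =>
    rw [idTensor_tmul, (commute_inFirst_leg23 a _).eq, ← mul_assoc, ← leg23_mul, E_mul_Δ]

theorem idTensor_mul_leg23_E (t : A ⊗[ℂ] A) :
    idTensor H.Δₗ t * leg23 H.E = idTensor H.Δₗ t := by
  induction t with
  | zero => simp only [map_zero, zero_mul]
  | add x y hx hy => simp only [map_add, add_mul, hx, hy]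
  | tmul a b => rw [idTensor_tmul, mul_assoc, ← leg23_mul, Δ_mul_E]

theorem of_op23_T₁_assoc_tmul (t : A ⊗[ℂ] A) (b : A) :
    Multiplier.of _ (op23 H.T₁ (TensorProduct.assoc ℂ A A A (t ⊗ₜ b))) =
      idTensor H.Δₗ t * inThird b := by
  induction t with
  | zero => simp only [map_zero, zero_mul, TensorProduct.zero_tmul]
  | add x y hx hy => simp only [map_add, add_mul, TensorProduct.add_tmul, hx, hy]
  | tmul a c =>
    rw [TensorProduct.assoc_tmul, op23_tmul, of_tmul, T₁_spec, idTensor_tmul, mul_assoc,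
      leg23_mul]
    rfl

theorem of_op12_T₂_tmul (c : A) (t : A ⊗[ℂ] A) :
    Multiplier.of _ (op12 H.T₂ (c ⊗ₜ t)) = inFirst c * tensorId H.Δₗ t := by
  induction t with
  | zero => simp only [map_zero, mul_zero, TensorProduct.tmul_zero]
  | add x y hx hy => simp only [map_add, mul_add, TensorProduct.tmul_add, hx, hy]
  | tmul a b =>
    rw [op12_tmul, of_assoc_tmul, T₂_spec, tensorId_tmul, ← mul_assoc, inFirst_eq_leg12,
      ← leg12_mul]

theorem of_op12_T₁_leftComm (b : A) (t : A ⊗[ℂ] A) :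
    Multiplier.of _ (op12 H.T₁ (TensorProduct.leftComm ℂ A A A (b ⊗ₜ t))) =
      tensorId H.Δₗ t * leg12 (Multiplier.tmul 1 (Multiplier.of A b)) := by
  induction t with
  | zero => simp only [map_zero, zero_mul, TensorProduct.tmul_zero]
  | add x y hx hy => simp only [map_add, add_mul, TensorProduct.tmul_add, hx, hy]
  | tmul a c =>
    rw [TensorProduct.leftComm_tmul, op12_tmul, of_assoc_tmul, T₁_spec, tensorId_tmul, leg12_mul,
      mul_assoc, mul_assoc, (commute_leg12_inThird _ c).eq]

theorem of_op23_T₂_leftComm (p : A) (t : A ⊗[ℂ] A) :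
    Multiplier.of _ (op23 H.T₂ (TensorProduct.leftComm ℂ A A A (p ⊗ₜ t))) =
      leg23 (Multiplier.tmul (Multiplier.of A p) 1) * idTensor H.Δₗ t := by
  induction t with
  | zero => simp only [map_zero, mul_zero, TensorProduct.tmul_zero]
  | add x y hx hy => simp only [map_add, mul_add, TensorProduct.tmul_add, hx, hy]
  | tmul a c =>
    rw [TensorProduct.leftComm_tmul, op23_tmul, of_tmul, T₂_spec, idTensor_tmul, leg23_mul,
      ← mul_assoc, ← mul_assoc, (commute_inFirst_leg23 a _).eq]

theorem mul_leg12_E_eq_of_forall_mul_tensorId {m n : Multiplier (A ⊗[ℂ] (A ⊗[ℂ] A))}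
    (h : ∀ t, m * tensorId H.Δₗ t = n * tensorId H.Δₗ t) : m * leg12 H.E = n * leg12 H.E := by
  have mul_of_op12_T₁ (x) : m * Multiplier.of _ (op12 H.T₁ x) =
      n * Multiplier.of _ (op12 H.T₁ x) := by
    obtain ⟨x, rfl⟩ := (TensorProduct.leftComm ℂ A A A).surjective x
    induction x with
    | zero => simp only [map_zero, mul_zero]
    | add x y hx hy => simp only [map_add, mul_add, hx, hy]
    | tmul b t => rw [of_op12_T₁_leftComm, ← mul_assoc, h, mul_assoc]
  obtain ⟨f, hf⟩ := H.exists_T₁_mul_eq_E_left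
  refine H.nondeg₃.multiplier_eq_of_forall_mul_of fun x => ?_
  rw [mul_assoc, mul_assoc, Multiplier.mul_of, left_leg12, ← hf, map_mul, Module.End.mul_apply,
    mul_of_op12_T₁]

theorem leg23_E_mul_eq_of_forall_idTensor_mul {m n : Multiplier (A ⊗[ℂ] (A ⊗[ℂ] A))}
    (h : ∀ t, idTensor H.Δₗ t * m = idTensor H.Δₗ t * n) : leg23 H.E * m = leg23 H.E * n := by
  have of_op23_T₂_mul (x) : Multiplier.of _ (op23 H.T₂ x) * m =
      Multiplier.of _ (op23 H.T₂ x) * n := by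
    obtain ⟨x, rfl⟩ := (TensorProduct.leftComm ℂ A A A).surjective x
    induction x with
    | zero => simp only [map_zero, zero_mul]
    | add x y hx hy => simp only [map_add, add_mul, hx, hy]
    | tmul p t => rw [of_op23_T₂_leftComm, mul_assoc, h, mul_assoc]
  obtain ⟨f, hf⟩ := H.exists_T₂_mul_eq_E_right
  refine H.nondeg₃.multiplier_eq_of_forall_of_mul fun x => ?_
  rw [← mul_assoc, ← mul_assoc, Multiplier.of_mul, right_leg23, ← hf, map_mul,
    Module.End.mul_apply, of_op23_T₂_mul]

theorem commute_op12_T₂_op23_T₁ : Commute (op12 H.T₂) (op23 H.T₁) :=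
  TensorProduct.ext_threefold' fun c a b => H.coassoc a b c

theorem idTensor_E_left (t : A ⊗[ℂ] A) :
    idTensor H.Δₗ (H.E.left t) = leg12 H.E * idTensor H.Δₗ t := by
  rw [← H.idTensor_E.2.2.1, mul_assoc, leg23_E_mul_idTensor]

theorem idTensor_E_right (t : A ⊗[ℂ] A) :
    idTensor H.Δₗ (H.E.right t) = idTensor H.Δₗ t * leg12 H.E := by
  rw [← H.idTensor_E.2.2.2, E_comm, ← mul_assoc, idTensor_mul_leg23_E]

theorem idTensor_mul_tensorId (t s : A ⊗[ℂ] A) :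
    idTensor H.Δₗ (H.E.right t) * tensorId H.Δₗ s = idTensor H.Δₗ t * tensorId H.Δₗ s := by
  rw [idTensor_E_right, mul_assoc, leg12_E_mul_tensorId]

theorem tensorId_mul (s t : A ⊗[ℂ] A) :
    tensorId H.Δₗ (s * t) = tensorId H.Δₗ s * tensorId H.Δₗ t := by
  induction s with
  | zero => simp only [map_zero, zero_mul]
  | add x y hx hy => simp only [map_add, add_mul, hx, hy]
  | tmul a b =>
    induction t with
    | zero => simp only [map_zero, mul_zero]
    | add x y hx hy => simp only [map_add, mul_add, hx, hy]
    | tmul c d =>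
      rw [Algebra.TensorProduct.tmul_mul_tmul, tensorId_tmul, tensorId_tmul, tensorId_tmul,
        map_mul, leg12_mul, ← inThird_mul_inThird,
        ((commute_leg12_inThird (H.Δ c) b).symm).mul_mul_mul_comm]

theorem left_Δ_tmul (a p b : A) :
    (H.Δ a).left (p ⊗ₜ b) = (LinearMap.mulRight ℂ p).rTensor A (H.T₁ (a ⊗ₜ b)) :=
  H.nondeg₂.of_injective (by
    rw [← Multiplier.mul_of, ← Multiplier.one_tmul_of_mul, ← mul_assoc, ← T₁_spec,
      Multiplier.of_mul]
    rfl)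

theorem right_Δ_tmul (a c d : A) :
    (H.Δ a).right (c ⊗ₜ d) = (LinearMap.mulLeft ℂ d).lTensor A (H.T₂ (c ⊗ₜ a)) :=
  H.nondeg₂.of_injective (by
    rw [← Multiplier.of_mul, ← Multiplier.one_tmul_of_mul, mul_assoc, ← T₂_spec,
      Multiplier.mul_of]
    rfl)

theorem tensorId_mul_leg12_Δ (t : A ⊗[ℂ] A) (p : A) :
    tensorId H.Δₗ t * leg12 (H.Δ p) = tensorId H.Δₗ ((LinearMap.mulRight ℂ p).rTensor A t) := by
  induction t with
  | zero => simp only [map_zero, zero_mul]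
  | add x y hx hy => simp only [map_add, add_mul, hx, hy]
  | tmul a b =>
    rw [LinearMap.rTensor_tmul, LinearMap.mulRight_apply, tensorId_tmul, tensorId_tmul, map_mul,
      leg12_mul, mul_assoc, mul_assoc, (commute_leg12_inThird _ b).eq]

theorem idTensor_T₂_mul_inThird (c a b : A) :
    idTensor H.Δₗ (H.T₂ (c ⊗ₜ a)) * inThird b = inFirst c * tensorId H.Δₗ (H.T₁ (a ⊗ₜ b)) := by
  rw [← of_op23_T₁_assoc_tmul, ← of_op12_T₂_tmul, ← op12_tmul, ← op23_tmul,
    ← Module.End.mul_apply, ← Module.End.mul_apply, H.commute_op12_T₂_op23_T₁.eq]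

theorem idTensor_T₂_mul_tensorId (c a : A) (t : A ⊗[ℂ] A) :
    idTensor H.Δₗ (H.T₂ (c ⊗ₜ a)) * tensorId H.Δₗ t =
      inFirst c * tensorId H.Δₗ ((H.Δ a).left t) := by
  induction t with
  | zero => simp only [map_zero, mul_zero]
  | add x y hx hy => simp only [map_add, mul_add, hx, hy]
  | tmul p b =>
    rw [tensorId_tmul, (commute_leg12_inThird _ b).eq, ← mul_assoc, idTensor_T₂_mul_inThird,
      mul_assoc, tensorId_mul_leg12_Δ, left_Δ_tmul]

theorem leg23_E_mul_tensorId_E_left (t : A ⊗[ℂ] A) :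
    leg23 H.E * tensorId H.Δₗ (H.E.left t) = tensorId H.Δₗ (H.E.left t) := by
  have E_mul_T₂_mul_T₁ : op23 H.E.left * (op12 H.T₂ * op23 H.T₁) = op12 H.T₂ * op23 H.T₁ := by
    rw [H.commute_op12_T₂_op23_T₁.eq, ← mul_assoc, ← map_mul, E_left_mul_T₁]
  obtain ⟨f, hf⟩ := H.exists_T₁_mul_eq_E_left
  rw [← LinearMap.congr_fun hf t, Module.End.mul_apply]
  refine NonDegenerate.eq_of_forall_of_tmul_one_mul H.nondeg₃ fun c => ?_
  change inFirst c * _ = inFirst c * _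
  rw [← mul_assoc, (commute_inFirst_leg23 c _).eq, mul_assoc, ← of_op12_T₂_tmul,
    Multiplier.mul_of]
  exact congrArg (Multiplier.of _) (LinearMap.congr_fun E_mul_T₂_mul_T₁ (c ⊗ₜ f t))

theorem idTensor_mul_tensorId_E_left (s t : A ⊗[ℂ] A) :
    idTensor H.Δₗ s * tensorId H.Δₗ (H.E.left t) = idTensor H.Δₗ s * tensorId H.Δₗ t := by
  obtain ⟨f, hf⟩ := H.exists_T₂_mul_eq_E_right
  rw [← idTensor_mul_tensorId, ← idTensor_mul_tensorId H s t, ← hf, Module.End.mul_apply]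
  induction f s with
  | zero => simp only [map_zero, zero_mul]
  | add x y hx hy => simp only [map_add, add_mul, hx, hy]
  | tmul c a =>
    rw [idTensor_T₂_mul_tensorId, idTensor_T₂_mul_tensorId, ← Module.End.mul_apply,
      ← Multiplier.left_mul, Δ_mul_E]

theorem tensorId_E_left (t : A ⊗[ℂ] A) :
    tensorId H.Δₗ (H.E.left t) = leg23 H.E * tensorId H.Δₗ t := by
  rw [← leg23_E_mul_tensorId_E_left]
  refine H.leg23_E_mul_eq_of_forall_idTensor_mul fun s => ?_
  exact H.idTensor_mul_tensorId_E_left s t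

theorem tensorId_E_right (t : A ⊗[ℂ] A) :
    tensorId H.Δₗ (H.E.right t) = tensorId H.Δₗ t * leg23 H.E := by
  have mul_tensorId (s) : tensorId H.Δₗ (H.E.right t) * tensorId H.Δₗ s =
      tensorId H.Δₗ t * leg23 H.E * tensorId H.Δₗ s := by
    rw [← tensorId_mul, Multiplier.right_mul_eq_mul_left, tensorId_mul, tensorId_E_left, mul_assoc]
  rw [← H.tensorId_mul_leg12_E, H.mul_leg12_E_eq_of_forall_mul_tensorId mul_tensorId, mul_assoc,
    ← H.E_comm, ← mul_assoc, tensorId_mul_leg12_E]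

theorem commute_op12_T₂_op23_E_left : Commute (op12 H.T₂) (op23 H.E.left) :=
  TensorProduct.ext' fun c t => H.nondeg₃.of_injective (by
    rw [Module.End.mul_apply, Module.End.mul_apply, op23_tmul, of_op12_T₂_tmul, tensorId_E_left,
      ← mul_assoc, (commute_inFirst_leg23 c _).eq, mul_assoc, ← of_op12_T₂_tmul,
      Multiplier.mul_of, left_leg23])

theorem commute_op12_T₂_op23_E_right : Commute (op12 H.T₂) (op23 H.E.right) :=
  TensorProduct.ext' fun c t => H.nondeg₃.of_injective (by
    rw [Module.End.mul_apply, Module.End.mul_apply, op23_tmul, of_op12_T₂_tmul, tensorId_E_right,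
      ← mul_assoc, ← of_op12_T₂_tmul, Multiplier.of_mul, right_leg23])

theorem commute_op12_E_left_op23_T₁ : Commute (op12 H.E.left) (op23 H.T₁) :=
  TensorProduct.ext_threefold' fun a b c => H.nondeg₃.of_injective (by
    rw [Module.End.mul_apply, Module.End.mul_apply, op12_tmul, of_op23_T₁_assoc_tmul,
      idTensor_E_left, mul_assoc, ← of_op23_T₁_assoc_tmul, Multiplier.mul_of, left_leg12,
      TensorProduct.assoc_tmul])

theorem commute_op12_E_right_op23_T₁ : Commute (op12 H.E.right) (op23 H.T₁) :=
  TensorProduct.ext_threefold' fun a b c => H.nondeg₃.of_injective (by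
    rw [Module.End.mul_apply, Module.End.mul_apply, op12_tmul, of_op23_T₁_assoc_tmul,
      idTensor_E_right, mul_assoc, (commute_leg12_inThird _ c).eq, ← mul_assoc,
      ← of_op23_T₁_assoc_tmul, Multiplier.of_mul, right_leg12, TensorProduct.assoc_tmul])

theorem commute_op12_E_left_op23_E_left : Commute (op12 H.E.left) (op23 H.E.left) :=
  congrArg Multiplier.left H.E_comm

theorem commute_op12_E_right_op23_E_right : Commute (op12 H.E.right) (op23 H.E.right) :=
  congrArg Multiplier.right H.E_comm.symm

end Comultiplication

end WeakMultiplierHopfAlgebra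

namespace IsGeneralizedInverse

variable {V : Type*} [AddCommGroup V] [Module ℂ V] {T P G R : Module.End ℂ V}

theorem mul_left_eq (h : IsGeneralizedInverse T P G R) : G * R = R := by
  rw [← h.2.1, h.2.2]

theorem mul_right_eq (h : IsGeneralizedInverse T P G R) : R * P = R := by
  rw [← h.1, ← mul_assoc, h.2.2]

theorem map {W : Type*} [AddCommGroup W] [Module ℂ W] (h : IsGeneralizedInverse T P G R)
    (φ : Module.End ℂ V →ₐ[ℂ] Module.End ℂ W) :
    IsGeneralizedInverse (φ T) (φ P) (φ G) (φ R) :=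
  ⟨by rw [← map_mul, h.1], by rw [← map_mul, h.2.1], by rw [← map_mul, ← map_mul, h.2.2]⟩

theorem commute (h : IsGeneralizedInverse T P G R) {X : Module.End ℂ V} (hT : Commute X T)
    (hP : Commute X P) (hG : Commute X G) : Commute X R :=
  calc X * R = X * (G * R) := by rw [h.mul_left_eq]
    _ = G * X * R := by rw [← mul_assoc, hG.eq]
    _ = R * (T * X) * R := by rw [← h.2.1]; simp only [mul_assoc]
    _ = R * (X * (T * R)) := by rw [← hT.eq]; simp only [mul_assoc]
    _ = R * P * X := by rw [h.1, hP.eq, mul_assoc]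
    _ = R * X := by rw [h.mul_right_eq]

theorem exists_of_range_eq (hP : P * P = P) (hPT : LinearMap.range P = LinearMap.range T)
    (hG : G * G = G) (hGT : LinearMap.ker T = LinearMap.range (1 - G)) :
    ∃ R, IsGeneralizedInverse T P G R := by
  obtain ⟨f, hf⟩ := exists_mul_eq_of_range_le hPT.le
  have T_mul_G : T * G = T := by
    refine (sub_eq_zero.1 (LinearMap.ext fun v => ?_)).symm
    have : (1 - G) v ∈ LinearMap.ker T := hGT ▸ LinearMap.mem_range_self _ v
    simpa using this
  have P_mul_T : P * T = T := by
    obtain ⟨g, rfl⟩ := exists_mul_eq_of_range_le hPT.ge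
    rw [← mul_assoc, hP]
  have G_mul_f_mul_T : G * (f * T) = G := by
    refine sub_eq_zero.1 (LinearMap.ext fun v => ?_)
    have : (f * T - 1) v ∈ LinearMap.range (1 - G) := by
      rw [← hGT, LinearMap.mem_ker, ← Module.End.mul_apply, mul_sub, ← mul_assoc, hf, P_mul_T,
        mul_one, sub_self, LinearMap.zero_apply]
    obtain ⟨w, hw⟩ := this
    rw [show G * (f * T) - G = G * (f * T - 1) by rw [mul_sub, mul_one], Module.End.mul_apply,
      ← hw, ← Module.End.mul_apply, mul_sub, mul_one, hG, sub_self, LinearMap.zero_apply,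
      LinearMap.zero_apply]
  refine ⟨G * f * P, ?_, ?_, ?_⟩
  · rw [← mul_assoc, ← mul_assoc, T_mul_G, hf, hP]
  · rw [mul_assoc, P_mul_T, mul_assoc, G_mul_f_mul_T]
  · rw [mul_assoc _ P, P_mul_T, mul_assoc G f T, G_mul_f_mul_T, ← mul_assoc, ← mul_assoc, hG]

end IsGeneralizedInverse

section TensorLegs

variable {K M N P V : Type*} [CommSemiring K] [AddCommMonoid M] [Module K M] [AddCommMonoid N]
  [Module K N] [AddCommMonoid P] [Module K P] [AddCommMonoid V] [Module K V]

theorem lTensor_rTensor_comm (f : M →ₗ[K] P) (g : N →ₗ[K] V) (t : M ⊗[K] N) :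
    g.lTensor P (f.rTensor N t) = f.rTensor V (g.lTensor M t) :=
  LinearMap.congr_fun
    ((LinearMap.lTensor_comp_rTensor _ f g).trans (LinearMap.rTensor_comp_lTensor _ f g).symm) t

theorem lTensor_assoc_tmul (F : N ⊗[K] P →ₗ[K] V) (t : M ⊗[K] N) (p : P) :
    F.lTensor M (TensorProduct.assoc K M N P (t ⊗ₜ p)) =
      (F ∘ₗ (TensorProduct.mk K N P).flip p).lTensor M t := by
  induction t with
  | zero => simp
  | add x y hx hy => simp only [map_add, TensorProduct.add_tmul, hx, hy]
  | tmul x y => simp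

theorem lTensor_leftComm_tmul (F : M ⊗[K] P →ₗ[K] V) (m : M) (t : N ⊗[K] P) :
    F.lTensor N (TensorProduct.leftComm K M N P (m ⊗ₜ t)) =
      (F ∘ₗ TensorProduct.mk K M P m).lTensor N t := by
  induction t with
  | zero => simp
  | add x y hx hy => simp only [map_add, TensorProduct.tmul_add, hx, hy]
  | tmul x y => simp

theorem rTensor_assoc_symm_tmul (F : M ⊗[K] N →ₗ[K] V) (m : M) (t : N ⊗[K] P) :
    F.rTensor P ((TensorProduct.assoc K M N P).symm (m ⊗ₜ t)) =
      (F ∘ₗ TensorProduct.mk K M N m).rTensor P t := by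
  induction t with
  | zero => simp
  | add x y hx hy => simp only [map_add, TensorProduct.tmul_add, hx, hy]
  | tmul x y => simp

theorem rTensor_assoc_symm_leftComm_tmul (F : N ⊗[K] M →ₗ[K] V) (m : M) (t : N ⊗[K] P) :
    F.rTensor P ((TensorProduct.assoc K N M P).symm (TensorProduct.leftComm K M N P (m ⊗ₜ t))) =
      (F ∘ₗ (TensorProduct.mk K N M).flip m).rTensor P t := by
  induction t with
  | zero => simp
  | add x y hx hy => simp only [map_add, TensorProduct.tmul_add, hx, hy]
  | tmul x y => simp

theorem assoc_tmul_eq_lTensor (t : M ⊗[K] N) (p : P) :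
    TensorProduct.assoc K M N P (t ⊗ₜ p) = ((TensorProduct.mk K N P).flip p).lTensor M t := by
  simpa using lTensor_assoc_tmul LinearMap.id t p

theorem tmul_eq_assoc_rTensor (m : M) (t : N ⊗[K] P) :
    m ⊗ₜ t = TensorProduct.assoc K M N P ((TensorProduct.mk K M N m).rTensor P t) := by
  rw [← LinearEquiv.symm_apply_eq]
  simpa using rTensor_assoc_symm_tmul LinearMap.id m t

end TensorLegs

section SliceMaps

variable {A : Type*} [NonUnitalRing A] [Module ℂ A]

@[simp] theorem sliceLeft_tmul (φ : A →ₗ[ℂ] ℂ) (a b : A) : sliceLeft φ (a ⊗ₜ b) = φ a • b :=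
  TensorProduct.lid_tmul b (φ a)

@[simp] theorem sliceRight_tmul (φ : A →ₗ[ℂ] ℂ) (a b : A) : sliceRight φ (a ⊗ₜ b) = φ b • a := by
  simp [sliceRight]

theorem sliceLeft_comp_lTensor (φ : A →ₗ[ℂ] ℂ) (f : Module.End ℂ A) :
    sliceLeft φ ∘ₗ f.lTensor A = f ∘ₗ sliceLeft φ :=
  TensorProduct.ext' fun a b => by simp

theorem sliceRight_comp_rTensor (φ : A →ₗ[ℂ] ℂ) (f : Module.End ℂ A) :
    sliceRight φ ∘ₗ f.rTensor A = f ∘ₗ sliceRight φ :=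
  TensorProduct.ext' fun a b => by simp

@[simp] theorem leg13_tmul (T : Module.End ℂ (A ⊗[ℂ] A)) (a b c : A) :
    leg13 T (a ⊗ₜ (b ⊗ₜ c)) = TensorProduct.leftComm ℂ A A A (b ⊗ₜ T (a ⊗ₜ c)) := by
  simp [leg13]

/-- `φ ⊗ ι ⊗ ι` on `A ⊗ A ⊗ A`. -/
def sliceFirst (φ : A →ₗ[ℂ] ℂ) : A ⊗[ℂ] (A ⊗[ℂ] A) →ₗ[ℂ] A ⊗[ℂ] A :=
  (TensorProduct.lid ℂ (A ⊗[ℂ] A)).toLinearMap ∘ₗ φ.rTensor (A ⊗[ℂ] A)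

/-- `ι ⊗ ι ⊗ φ` on `A ⊗ A ⊗ A`. -/
def sliceThird (φ : A →ₗ[ℂ] ℂ) : A ⊗[ℂ] (A ⊗[ℂ] A) →ₗ[ℂ] A ⊗[ℂ] A :=
  (sliceRight φ).lTensor A

@[simp] theorem sliceFirst_tmul (φ : A →ₗ[ℂ] ℂ) (a : A) (t : A ⊗[ℂ] A) :
    sliceFirst φ (a ⊗ₜ t) = φ a • t :=
  TensorProduct.lid_tmul t (φ a)

@[simp] theorem sliceThird_tmul (φ : A →ₗ[ℂ] ℂ) (a : A) (t : A ⊗[ℂ] A) :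
    sliceThird φ (a ⊗ₜ t) = a ⊗ₜ sliceRight φ t := rfl

@[simp] theorem sliceThird_assoc (φ : A →ₗ[ℂ] ℂ) (a : A) (t : A ⊗[ℂ] A) :
    sliceThird φ (TensorProduct.assoc ℂ A A A (t ⊗ₜ a)) = φ a • t := by
  induction t with
  | zero => simp
  | add x y hx hy => simp only [map_add, TensorProduct.add_tmul, smul_add, hx, hy]
  | tmul x y => simp

theorem sliceFirst_assoc (φ : A →ₗ[ℂ] ℂ) (t : A ⊗[ℂ] A) (c : A) :
    sliceFirst φ (TensorProduct.assoc ℂ A A A (t ⊗ₜ c)) = sliceLeft φ t ⊗ₜ c := by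
  induction t with
  | zero => simp
  | add x y hx hy => simp only [map_add, TensorProduct.add_tmul, hx, hy]
  | tmul x y => simp [TensorProduct.smul_tmul']

theorem sliceThird_comp_op12 (φ : A →ₗ[ℂ] ℂ) (T : Module.End ℂ (A ⊗[ℂ] A)) :
    sliceThird φ ∘ₗ op12 T = T ∘ₗ sliceThird φ :=
  TensorProduct.ext_threefold' fun a b c => by simp

theorem sliceFirst_comp_op23 (φ : A →ₗ[ℂ] ℂ) (T : Module.End ℂ (A ⊗[ℂ] A)) :
    sliceFirst φ ∘ₗ op23 T = T ∘ₗ sliceFirst φ :=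
  TensorProduct.ext' fun a t => by simp

theorem sliceThird_leftComm (φ : A →ₗ[ℂ] ℂ) (b : A) (t : A ⊗[ℂ] A) :
    sliceThird φ (TensorProduct.leftComm ℂ A A A (b ⊗ₜ t)) = sliceRight φ t ⊗ₜ b := by
  induction t with
  | zero => simp
  | add x y hx hy => simp only [map_add, TensorProduct.tmul_add, TensorProduct.add_tmul, hx, hy]
  | tmul x y => simp [TensorProduct.smul_tmul]

theorem sliceFirst_leftComm (φ : A →ₗ[ℂ] ℂ) (b : A) (t : A ⊗[ℂ] A) :
    sliceFirst φ (TensorProduct.leftComm ℂ A A A (b ⊗ₜ t)) = b ⊗ₜ sliceLeft φ t := by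
  induction t with
  | zero => simp
  | add x y hx hy => simp only [map_add, TensorProduct.tmul_add, hx, hy]
  | tmul x y => simp

theorem sliceFirst_op12_tmul (φ : A →ₗ[ℂ] ℂ) (T : Module.End ℂ (A ⊗[ℂ] A)) (d : A)
    (t : A ⊗[ℂ] A) : sliceFirst φ (op12 T (d ⊗ₜ t)) =
      (sliceLeft φ ∘ₗ T ∘ₗ TensorProduct.mk ℂ A A d).rTensor A t := by
  induction t with
  | zero => simp
  | add x y hx hy => simp only [map_add, TensorProduct.tmul_add, hx, hy]
  | tmul x y => rw [op12_tmul, sliceFirst_assoc]; rfl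

theorem sliceThird_op23_assoc (φ : A →ₗ[ℂ] ℂ) (T : Module.End ℂ (A ⊗[ℂ] A)) (t : A ⊗[ℂ] A)
    (d : A) : sliceThird φ (op23 T (TensorProduct.assoc ℂ A A A (t ⊗ₜ d))) =
      (sliceRight φ ∘ₗ T ∘ₗ (TensorProduct.mk ℂ A A).flip d).lTensor A t := by
  induction t with
  | zero => simp
  | add x y hx hy => simp only [map_add, TensorProduct.add_tmul, hx, hy]
  | tmul x y => rfl

theorem eq_of_forall_apply_sliceRight {V : Type*} [AddCommGroup V] [Module ℂ V]
    {f g : A →ₗ[ℂ] V} {t : A ⊗[ℂ] A}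
    (h : ∀ φ : A →ₗ[ℂ] ℂ, f (sliceRight φ t) = g (sliceRight φ t)) :
    f.rTensor A t = g.rTensor A t := by
  have rid_lTensor_rTensor (φ : A →ₗ[ℂ] ℂ) (f : A →ₗ[ℂ] V) :
      (TensorProduct.rid ℂ V).toLinearMap ∘ₗ φ.lTensor V ∘ₗ f.rTensor A = f ∘ₗ sliceRight φ :=
    TensorProduct.ext' fun a b => by simp
  rw [← sub_eq_zero, ← LinearMap.sub_apply, ← LinearMap.rTensor_sub]
  refine eq_zero_of_forall_lTensor_eq_zero (g := fun φ : A →ₗ[ℂ] ℂ => φ)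
    (fun v => (Module.forall_dual_apply_eq_zero_iff ℂ v).1)
    fun φ => (TensorProduct.rid ℂ V).injective ?_
  rw [map_zero, ← sub_eq_zero.2 (h φ)]
  exact LinearMap.congr_fun (rid_lTensor_rTensor φ (f - g)) t

theorem eq_of_forall_apply_sliceLeft {V : Type*} [AddCommGroup V] [Module ℂ V]
    {f g : A →ₗ[ℂ] V} {t : A ⊗[ℂ] A}
    (h : ∀ φ : A →ₗ[ℂ] ℂ, f (sliceLeft φ t) = g (sliceLeft φ t)) :
    f.lTensor A t = g.lTensor A t := by
  have lid_rTensor_lTensor (φ : A →ₗ[ℂ] ℂ) (f : A →ₗ[ℂ] V) :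
      (TensorProduct.lid ℂ V).toLinearMap ∘ₗ φ.rTensor V ∘ₗ f.lTensor A = f ∘ₗ sliceLeft φ :=
    TensorProduct.ext' fun a b => by simp
  rw [← sub_eq_zero, ← LinearMap.sub_apply, ← LinearMap.lTensor_sub]
  refine eq_zero_of_forall_rTensor_eq_zero (g := fun φ : A →ₗ[ℂ] ℂ => φ)
    (fun v => (Module.forall_dual_apply_eq_zero_iff ℂ v).1)
    fun φ => (TensorProduct.lid ℂ V).injective ?_
  rw [map_zero, ← sub_eq_zero.2 (h φ)]
  exact LinearMap.congr_fun (lid_rTensor_lTensor φ (f - g)) t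

end SliceMaps

namespace WeakMultiplierHopfAlgebra

variable {A : Type*} [NonUnitalRing A] [Module ℂ A] [IsScalarTower ℂ A A] [SMulCommClass ℂ A A]

section CanonicalMaps

variable (H : WeakMultiplierHopfAlgebra A)

theorem rTensor_mulLeft_T₁ (a b c : A) :
    (LinearMap.mulLeft ℂ c).rTensor A (H.T₁ (a ⊗ₜ b)) =
      (LinearMap.mulRight ℂ b).lTensor A (H.T₂ (c ⊗ₜ a)) := by
  refine H.nondeg₂.of_injective ?_
  calc _ = Multiplier.tmul (Multiplier.of A c) 1 * Multiplier.of _ (H.T₁ (a ⊗ₜ b)) :=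
        (Multiplier.mul_of _ _).symm
    _ = Multiplier.of _ (H.T₂ (c ⊗ₜ a)) * Multiplier.tmul 1 (Multiplier.of A b) := by
        rw [T₁_spec, T₂_spec, mul_assoc]
    _ = _ := Multiplier.of_mul _ _

theorem eq_of_forall_rTensor_T₁ {V : Type*} [AddCommGroup V] [Module ℂ V] {f g : A →ₗ[ℂ] V}
    (h : ∀ a b, f.rTensor A (H.T₁ (a ⊗ₜ b)) = g.rTensor A (H.T₁ (a ⊗ₜ b))) : f = g := by
  have comp_T₁ : (f - g).rTensor A ∘ₗ H.T₁ = 0 := TensorProduct.ext' fun a b => by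
    rw [LinearMap.comp_apply, LinearMap.rTensor_sub, LinearMap.sub_apply, h, sub_self,
      LinearMap.zero_apply]
  refine sub_eq_zero.1 (LinearMap.ker_eq_top.1 (H.full_left _ ?_))
  rintro _ ⟨t, rfl⟩
  exact (Module.Flat.rTensor_exact A (LinearMap.exact_subtype_ker_map (f - g)) _).1
    (LinearMap.congr_fun comp_T₁ t)

theorem eq_of_forall_lTensor_T₂ {V : Type*} [AddCommGroup V] [Module ℂ V] {f g : A →ₗ[ℂ] V}
    (h : ∀ a b, f.lTensor A (H.T₂ (a ⊗ₜ b)) = g.lTensor A (H.T₂ (a ⊗ₜ b))) : f = g := by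
  have comp_T₂ : (f - g).lTensor A ∘ₗ H.T₂ = 0 := TensorProduct.ext' fun a b => by
    rw [LinearMap.comp_apply, LinearMap.lTensor_sub, LinearMap.sub_apply, h, sub_self,
      LinearMap.zero_apply]
  refine sub_eq_zero.1 (LinearMap.ker_eq_top.1 (H.full_right _ ?_))
  rintro _ ⟨t, rfl⟩
  exact (Module.Flat.lTensor_exact A (LinearMap.exact_subtype_ker_map (f - g)) _).1
    (LinearMap.congr_fun comp_T₂ t)

/-- The slice `a ↦ (ι ⊗ ι ⊗ ω)(Δ₁₃(a)(1 ⊗ t))`. By fullness such slices determine the linear maps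
on `A ⊗ A`, which is how the defining equation of `G₁` is exploited. -/
def T₁Slice (ω : A →ₗ[ℂ] ℂ) : A ⊗[ℂ] A →ₗ[ℂ] A →ₗ[ℂ] A ⊗[ℂ] A :=
  ((TensorProduct.mk ℂ A (A ⊗[ℂ] A)).compr₂ (sliceThird ω ∘ₗ leg13 H.T₁)).flip

/-- The slice `a ↦ (ω ⊗ ι ⊗ ι)((t ⊗ 1)Δ₁₃(a))`, the counterpart of `T₁Slice` for `G₂`. -/
def T₂Slice (ω : A →ₗ[ℂ] ℂ) : A ⊗[ℂ] A →ₗ[ℂ] A →ₗ[ℂ] A ⊗[ℂ] A :=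
  (TensorProduct.mk ℂ (A ⊗[ℂ] A) A).compr₂
    (sliceFirst ω ∘ₗ leg13 H.T₂ ∘ₗ (TensorProduct.assoc ℂ A A A).toLinearMap)

theorem T₁Slice_tmul (ω : A →ₗ[ℂ] ℂ) (a b c : A) :
    H.T₁Slice ω (b ⊗ₜ c) a = sliceRight ω (H.T₁ (a ⊗ₜ c)) ⊗ₜ b :=
  (congrArg _ (leg13_tmul _ a b c)).trans (sliceThird_leftComm _ _ _)

theorem T₂Slice_tmul (ω : A →ₗ[ℂ] ℂ) (a b c : A) :
    H.T₂Slice ω (c ⊗ₜ b) a = b ⊗ₜ sliceLeft ω (H.T₂ (c ⊗ₜ a)) :=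
  (congrArg _ (leg13_tmul _ c b a)).trans (sliceFirst_leftComm _ _ _)

theorem eq_of_forall_comp_T₁Slice {V : Type*} [AddCommGroup V] [Module ℂ V]
    {F F' : A ⊗[ℂ] A →ₗ[ℂ] V} (h : ∀ ω t, F ∘ₗ H.T₁Slice ω t = F' ∘ₗ H.T₁Slice ω t) :
    F = F' := by
  have comp_mk_flip (b : A) : F ∘ₗ (TensorProduct.mk ℂ A A).flip b =
      F' ∘ₗ (TensorProduct.mk ℂ A A).flip b := by
    refine H.eq_of_forall_rTensor_T₁ fun a c => eq_of_forall_apply_sliceRight fun ω => ?_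
    simpa only [LinearMap.comp_apply, T₁Slice_tmul, LinearMap.flip_apply, TensorProduct.mk_apply]
      using LinearMap.congr_fun (h ω (b ⊗ₜ c)) a
  exact TensorProduct.ext' fun a b => LinearMap.congr_fun (comp_mk_flip b) a

theorem eq_of_forall_comp_T₂Slice {V : Type*} [AddCommGroup V] [Module ℂ V]
    {F F' : A ⊗[ℂ] A →ₗ[ℂ] V} (h : ∀ ω t, F ∘ₗ H.T₂Slice ω t = F' ∘ₗ H.T₂Slice ω t) :
    F = F' := by
  have comp_mk (b : A) : F ∘ₗ TensorProduct.mk ℂ A A b = F' ∘ₗ TensorProduct.mk ℂ A A b := by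
    refine H.eq_of_forall_lTensor_T₂ fun c a => eq_of_forall_apply_sliceLeft fun ω => ?_
    simpa only [LinearMap.comp_apply, T₂Slice_tmul, TensorProduct.mk_apply]
      using LinearMap.congr_fun (h ω (c ⊗ₜ b)) a
  exact TensorProduct.ext' fun b a => LinearMap.congr_fun (comp_mk b) a

theorem op12_G₁_mul_leg13_T₁ : op12 H.G₁ * leg13 H.T₁ = leg13 H.T₁ * op23 H.E.left :=
  TensorProduct.ext_threefold' fun a b c => H.G₁_spec a b c

theorem op23_G₂_mul_leg13_T₂ : op23 H.G₂ * leg13 H.T₂ = leg13 H.T₂ * op12 H.E.right :=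
  TensorProduct.ext_threefold' fun a b c => by
    rw [Module.End.mul_apply, Module.End.mul_apply, op12_tmul]
    exact H.G₂_spec a b c

theorem G₁_comp_T₁Slice (ω : A →ₗ[ℂ] ℂ) (t : A ⊗[ℂ] A) :
    H.G₁ ∘ₗ H.T₁Slice ω t = H.T₁Slice ω (H.E.left t) := by
  refine LinearMap.ext fun a => (LinearMap.congr_fun (sliceThird_comp_op12 ω H.G₁) _).symm.trans ?_
  exact congrArg (sliceThird ω) (LinearMap.congr_fun H.op12_G₁_mul_leg13_T₁ (a ⊗ₜ t))

theorem G₂_comp_T₂Slice (ω : A →ₗ[ℂ] ℂ) (t : A ⊗[ℂ] A) :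
    H.G₂ ∘ₗ H.T₂Slice ω t = H.T₂Slice ω (H.E.right t) := by
  refine LinearMap.ext fun a => (LinearMap.congr_fun (sliceFirst_comp_op23 ω H.G₂) _).symm.trans ?_
  refine congrArg (sliceFirst ω) ?_
  refine (LinearMap.congr_fun H.op23_G₂_mul_leg13_T₂ _).trans (congrArg (leg13 H.T₂) ?_)
  exact op12_assoc _ (t ⊗ₜ a)

theorem G₁_mul_G₁ : H.G₁ * H.G₁ = H.G₁ := by
  refine H.eq_of_forall_comp_T₁Slice fun ω t => ?_
  rw [Module.End.mul_eq_comp, LinearMap.comp_assoc, G₁_comp_T₁Slice, G₁_comp_T₁Slice,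
    ← Module.End.mul_apply, ← Multiplier.left_mul, E_idem]

theorem G₂_mul_G₂ : H.G₂ * H.G₂ = H.G₂ := by
  refine H.eq_of_forall_comp_T₂Slice fun ω t => ?_
  rw [Module.End.mul_eq_comp, LinearMap.comp_assoc, G₂_comp_T₂Slice, G₂_comp_T₂Slice,
    ← Module.End.mul_apply, ← Multiplier.right_mul, E_idem]

theorem T₂_tmul_sliceRight_T₁ (ω : A →ₗ[ℂ] ℂ) (a c d : A) :
    H.T₂ (c ⊗ₜ sliceRight ω (H.T₁ (a ⊗ₜ d))) =
      (sliceRight ω ∘ₗ H.T₁ ∘ₗ (TensorProduct.mk ℂ A A).flip d).lTensor A (H.T₂ (c ⊗ₜ a)) :=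
  calc _ = sliceThird ω ((op12 H.T₂ * op23 H.T₁) (c ⊗ₜ (a ⊗ₜ d))) :=
        (LinearMap.congr_fun (sliceThird_comp_op12 ω H.T₂) (c ⊗ₜ H.T₁ (a ⊗ₜ d))).symm
    _ = sliceThird ω (op23 H.T₁ (op12 H.T₂ (c ⊗ₜ (a ⊗ₜ d)))) := by
        rw [H.commute_op12_T₂_op23_T₁.eq, Module.End.mul_apply]
    _ = _ := by rw [op12_tmul, sliceThird_op23_assoc]

theorem T₁_sliceLeft_T₂_tmul (ω : A →ₗ[ℂ] ℂ) (a c d : A) :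
    H.T₁ (sliceLeft ω (H.T₂ (d ⊗ₜ a)) ⊗ₜ c) =
      (sliceLeft ω ∘ₗ H.T₂ ∘ₗ TensorProduct.mk ℂ A A d).rTensor A (H.T₁ (a ⊗ₜ c)) :=
  calc _ = H.T₁ (sliceFirst ω (op12 H.T₂ (d ⊗ₜ (a ⊗ₜ c)))) := by
        rw [op12_tmul, sliceFirst_assoc]
    _ = sliceFirst ω ((op23 H.T₁ * op12 H.T₂) (d ⊗ₜ (a ⊗ₜ c))) :=
        (LinearMap.congr_fun (sliceFirst_comp_op23 ω H.T₁) _).symm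
    _ = _ := by
        rw [← H.commute_op12_T₂_op23_T₁.eq, Module.End.mul_apply, op23_tmul, sliceFirst_op12_tmul]

theorem op12_T₂_tmul_T₁Slice (ω : A →ₗ[ℂ] ℂ) (c a : A) (t : A ⊗[ℂ] A) :
    op12 H.T₂ (c ⊗ₜ H.T₁Slice ω t a) = (H.T₁Slice ω t).lTensor A (H.T₂ (c ⊗ₜ a)) := by
  induction t with
  | zero => simp
  | add x y hx hy =>
    simp only [map_add, LinearMap.add_apply, TensorProduct.tmul_add,
      LinearMap.lTensor_add, hx, hy]
  | tmul b d =>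
    rw [T₁Slice_tmul, op12_tmul, T₂_tmul_sliceRight_T₁, assoc_tmul_eq_lTensor,
      ← LinearMap.lTensor_comp_apply]
    exact congrArg (fun f => LinearMap.lTensor A f (H.T₂ (c ⊗ₜ a)))
      (LinearMap.ext fun a => (H.T₁Slice_tmul ω a b d).symm)

theorem op23_T₁_T₂Slice_tmul (ω : A →ₗ[ℂ] ℂ) (c a : A) (t : A ⊗[ℂ] A) :
    op23 H.T₁ (TensorProduct.assoc ℂ A A A (H.T₂Slice ω t a ⊗ₜ c)) =
      TensorProduct.assoc ℂ A A A ((H.T₂Slice ω t).rTensor A (H.T₁ (a ⊗ₜ c))) := by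
  induction t with
  | zero => simp
  | add x y hx hy =>
    simp only [map_add, LinearMap.add_apply, TensorProduct.add_tmul,
      LinearMap.rTensor_add, hx, hy]
  | tmul d b =>
    rw [T₂Slice_tmul, TensorProduct.assoc_tmul, op23_tmul, T₁_sliceLeft_T₂_tmul,
      tmul_eq_assoc_rTensor, ← LinearMap.rTensor_comp_apply]
    exact congrArg (fun f => TensorProduct.assoc ℂ A A A (LinearMap.rTensor A f (H.T₁ (a ⊗ₜ c))))
      (LinearMap.ext fun a => (H.T₂Slice_tmul ω a b d).symm)

theorem commute_op12_T₂_op23_G₁ : Commute (op12 H.T₂) (op23 H.G₁) := by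
  have comp_mk (c : A) : op12 H.T₂ ∘ₗ TensorProduct.mk ℂ A (A ⊗[ℂ] A) c ∘ₗ H.G₁ =
      op23 H.G₁ ∘ₗ op12 H.T₂ ∘ₗ TensorProduct.mk ℂ A (A ⊗[ℂ] A) c := by
    refine H.eq_of_forall_comp_T₁Slice fun ω t => LinearMap.ext fun a => ?_
    calc op12 H.T₂ (c ⊗ₜ (H.G₁ ∘ₗ H.T₁Slice ω t) a)
      _ = (H.G₁ ∘ₗ H.T₁Slice ω t).lTensor A (H.T₂ (c ⊗ₜ a)) := by
          rw [G₁_comp_T₁Slice, op12_T₂_tmul_T₁Slice]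
      _ = op23 H.G₁ (op12 H.T₂ (c ⊗ₜ H.T₁Slice ω t a)) := by
          rw [LinearMap.lTensor_comp_apply, op12_T₂_tmul_T₁Slice]
          rfl
  exact TensorProduct.ext' fun c t => LinearMap.congr_fun (comp_mk c) t

theorem commute_op12_G₂_op23_T₁ : Commute (op12 H.G₂) (op23 H.T₁) := by
  have comp_mk_flip (c : A) : op12 H.G₂ ∘ₗ op23 H.T₁ ∘ₗ (TensorProduct.assoc ℂ A A A).toLinearMap ∘ₗ
      (TensorProduct.mk ℂ (A ⊗[ℂ] A) A).flip c =
      op23 H.T₁ ∘ₗ (TensorProduct.assoc ℂ A A A).toLinearMap ∘ₗ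
        (TensorProduct.mk ℂ (A ⊗[ℂ] A) A).flip c ∘ₗ H.G₂ := by
    refine H.eq_of_forall_comp_T₂Slice fun ω t => LinearMap.ext fun a => ?_
    calc op12 H.G₂ (op23 H.T₁ (TensorProduct.assoc ℂ A A A (H.T₂Slice ω t a ⊗ₜ c)))
      _ = TensorProduct.assoc ℂ A A A
            ((H.G₂ ∘ₗ H.T₂Slice ω t).rTensor A (H.T₁ (a ⊗ₜ c))) := by
          rw [op23_T₁_T₂Slice_tmul, op12_assoc, LinearMap.rTensor_comp_apply]
      _ = op23 H.T₁ (TensorProduct.assoc ℂ A A A ((H.G₂ ∘ₗ H.T₂Slice ω t) a ⊗ₜ c)) := by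
          rw [G₂_comp_T₂Slice, op23_T₁_T₂Slice_tmul]
  refine TensorProduct.ext_threefold' fun a b c => ?_
  simpa using LinearMap.congr_fun (comp_mk_flip c) (a ⊗ₜ b)

theorem exists_R₁ : ∃ R₁, IsGeneralizedInverse H.T₁ H.E.left H.G₁ R₁ :=
  IsGeneralizedInverse.exists_of_range_eq (congrArg Multiplier.left H.E_idem) H.range_T₁
    H.G₁_mul_G₁ H.ker_T₁

theorem exists_R₂ : ∃ R₂, IsGeneralizedInverse H.T₂ H.E.right H.G₂ R₂ :=
  IsGeneralizedInverse.exists_of_range_eq (congrArg Multiplier.right H.E_idem) H.range_T₂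
    H.G₂_mul_G₂ H.ker_T₂

end CanonicalMaps

end WeakMultiplierHopfAlgebra

section

variable {B : Type*} [NonUnitalRing B] [Module ℂ B] [IsScalarTower ℂ B B] [SMulCommClass ℂ B B]

/-- `Multiplier.left` as a linear map. -/
def Multiplier.leftₗ : Multiplier B →ₗ[ℂ] B →ₗ[ℂ] B where
  toFun := Multiplier.left
  map_add' _ _ := rfl
  map_smul' _ _ := rfl

/-- `Multiplier.right` as a linear map. -/
def Multiplier.rightₗ : Multiplier B →ₗ[ℂ] B →ₗ[ℂ] B where
  toFun := Multiplier.right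
  map_add' _ _ := rfl
  map_smul' _ _ := rfl

end

section TensorLegs

variable {K M M' N N' P : Type*} [CommSemiring K] [AddCommMonoid M] [Module K M] [AddCommMonoid M']
  [Module K M'] [AddCommMonoid N] [Module K N] [AddCommMonoid N'] [Module K N'] [AddCommMonoid P]
  [Module K P]

theorem rTensor_assoc_tmul (f : M →ₗ[K] M') (t : M ⊗[K] N) (p : P) :
    f.rTensor (N ⊗[K] P) (TensorProduct.assoc K M N P (t ⊗ₜ p)) =
      TensorProduct.assoc K M' N P (f.rTensor N t ⊗ₜ p) := by
  induction t with
  | zero => simp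
  | add x y hx hy => simp only [map_add, TensorProduct.add_tmul, hx, hy]
  | tmul x y => simp

theorem lTensor_rTensor_assoc_tmul (f : N →ₗ[K] N') (t : M ⊗[K] N) (p : P) :
    (f.rTensor P).lTensor M (TensorProduct.assoc K M N P (t ⊗ₜ p)) =
      TensorProduct.assoc K M N' P (f.lTensor M t ⊗ₜ p) := by
  induction t with
  | zero => simp
  | add x y hx hy => simp only [map_add, TensorProduct.add_tmul, hx, hy]
  | tmul x y => simp

end TensorLegs

section LegOperators

variable {A : Type*} [AddCommGroup A] [Module ℂ A]

theorem op12_tmul_eq_rTensor (F : Module.End ℂ (A ⊗[ℂ] A)) (c : A) (t : A ⊗[ℂ] A) :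
    op12 F (c ⊗ₜ t) =
      TensorProduct.assoc ℂ A A A ((F ∘ₗ TensorProduct.mk ℂ A A c).rTensor A t) := by
  rw [tmul_eq_assoc_rTensor, op12_assoc, LinearMap.rTensor_comp_apply]

theorem op23_assoc_tmul (F : Module.End ℂ (A ⊗[ℂ] A)) (t : A ⊗[ℂ] A) (d : A) :
    op23 F (TensorProduct.assoc ℂ A A A (t ⊗ₜ d)) =
      (F ∘ₗ (TensorProduct.mk ℂ A A).flip d).lTensor A t :=
  lTensor_assoc_tmul F t d

theorem op23_lTensor_assoc_tmul (f : Module.End ℂ A) (t : A ⊗[ℂ] A) (c : A) :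
    op23 (f.lTensor A) (TensorProduct.assoc ℂ A A A (t ⊗ₜ c)) =
      TensorProduct.assoc ℂ A A A (t ⊗ₜ f c) := by
  rw [op23_assoc_tmul, assoc_tmul_eq_lTensor]
  rfl

theorem op12_rTensor_tmul (f : Module.End ℂ A) (a : A) (t : A ⊗[ℂ] A) :
    op12 (f.rTensor A) (a ⊗ₜ t) = f a ⊗ₜ t := by
  rw [op12_tmul_eq_rTensor, tmul_eq_assoc_rTensor]
  rfl

theorem commute_op12_op23_lTensor (T : Module.End ℂ (A ⊗[ℂ] A)) (f : Module.End ℂ A) :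
    Commute (op12 T) (op23 (f.lTensor A)) :=
  TensorProduct.ext_threefold' fun a b c => by
    simp only [Module.End.mul_apply, op23_tmul, LinearMap.lTensor_tmul, op12_tmul,
      op23_lTensor_assoc_tmul]

theorem commute_op12_rTensor_op23 (T : Module.End ℂ (A ⊗[ℂ] A)) (f : Module.End ℂ A) :
    Commute (op12 (f.rTensor A)) (op23 T) :=
  TensorProduct.ext' fun a t => by
    simp only [Module.End.mul_apply, op23_tmul, op12_rTensor_tmul]

end LegOperators

namespace WeakMultiplierHopfAlgebra

variable {A : Type*} [NonUnitalRing A] [Module ℂ A] [IsScalarTower ℂ A A] [SMulCommClass ℂ A A]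

section Pentagons

variable (H : WeakMultiplierHopfAlgebra A)

/-- The bilinear map `(t, a) ↦ Δ(a)t`. -/
def ΔMul : A ⊗[ℂ] A →ₗ[ℂ] A →ₗ[ℂ] A ⊗[ℂ] A := (Multiplier.leftₗ ∘ₗ H.Δₗ).flip

/-- The bilinear map `(t, a) ↦ tΔ(a)`. -/
def mulΔ : A ⊗[ℂ] A →ₗ[ℂ] A →ₗ[ℂ] A ⊗[ℂ] A := (Multiplier.rightₗ ∘ₗ H.Δₗ).flip

theorem T₁_comp_mk_flip_comp_mulRight (b d : A) :
    H.T₁ ∘ₗ (TensorProduct.mk ℂ A A).flip d ∘ₗ LinearMap.mulRight ℂ b =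
      H.ΔMul (H.T₁ (b ⊗ₜ d)) :=
  LinearMap.ext fun x => H.nondeg₂.of_injective <| by
    calc Multiplier.of _ (H.T₁ ((x * b) ⊗ₜ d)) = H.Δ x * Multiplier.of _ (H.T₁ (b ⊗ₜ d)) := by
          rw [T₁_spec, T₁_spec, map_mul, mul_assoc]
      _ = _ := Multiplier.mul_of _ _

theorem T₂_comp_mk_comp_mulLeft (c p : A) :
    H.T₂ ∘ₗ TensorProduct.mk ℂ A A c ∘ₗ LinearMap.mulLeft ℂ p = H.mulΔ (H.T₂ (c ⊗ₜ p)) :=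
  LinearMap.ext fun x => H.nondeg₂.of_injective <| by
    calc Multiplier.of _ (H.T₂ (c ⊗ₜ (p * x))) = Multiplier.of _ (H.T₂ (c ⊗ₜ p)) * H.Δ x := by
          rw [T₂_spec, T₂_spec, map_mul, mul_assoc]
      _ = _ := Multiplier.of_mul _ _

theorem rTensor_mulLeft_op23_T₁_op12_T₁ (a b c d : A) :
    (LinearMap.mulLeft ℂ c).rTensor (A ⊗[ℂ] A) (op23 H.T₁ (op12 H.T₁ (a ⊗ₜ (b ⊗ₜ d)))) =
      (H.ΔMul (H.T₁ (b ⊗ₜ d))).lTensor A (H.T₂ (c ⊗ₜ a)) :=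
  calc _ = (LinearMap.mulLeft ℂ c).rTensor (A ⊗[ℂ] A)
          ((H.T₁ ∘ₗ (TensorProduct.mk ℂ A A).flip d).lTensor A (H.T₁ (a ⊗ₜ b))) := by
        rw [op12_tmul, ← lTensor_assoc_tmul]
        rfl
    _ = (H.T₁ ∘ₗ (TensorProduct.mk ℂ A A).flip d).lTensor A
          ((LinearMap.mulLeft ℂ c).rTensor A (H.T₁ (a ⊗ₜ b))) := by
        rw [lTensor_rTensor_comm]
    _ = _ := by
        rw [rTensor_mulLeft_T₁, ← LinearMap.lTensor_comp_apply, LinearMap.comp_assoc,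
          T₁_comp_mk_flip_comp_mulRight]

theorem rTensor_mulLeft_op12_T₁_leftComm (b c : A) (s : A ⊗[ℂ] A) :
    (LinearMap.mulLeft ℂ c).rTensor (A ⊗[ℂ] A)
        (op12 H.T₁ (TensorProduct.leftComm ℂ A A A (b ⊗ₜ s))) =
      op23 ((LinearMap.mulRight ℂ b).rTensor A) (op12 H.T₂ (c ⊗ₜ s)) := by
  induction s with
  | zero => simp
  | add x y hx hy => simp only [map_add, TensorProduct.tmul_add, hx, hy]
  | tmul x y =>
    rw [TensorProduct.leftComm_tmul, op12_tmul, op12_tmul, rTensor_assoc_tmul, rTensor_mulLeft_T₁]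
    exact (lTensor_rTensor_assoc_tmul _ _ _).symm

theorem op23_mulRight_op23_T₂_leftComm (p d : A) (s : A ⊗[ℂ] A) :
    op23 ((LinearMap.mulRight ℂ d).lTensor A)
        (op23 H.T₂ (TensorProduct.leftComm ℂ A A A (p ⊗ₜ s))) =
      op12 ((LinearMap.mulLeft ℂ p).lTensor A)
        (op23 H.T₁ (TensorProduct.assoc ℂ A A A (s ⊗ₜ d))) := by
  induction s with
  | zero => simp
  | add x y hx hy =>
    simp only [map_add, TensorProduct.tmul_add, TensorProduct.add_tmul, hx, hy]
  | tmul x y =>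
    rw [TensorProduct.leftComm_tmul, op23_tmul, op23_tmul, TensorProduct.assoc_tmul, op23_tmul,
      ← rTensor_mulLeft_T₁, op12_tmul_eq_rTensor, tmul_eq_assoc_rTensor,
      ← LinearMap.rTensor_comp_apply]
    rfl

theorem rTensor_mulLeft_op12_T₁_leg13_T₁ (a c : A) (t : A ⊗[ℂ] A) :
    (LinearMap.mulLeft ℂ c).rTensor (A ⊗[ℂ] A) (op12 H.T₁ (leg13 H.T₁ (a ⊗ₜ t))) =
      (H.ΔMul t).lTensor A (H.T₂ (c ⊗ₜ a)) := by
  induction t with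
  | zero => simp
  | add x y hx hy =>
    simp only [map_add, TensorProduct.tmul_add, LinearMap.lTensor_add, LinearMap.add_apply, hx, hy]
  | tmul b d =>
    have op12_T₂_tmul_T₁ : op12 H.T₂ (c ⊗ₜ H.T₁ (a ⊗ₜ d)) =
        op23 H.T₁ (TensorProduct.assoc ℂ A A A (H.T₂ (c ⊗ₜ a) ⊗ₜ d)) := by
      rw [← op12_tmul]
      exact LinearMap.congr_fun H.commute_op12_T₂_op23_T₁.eq (c ⊗ₜ (a ⊗ₜ d))
    rw [leg13_tmul, rTensor_mulLeft_op12_T₁_leftComm, op12_T₂_tmul_T₁, ← Module.End.mul_apply,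
      ← map_mul, op23_assoc_tmul]
    exact congrArg (fun f => LinearMap.lTensor A f (H.T₂ (c ⊗ₜ a)))
      (LinearMap.ext fun x => (H.left_Δ_tmul x b d).symm)

theorem op23_mulRight_op23_T₂_leg13_T₂ (a d : A) (t : A ⊗[ℂ] A) :
    op23 ((LinearMap.mulRight ℂ d).lTensor A)
        (op23 H.T₂ (leg13 H.T₂ (TensorProduct.assoc ℂ A A A (t ⊗ₜ a)))) =
      TensorProduct.assoc ℂ A A A ((H.mulΔ t).rTensor A (H.T₁ (a ⊗ₜ d))) := by
  induction t with
  | zero => simp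
  | add x y hx hy =>
    simp only [map_add, TensorProduct.add_tmul, LinearMap.rTensor_add, LinearMap.add_apply, hx, hy]
  | tmul c p =>
    have op23_T₁_assoc_T₂ : op23 H.T₁ (TensorProduct.assoc ℂ A A A (H.T₂ (c ⊗ₜ a) ⊗ₜ d)) =
        op12 H.T₂ (c ⊗ₜ H.T₁ (a ⊗ₜ d)) := by
      rw [← op12_tmul]
      exact (LinearMap.congr_fun H.commute_op12_T₂_op23_T₁.eq (c ⊗ₜ (a ⊗ₜ d))).symm
    rw [TensorProduct.assoc_tmul, leg13_tmul, op23_mulRight_op23_T₂_leftComm, op23_T₁_assoc_T₂,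
      ← Module.End.mul_apply, ← map_mul, op12_tmul_eq_rTensor]
    exact congrArg (fun f => TensorProduct.assoc ℂ A A A (LinearMap.rTensor A f (H.T₁ (a ⊗ₜ d))))
      (LinearMap.ext fun x => (H.right_Δ_tmul x c p).symm)

theorem op23_mulRight_op12_T₂_op23_T₂ (c p a d : A) :
    op23 ((LinearMap.mulRight ℂ d).lTensor A) (op12 H.T₂ (op23 H.T₂ (c ⊗ₜ (p ⊗ₜ a)))) =
      TensorProduct.assoc ℂ A A A ((H.mulΔ (H.T₂ (c ⊗ₜ p))).rTensor A (H.T₁ (a ⊗ₜ d))) :=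
  calc _ = op12 H.T₂ (c ⊗ₜ (LinearMap.mulRight ℂ d).lTensor A (H.T₂ (p ⊗ₜ a))) :=
        (LinearMap.congr_fun (commute_op12_op23_lTensor H.T₂ _).eq (c ⊗ₜ H.T₂ (p ⊗ₜ a))).symm
    _ = _ := by
        rw [← rTensor_mulLeft_T₁, op12_tmul_eq_rTensor, ← LinearMap.rTensor_comp_apply,
          LinearMap.comp_assoc, T₂_comp_mk_comp_mulLeft]

theorem pentagon_T₁ : op23 H.T₁ * op12 H.T₁ = op12 H.T₁ * leg13 H.T₁ * op23 H.T₁ :=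
  TensorProduct.ext_threefold' fun a b d => by
    rw [← sub_eq_zero]
    refine eq_zero_of_forall_rTensor_eq_zero (g := fun c : A => LinearMap.mulLeft ℂ c)
      H.right_nondeg fun c => ?_
    rw [map_sub, sub_eq_zero]
    exact (H.rTensor_mulLeft_op23_T₁_op12_T₁ a b c d).trans
      (H.rTensor_mulLeft_op12_T₁_leg13_T₁ a c _).symm

theorem pentagon_T₂ : op12 H.T₂ * op23 H.T₂ = op23 H.T₂ * leg13 H.T₂ * op12 H.T₂ :=
  TensorProduct.ext_threefold' fun c p a => by
    rw [← sub_eq_zero]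
    refine eq_zero_of_forall_lTensor_eq_zero
      (g := fun d : A => (LinearMap.mulRight ℂ d).lTensor A)
      (fun _ => eq_zero_of_forall_lTensor_eq_zero H.left_nondeg) fun d => ?_
    rw [map_sub, sub_eq_zero]
    refine (H.op23_mulRight_op12_T₂_op23_T₂ c p a d).trans ?_
    rw [Module.End.mul_apply, Module.End.mul_apply, op12_tmul]
    exact (H.op23_mulRight_op23_T₂_leg13_T₂ a d _).symm

end Pentagons

end WeakMultiplierHopfAlgebra

section SlicedLegs

variable {A : Type*} [NonUnitalRing A] [Module ℂ A]

theorem lTensor_op23 {V : Type*} [AddCommGroup V] [Module ℂ V] (F : A ⊗[ℂ] A →ₗ[ℂ] V)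
    (T : Module.End ℂ (A ⊗[ℂ] A)) (s : A ⊗[ℂ] (A ⊗[ℂ] A)) :
    F.lTensor A (op23 T s) = (F ∘ₗ T).lTensor A s :=
  (LinearMap.lTensor_comp_apply A F T s).symm

theorem rTensor_assoc_symm_op12 {V : Type*} [AddCommGroup V] [Module ℂ V] (F : A ⊗[ℂ] A →ₗ[ℂ] V)
    (T : Module.End ℂ (A ⊗[ℂ] A)) (s : A ⊗[ℂ] (A ⊗[ℂ] A)) :
    F.rTensor A ((TensorProduct.assoc ℂ A A A).symm (op12 T s)) =
      (F ∘ₗ T).rTensor A ((TensorProduct.assoc ℂ A A A).symm s) := by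
  rw [LinearMap.rTensor_comp_apply]
  exact congrArg _ ((TensorProduct.assoc ℂ A A A).symm_apply_apply _)

theorem rTensor_sliceRight_assoc_symm (φ : A →ₗ[ℂ] ℂ) (s : A ⊗[ℂ] (A ⊗[ℂ] A)) :
    (sliceRight φ).rTensor A ((TensorProduct.assoc ℂ A A A).symm s) =
      (sliceLeft φ).lTensor A s := by
  refine LinearMap.congr_fun (f := (sliceRight φ).rTensor A ∘ₗ
    (TensorProduct.assoc ℂ A A A).symm.toLinearMap) (TensorProduct.ext_threefold' fun a b c => ?_) s
  simp [TensorProduct.smul_tmul]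

theorem rTensor_sliceLeft_assoc_symm_leftComm (φ : A →ₗ[ℂ] ℂ) (b : A) (t : A ⊗[ℂ] A) :
    (sliceLeft φ).rTensor A ((TensorProduct.assoc ℂ A A A).symm
      (TensorProduct.leftComm ℂ A A A (b ⊗ₜ t))) = b ⊗ₜ sliceLeft φ t := by
  induction t with
  | zero => simp
  | add x y hx hy => simp only [map_add, TensorProduct.tmul_add, hx, hy]
  | tmul x y => simp [TensorProduct.smul_tmul]

variable [IsScalarTower ℂ A A] [SMulCommClass ℂ A A]

theorem mul'_comp_rTensor_mulLeft (c : A) :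
    LinearMap.mul' ℂ A ∘ₗ (LinearMap.mulLeft ℂ c).rTensor A =
      LinearMap.mulLeft ℂ c ∘ₗ LinearMap.mul' ℂ A :=
  TensorProduct.ext' fun a b => by simp [mul_assoc]

theorem mul'_comp_lTensor_mulRight (c : A) :
    LinearMap.mul' ℂ A ∘ₗ (LinearMap.mulRight ℂ c).lTensor A =
      LinearMap.mulRight ℂ c ∘ₗ LinearMap.mul' ℂ A :=
  TensorProduct.ext' fun a b => by simp [mul_assoc]

theorem lTensor_mulRight_rTensor_mulRight (a b : A) (t : A ⊗[ℂ] A) :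
    (LinearMap.mulRight ℂ b).lTensor A ((LinearMap.mulRight ℂ a).rTensor A t) = t * (a ⊗ₜ b) := by
  induction t with
  | zero => simp
  | add x y hx hy => simp only [map_add, add_mul, hx, hy]
  | tmul x y => simp [Algebra.TensorProduct.tmul_mul_tmul]

theorem lTensor_mulLeft_rTensor_mulLeft (a b : A) (t : A ⊗[ℂ] A) :
    (LinearMap.mulLeft ℂ b).lTensor A ((LinearMap.mulLeft ℂ a).rTensor A t) = (a ⊗ₜ b) * t := by
  induction t with
  | zero => simp
  | add x y hx hy => simp only [map_add, mul_add, hx, hy]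
  | tmul x y => simp [Algebra.TensorProduct.tmul_mul_tmul]

end SlicedLegs

/-- The multiplier with left multiplication `f` and right multiplication `g`. Over a non-degenerate
algebra the module properties of `f` and `g` follow from their compatibility. -/
def NonDegenerate.multiplier {A : Type*} [NonUnitalRing A] [Module ℂ A] [IsScalarTower ℂ A A]
    [SMulCommClass ℂ A A] (hA : NonDegenerate A) (f g : Module.End ℂ A)
    (h : ∀ a b, g a * b = a * f b) : Multiplier A :=
  Multiplier.mk f g
    (fun a b => hA.eq_of_forall_mul_left fun c => by rw [← h, ← mul_assoc, ← mul_assoc, h])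
    (fun a b => hA.eq_of_forall_mul_right fun c => by rw [h, mul_assoc, mul_assoc, h])
    h

namespace WeakMultiplierHopfAlgebra

variable {A : Type*} [NonUnitalRing A] [Module ℂ A] [IsScalarTower ℂ A A] [SMulCommClass ℂ A A]

section CounitFormulas

variable (H : WeakMultiplierHopfAlgebra A)

theorem sliceLeft_comp_T₁ : sliceLeft H.ε ∘ₗ H.T₁ = LinearMap.mul' ℂ A :=
  TensorProduct.ext' H.counit_left

theorem sliceRight_comp_T₂ : sliceRight H.ε ∘ₗ H.T₂ = LinearMap.mul' ℂ A :=
  TensorProduct.ext' H.counit_right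

theorem lTensor_sliceLeft_op12_T₂ (c : A) (t : A ⊗[ℂ] A) :
    (sliceLeft H.ε).lTensor A (op12 H.T₂ (c ⊗ₜ t)) = (LinearMap.mulLeft ℂ c).rTensor A t := by
  rw [← rTensor_sliceRight_assoc_symm, rTensor_assoc_symm_op12, sliceRight_comp_T₂,
    rTensor_assoc_symm_tmul]
  rfl

theorem lTensor_sliceLeft_op23_T₁ (b : A) (t : A ⊗[ℂ] A) :
    (sliceLeft H.ε).lTensor A (op23 H.T₁ (TensorProduct.assoc ℂ A A A (t ⊗ₜ b))) =
      (LinearMap.mulRight ℂ b).lTensor A t := by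
  rw [lTensor_op23, sliceLeft_comp_T₁, lTensor_assoc_tmul]
  rfl

theorem sliceThird_leg13_T₂ (t : A ⊗[ℂ] A) (a : A) :
    sliceThird H.ε (leg13 H.T₂ (TensorProduct.assoc ℂ A A A (t ⊗ₜ a))) =
      (LinearMap.mulRight ℂ a).rTensor A t := by
  induction t with
  | zero => simp
  | add x y hx hy => simp only [map_add, TensorProduct.add_tmul, hx, hy]
  | tmul b c =>
    rw [TensorProduct.assoc_tmul, leg13_tmul, sliceThird_leftComm, H.counit_right]
    rfl

theorem rTensor_sliceLeft_leg13_T₁ (a : A) (t : A ⊗[ℂ] A) :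
    (sliceLeft H.ε).rTensor A ((TensorProduct.assoc ℂ A A A).symm (leg13 H.T₁ (a ⊗ₜ t))) =
      (LinearMap.mulLeft ℂ a).lTensor A t := by
  induction t with
  | zero => simp
  | add x y hx hy => simp only [map_add, TensorProduct.tmul_add, hx, hy]
  | tmul b c =>
    rw [leg13_tmul, rTensor_sliceLeft_assoc_symm_leftComm, H.counit_left]
    rfl

/-- In Sweedler notation, `(r ⊗ q)E(a ⊗ 1) = ∑ r a₍₁₎ ⊗ q ε_t(a₍₂₎)`. -/
theorem lTensor_sliceRight_G₂ (t : A ⊗[ℂ] A) (a : A) :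
    (sliceRight H.ε ∘ₗ H.G₂).lTensor A (leg13 H.T₂ (TensorProduct.assoc ℂ A A A (t ⊗ₜ a))) =
      (LinearMap.mulRight ℂ a).rTensor A (H.E.right t) := by
  rw [← lTensor_op23, ← Module.End.mul_apply, op23_G₂_mul_leg13_T₂, Module.End.mul_apply,
    op12_assoc, LinearMap.rTensor_tmul]
  exact H.sliceThird_leg13_T₂ (H.E.right t) a

/-- In Sweedler notation, `(1 ⊗ a)E(b ⊗ c) = ∑ ε_s(a₍₁₎)b ⊗ a₍₂₎c`. -/
theorem rTensor_sliceLeft_G₁ (a : A) (t : A ⊗[ℂ] A) :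
    (sliceLeft H.ε ∘ₗ H.G₁).rTensor A
        ((TensorProduct.assoc ℂ A A A).symm (leg13 H.T₁ (a ⊗ₜ t))) =
      (LinearMap.mulLeft ℂ a).lTensor A (H.E.left t) := by
  rw [← rTensor_assoc_symm_op12, ← Module.End.mul_apply, op12_G₁_mul_leg13_T₁,
    Module.End.mul_apply, op23_tmul, rTensor_sliceLeft_leg13_T₁]

theorem target_compat (a b c : A) :
    c * sliceLeft H.ε (H.E.left (a ⊗ₜ b)) = sliceRight H.ε (H.G₂ (c ⊗ₜ a)) * b := by
  refine LinearMap.congr_fun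
    (f := LinearMap.mulLeft ℂ c ∘ₗ (sliceLeft H.ε ∘ₗ H.E.left) ∘ₗ (TensorProduct.mk ℂ A A).flip b)
    (g := LinearMap.mulRight ℂ b ∘ₗ (sliceRight H.ε ∘ₗ H.G₂) ∘ₗ TensorProduct.mk ℂ A A c)
    (H.eq_of_forall_lTensor_T₂ fun r a => ?_) a
  calc (LinearMap.mulLeft ℂ c ∘ₗ (sliceLeft H.ε ∘ₗ H.E.left) ∘ₗ
        (TensorProduct.mk ℂ A A).flip b).lTensor A (H.T₂ (r ⊗ₜ a))
      = (LinearMap.mulLeft ℂ c).lTensor A ((sliceLeft H.ε).lTensor A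
          ((op23 H.E.left * op12 H.T₂) (r ⊗ₜ (a ⊗ₜ b)))) := by
        rw [LinearMap.lTensor_comp_apply, ← lTensor_assoc_tmul, ← op12_tmul, ← lTensor_op23,
          Module.End.mul_apply]
    _ = (r ⊗ₜ c) * H.E.left (a ⊗ₜ b) := by
        rw [← H.commute_op12_T₂_op23_E_left.eq, Module.End.mul_apply, op23_tmul,
          lTensor_sliceLeft_op12_T₂, lTensor_mulLeft_rTensor_mulLeft]
    _ = H.E.right (r ⊗ₜ c) * (a ⊗ₜ b) := (Multiplier.right_mul_eq_mul_left _ _ _).symm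
    _ = (LinearMap.mulRight ℂ b).lTensor A ((sliceRight H.ε ∘ₗ H.G₂).lTensor A
          (leg13 H.T₂ (r ⊗ₜ (c ⊗ₜ a)))) := by
        rw [← TensorProduct.assoc_tmul, lTensor_sliceRight_G₂, lTensor_mulRight_rTensor_mulRight]
    _ = _ := by rw [leg13_tmul, lTensor_leftComm_tmul, ← LinearMap.lTensor_comp_apply]

theorem source_compat (a b c : A) :
    sliceRight H.ε (H.E.right (c ⊗ₜ a)) * b = c * sliceLeft H.ε (H.G₁ (a ⊗ₜ b)) := by
  refine LinearMap.congr_fun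
    (f := LinearMap.mulRight ℂ b ∘ₗ (sliceRight H.ε ∘ₗ H.E.right) ∘ₗ TensorProduct.mk ℂ A A c)
    (g := LinearMap.mulLeft ℂ c ∘ₗ (sliceLeft H.ε ∘ₗ H.G₁) ∘ₗ (TensorProduct.mk ℂ A A).flip b)
    (H.eq_of_forall_rTensor_T₁ fun a d => ?_) a
  calc (LinearMap.mulRight ℂ b ∘ₗ (sliceRight H.ε ∘ₗ H.E.right) ∘ₗ
        TensorProduct.mk ℂ A A c).rTensor A (H.T₁ (a ⊗ₜ d))
      = (LinearMap.mulRight ℂ b).rTensor A ((sliceLeft H.ε).lTensor A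
          ((op12 H.E.right * op23 H.T₁) (c ⊗ₜ (a ⊗ₜ d)))) := by
        rw [LinearMap.rTensor_comp_apply, ← rTensor_assoc_symm_tmul, ← op23_tmul,
          ← rTensor_assoc_symm_op12, rTensor_sliceRight_assoc_symm, Module.End.mul_apply]
    _ = H.E.right (c ⊗ₜ a) * (b ⊗ₜ d) := by
        rw [H.commute_op12_E_right_op23_T₁.eq, Module.End.mul_apply, op12_tmul,
          lTensor_sliceLeft_op23_T₁, ← lTensor_mulRight_rTensor_mulRight, lTensor_rTensor_comm]
    _ = (c ⊗ₜ a) * H.E.left (b ⊗ₜ d) := Multiplier.right_mul_eq_mul_left _ _ _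
    _ = (LinearMap.mulLeft ℂ c).rTensor A ((sliceLeft H.ε ∘ₗ H.G₁).rTensor A
          ((TensorProduct.assoc ℂ A A A).symm (leg13 H.T₁ (a ⊗ₜ (b ⊗ₜ d))))) := by
        rw [rTensor_sliceLeft_G₁, ← lTensor_mulLeft_rTensor_mulLeft, lTensor_rTensor_comm]
    _ = _ := by
        rw [leg13_tmul, rTensor_assoc_symm_leftComm_tmul, ← LinearMap.rTensor_comp_apply]

end CounitFormulas

section Antipode

variable {H : WeakMultiplierHopfAlgebra A} {R₁ R₂ : Module.End ℂ (A ⊗[ℂ] A)}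

theorem commute_op12_T₂_op23_R₁ (hR₁ : IsGeneralizedInverse H.T₁ H.E.left H.G₁ R₁) :
    Commute (op12 H.T₂) (op23 R₁) :=
  (hR₁.map op23).commute H.commute_op12_T₂_op23_T₁ H.commute_op12_T₂_op23_E_left
    H.commute_op12_T₂_op23_G₁

theorem commute_op23_T₁_op12_R₂ (hR₂ : IsGeneralizedInverse H.T₂ H.E.right H.G₂ R₂) :
    Commute (op23 H.T₁) (op12 R₂) :=
  (hR₂.map op12).commute H.commute_op12_T₂_op23_T₁.symm H.commute_op12_E_right_op23_T₁.symm
    H.commute_op12_G₂_op23_T₁.symm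

/-- The map `a ⊗ b ↦ S(a)b`. -/
def antipodeLeft (H : WeakMultiplierHopfAlgebra A) (R₁ : Module.End ℂ (A ⊗[ℂ] A)) :
    A ⊗[ℂ] A →ₗ[ℂ] A :=
  sliceLeft H.ε ∘ₗ R₁

/-- The map `b ⊗ a ↦ bS(a)`. -/
def antipodeRight (H : WeakMultiplierHopfAlgebra A) (R₂ : Module.End ℂ (A ⊗[ℂ] A)) :
    A ⊗[ℂ] A →ₗ[ℂ] A :=
  sliceRight H.ε ∘ₗ R₂

theorem antipodeLeft_comp_E_left (hR₁ : IsGeneralizedInverse H.T₁ H.E.left H.G₁ R₁) :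
    H.antipodeLeft R₁ ∘ₗ H.E.left = H.antipodeLeft R₁ :=
  congrArg (sliceLeft H.ε ∘ₗ ·) hR₁.mul_right_eq

theorem antipodeRight_comp_E_right (hR₂ : IsGeneralizedInverse H.T₂ H.E.right H.G₂ R₂) :
    H.antipodeRight R₂ ∘ₗ H.E.right = H.antipodeRight R₂ :=
  congrArg (sliceRight H.ε ∘ₗ ·) hR₂.mul_right_eq

theorem antipodeLeft_comp_T₁ (hR₁ : IsGeneralizedInverse H.T₁ H.E.left H.G₁ R₁) :
    H.antipodeLeft R₁ ∘ₗ H.T₁ = sliceLeft H.ε ∘ₗ H.G₁ :=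
  congrArg (sliceLeft H.ε ∘ₗ ·) hR₁.2.1

theorem antipodeRight_comp_T₂ (hR₂ : IsGeneralizedInverse H.T₂ H.E.right H.G₂ R₂) :
    H.antipodeRight R₂ ∘ₗ H.T₂ = sliceRight H.ε ∘ₗ H.G₂ :=
  congrArg (sliceRight H.ε ∘ₗ ·) hR₂.2.1

theorem mul'_comp_R₁ (hR₁ : IsGeneralizedInverse H.T₁ H.E.left H.G₁ R₁) :
    LinearMap.mul' ℂ A ∘ₗ R₁ = sliceLeft H.ε ∘ₗ H.E.left := by
  rw [← sliceLeft_comp_T₁, LinearMap.comp_assoc, ← Module.End.mul_eq_comp, hR₁.1]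

theorem mul'_comp_R₂ (hR₂ : IsGeneralizedInverse H.T₂ H.E.right H.G₂ R₂) :
    LinearMap.mul' ℂ A ∘ₗ R₂ = sliceRight H.ε ∘ₗ H.E.right := by
  rw [← sliceRight_comp_T₂, LinearMap.comp_assoc, ← Module.End.mul_eq_comp, hR₂.1]

/-- The map `c ⊗ a ⊗ b ↦ c(S(a)b)`. -/
def mulAntipodeLeft (H : WeakMultiplierHopfAlgebra A) (R₁ : Module.End ℂ (A ⊗[ℂ] A)) :
    A ⊗[ℂ] (A ⊗[ℂ] A) →ₗ[ℂ] A :=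
  LinearMap.mul' ℂ A ∘ₗ (H.antipodeLeft R₁).lTensor A

/-- The map `c ⊗ a ⊗ b ↦ (cS(a))b`. -/
def antipodeRightMul (H : WeakMultiplierHopfAlgebra A) (R₂ : Module.End ℂ (A ⊗[ℂ] A)) :
    A ⊗[ℂ] (A ⊗[ℂ] A) →ₗ[ℂ] A :=
  LinearMap.mul' ℂ A ∘ₗ (H.antipodeRight R₂).rTensor A ∘ₗ
    (TensorProduct.assoc ℂ A A A).symm.toLinearMap

theorem mulAntipodeLeft_comp_op23_E_left
    (hR₁ : IsGeneralizedInverse H.T₁ H.E.left H.G₁ R₁) :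
    H.mulAntipodeLeft R₁ ∘ₗ op23 H.E.left = H.mulAntipodeLeft R₁ :=
  LinearMap.ext fun s => congrArg (LinearMap.mul' ℂ A) (by
    rw [lTensor_op23, antipodeLeft_comp_E_left hR₁])

theorem antipodeRightMul_comp_op12_E_right
    (hR₂ : IsGeneralizedInverse H.T₂ H.E.right H.G₂ R₂) :
    H.antipodeRightMul R₂ ∘ₗ op12 H.E.right = H.antipodeRightMul R₂ :=
  LinearMap.ext fun s => congrArg (LinearMap.mul' ℂ A) (by
    simp only [LinearMap.comp_apply, LinearEquiv.coe_coe]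
    rw [rTensor_assoc_symm_op12, antipodeRight_comp_E_right hR₂])

theorem mulAntipodeLeft_comp_op12_T₂ (hR₁ : IsGeneralizedInverse H.T₁ H.E.left H.G₁ R₁)
    (hR₂ : IsGeneralizedInverse H.T₂ H.E.right H.G₂ R₂) :
    H.mulAntipodeLeft R₁ ∘ₗ op12 H.T₂ = H.antipodeRightMul R₂ ∘ₗ op12 H.T₂ := by
  refine TensorProduct.ext_threefold' fun c a b => ?_
  calc LinearMap.mul' ℂ A ((H.antipodeLeft R₁).lTensor A (op12 H.T₂ (c ⊗ₜ (a ⊗ₜ b))))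
      = LinearMap.mul' ℂ A ((LinearMap.mulLeft ℂ c).rTensor A (R₁ (a ⊗ₜ b))) := by
        rw [antipodeLeft, ← lTensor_op23, ← Module.End.mul_apply (op23 R₁),
          ← (commute_op12_T₂_op23_R₁ hR₁).eq, Module.End.mul_apply, op23_tmul,
          lTensor_sliceLeft_op12_T₂]
    _ = c * sliceLeft H.ε (H.E.left (a ⊗ₜ b)) :=
        (LinearMap.congr_fun (mul'_comp_rTensor_mulLeft c) _).trans
          (congrArg (c * ·) (LinearMap.congr_fun (mul'_comp_R₁ hR₁) _))
    _ = sliceRight H.ε (H.G₂ (c ⊗ₜ a)) * b := H.target_compat a b c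
    _ = LinearMap.mul' ℂ A ((H.antipodeRight R₂).rTensor A
          ((TensorProduct.assoc ℂ A A A).symm (op12 H.T₂ (c ⊗ₜ (a ⊗ₜ b))))) := by
        rw [rTensor_assoc_symm_op12, antipodeRight_comp_T₂ hR₂]
        rfl

theorem mulAntipodeLeft_comp_op23_T₁ (hR₁ : IsGeneralizedInverse H.T₁ H.E.left H.G₁ R₁)
    (hR₂ : IsGeneralizedInverse H.T₂ H.E.right H.G₂ R₂) :
    H.mulAntipodeLeft R₁ ∘ₗ op23 H.T₁ = H.antipodeRightMul R₂ ∘ₗ op23 H.T₁ := by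
  refine TensorProduct.ext_threefold' fun c a b => ?_
  calc LinearMap.mul' ℂ A ((H.antipodeLeft R₁).lTensor A (op23 H.T₁ (c ⊗ₜ (a ⊗ₜ b))))
      = c * sliceLeft H.ε (H.G₁ (a ⊗ₜ b)) := by
        rw [lTensor_op23, antipodeLeft_comp_T₁ hR₁]
        rfl
    _ = sliceRight H.ε (H.E.right (c ⊗ₜ a)) * b := (H.source_compat a b c).symm
    _ = LinearMap.mul' ℂ A ((LinearMap.mulRight ℂ b).lTensor A (R₂ (c ⊗ₜ a))) :=
        ((LinearMap.congr_fun (mul'_comp_lTensor_mulRight b) _).trans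
          (congrArg (· * b) (LinearMap.congr_fun (mul'_comp_R₂ hR₂) _))).symm
    _ = LinearMap.mul' ℂ A ((H.antipodeRight R₂).rTensor A
          ((TensorProduct.assoc ℂ A A A).symm (op23 H.T₁ (c ⊗ₜ (a ⊗ₜ b))))) := by
        rw [antipodeRight, ← rTensor_assoc_symm_op12, ← Module.End.mul_apply (op12 R₂),
          ← (commute_op23_T₁_op12_R₂ hR₂).eq, Module.End.mul_apply, op12_tmul,
          rTensor_sliceRight_assoc_symm, lTensor_sliceLeft_op23_T₁]

theorem mulAntipodeLeft_eq_antipodeRightMul (hR₁ : IsGeneralizedInverse H.T₁ H.E.left H.G₁ R₁)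
    (hR₂ : IsGeneralizedInverse H.T₂ H.E.right H.G₂ R₂) :
    H.mulAntipodeLeft R₁ = H.antipodeRightMul R₂ := by
  -- With `P = (E ⊗ 1)` acting on the right and `Q = (1 ⊗ E)` acting on the left,
  -- the two maps agree after `P` and after `Q`, the first absorbs `Q` and the second absorbs `P`.
  have comp_P : H.mulAntipodeLeft R₁ ∘ₗ op12 H.E.right =
      H.antipodeRightMul R₂ ∘ₗ op12 H.E.right := by
    rw [← hR₂.1, map_mul, Module.End.mul_eq_comp, ← LinearMap.comp_assoc,
      mulAntipodeLeft_comp_op12_T₂ hR₁ hR₂, LinearMap.comp_assoc]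
  have comp_Q : H.mulAntipodeLeft R₁ ∘ₗ op23 H.E.left =
      H.antipodeRightMul R₂ ∘ₗ op23 H.E.left := by
    rw [← hR₁.1, map_mul, Module.End.mul_eq_comp, ← LinearMap.comp_assoc,
      mulAntipodeLeft_comp_op23_T₁ hR₁ hR₂, LinearMap.comp_assoc]
  have P_comm_Q : op12 H.E.right ∘ₗ op23 H.E.left = op23 H.E.left ∘ₗ op12 H.E.right :=
    (H.nondeg₃.commute_left_right (leg23 H.E) (leg12 H.E)).symm
  rw [← mulAntipodeLeft_comp_op23_E_left hR₁, comp_Q, ← antipodeRightMul_comp_op12_E_right hR₂,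
    ← comp_P, LinearMap.comp_assoc, P_comm_Q, ← LinearMap.comp_assoc,
    mulAntipodeLeft_comp_op23_E_left hR₁]

/-- `(cS(a))b = c(S(a)b)`. -/
theorem antipode_compat (hR₁ : IsGeneralizedInverse H.T₁ H.E.left H.G₁ R₁)
    (hR₂ : IsGeneralizedInverse H.T₂ H.E.right H.G₂ R₂) (a b c : A) :
    H.antipodeRight R₂ (c ⊗ₜ a) * b = c * H.antipodeLeft R₁ (a ⊗ₜ b) :=
  LinearMap.congr_fun (mulAntipodeLeft_eq_antipodeRightMul hR₁ hR₂).symm (c ⊗ₜ (a ⊗ₜ b))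

theorem exists_isAntipode (H : WeakMultiplierHopfAlgebra A) : ∃ S, H.IsAntipode S := by
  obtain ⟨R₁, hR₁⟩ := H.exists_R₁
  obtain ⟨R₂, hR₂⟩ := H.exists_R₂
  let f := (TensorProduct.mk ℂ A A).compr₂ (H.antipodeLeft R₁)
  let g := (TensorProduct.mk ℂ A A).flip.compr₂ (H.antipodeRight R₂)
  let S : A →ₗ[ℂ] Multiplier A :=
    { toFun := fun a =>
        H.nondeg.multiplier (f a) (g a) fun c b => antipode_compat hR₁ hR₂ a b c
      map_add' := fun a b => Multiplier.ext (map_add f a b) (map_add g a b)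
      map_smul' := fun z a => Multiplier.ext (map_smul f z a) (map_smul g z a) }
  exact ⟨S, R₁, R₂, hR₁, hR₂, fun _ _ => rfl, fun _ _ => rfl⟩

theorem antipodeLeft_surjective (hR₁ : IsGeneralizedInverse H.T₁ H.E.left H.G₁ R₁) :
    Function.Surjective (H.antipodeLeft R₁) := by
  rw [← LinearMap.range_eq_top]
  set V := LinearMap.range (H.antipodeLeft R₁) with hV
  have mkQ_comp : V.mkQ ∘ₗ sliceLeft H.ε ∘ₗ H.G₁ = 0 := by
    rw [← antipodeLeft_comp_T₁ hR₁, ← LinearMap.comp_assoc, hV, LinearMap.range_mkQ_comp,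
      LinearMap.zero_comp]
  have mkQ_E_left (t : A ⊗[ℂ] A) : V.mkQ.rTensor A (H.E.left t) = 0 := by
    refine eq_zero_of_forall_lTensor_eq_zero (g := fun a : A => LinearMap.mulLeft ℂ a)
      H.right_nondeg fun a => ?_
    rw [lTensor_rTensor_comm, ← rTensor_sliceLeft_G₁, ← LinearMap.rTensor_comp_apply, mkQ_comp,
      LinearMap.rTensor_zero, LinearMap.zero_apply]
  refine H.full_left V ?_
  rintro _ ⟨t, rfl⟩
  rw [← H.E_left_mul_T₁, Module.End.mul_apply]
  exact (rTensor_exact A (LinearMap.exact_subtype_mkQ V) V.mkQ_surjective _).mp (mkQ_E_left _)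

theorem antipodeRight_surjective (hR₂ : IsGeneralizedInverse H.T₂ H.E.right H.G₂ R₂) :
    Function.Surjective (H.antipodeRight R₂) := by
  rw [← LinearMap.range_eq_top]
  set W := LinearMap.range (H.antipodeRight R₂) with hW
  have mkQ_comp : W.mkQ ∘ₗ sliceRight H.ε ∘ₗ H.G₂ = 0 := by
    rw [← antipodeRight_comp_T₂ hR₂, ← LinearMap.comp_assoc, hW, LinearMap.range_mkQ_comp,
      LinearMap.zero_comp]
  have mkQ_E_right (t : A ⊗[ℂ] A) : W.mkQ.lTensor A (H.E.right t) = 0 := by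
    refine eq_zero_of_forall_rTensor_eq_zero (g := fun a : A => LinearMap.mulRight ℂ a)
      H.left_nondeg fun a => ?_
    rw [← lTensor_rTensor_comm, ← lTensor_sliceRight_G₂, ← LinearMap.lTensor_comp_apply, mkQ_comp,
      LinearMap.lTensor_zero, LinearMap.zero_apply]
  refine H.full_right W ?_
  rintro _ ⟨t, rfl⟩
  rw [← H.E_right_mul_T₂, Module.End.mul_apply]
  exact (lTensor_exact A (LinearMap.exact_subtype_mkQ W) W.mkQ_surjective _).mp (mkQ_E_right _)

end Antipode

section SourceTarget

variable (H : WeakMultiplierHopfAlgebra A)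

/-- The multiplier `ε_s(p)`. -/
def source (p : A) : Multiplier A :=
  H.nondeg.multiplier (sliceLeft H.ε ∘ₗ H.G₁ ∘ₗ TensorProduct.mk ℂ A A p)
    (sliceRight H.ε ∘ₗ H.E.right ∘ₗ (TensorProduct.mk ℂ A A).flip p)
    fun a b => H.source_compat p b a

/-- The multiplier `ε_t(p)`. -/
def target (p : A) : Multiplier A :=
  H.nondeg.multiplier (sliceLeft H.ε ∘ₗ H.E.left ∘ₗ TensorProduct.mk ℂ A A p)
    (sliceRight H.ε ∘ₗ H.G₂ ∘ₗ (TensorProduct.mk ℂ A A).flip p)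
    fun a b => (H.target_compat p b a).symm

theorem sourceMap_eq (p : A) : H.sourceMap p = H.source p := by
  have right_sourceMap (b : A) : (H.sourceMap p).right b = sliceRight H.ε (H.E.right (b ⊗ₜ p)) :=
    Classical.epsilon_spec (p := fun y : Multiplier A =>
      ∀ b : A, y.right b = sliceRight H.ε (H.E.right (b ⊗ₜ p))) ⟨H.source p, fun _ => rfl⟩ b
  exact H.nondeg.multiplier_ext_right (LinearMap.ext right_sourceMap)

theorem commute_lTensor_source_right {T : Module.End ℂ (A ⊗[ℂ] A)}
    (hT : Commute (op12 T) (op23 H.E.right)) (p : A) :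
    Commute T ((H.source p).right.lTensor A) := by
  have lTensor_source_right (t : A ⊗[ℂ] A) : (H.source p).right.lTensor A t =
      sliceThird H.ε (op23 H.E.right (TensorProduct.assoc ℂ A A A (t ⊗ₜ p))) :=
    (sliceThird_op23_assoc H.ε H.E.right t p).symm
  refine LinearMap.ext fun t => ?_
  rw [Module.End.mul_apply, Module.End.mul_apply, lTensor_source_right, lTensor_source_right,
    ← LinearMap.rTensor_tmul A T p t, ← op12_assoc, ← Module.End.mul_apply (op23 _), ← hT.eq,
    Module.End.mul_apply]
  exact (LinearMap.congr_fun (sliceThird_comp_op12 H.ε T) _).symm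

theorem commute_rTensor_target_left {T : Module.End ℂ (A ⊗[ℂ] A)}
    (hT : Commute (op12 H.E.left) (op23 T)) (p : A) :
    Commute T ((H.target p).left.rTensor A) := by
  have rTensor_target_left (t : A ⊗[ℂ] A) : (H.target p).left.rTensor A t =
      sliceFirst H.ε (op12 H.E.left (p ⊗ₜ t)) :=
    (sliceFirst_op12_tmul H.ε H.E.left p t).symm
  refine LinearMap.ext fun t => ?_
  rw [Module.End.mul_apply, Module.End.mul_apply, rTensor_target_left, rTensor_target_left,
    ← op23_tmul, ← Module.End.mul_apply (op12 _), hT.eq, Module.End.mul_apply]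
  exact (LinearMap.congr_fun (sliceFirst_comp_op23 H.ε T) _).symm

theorem lTensor_sliceRight_G₂_op23_source (p : A) (x : A ⊗[ℂ] (A ⊗[ℂ] A)) :
    (sliceRight H.ε ∘ₗ H.G₂).lTensor A
        (leg13 H.T₂ (op23 ((H.source p).right.lTensor A) x)) =
      (H.source p).right.rTensor A
        ((sliceRight H.ε ∘ₗ H.G₂).lTensor A (leg13 H.T₂ x)) := by
  obtain ⟨x, rfl⟩ := (TensorProduct.assoc ℂ A A A).surjective x
  induction x with
  | zero => simp only [map_zero]
  | add x y hx hy => simp only [map_add, hx, hy]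
  | tmul t a =>
    rw [op23_lTensor_assoc_tmul, lTensor_sliceRight_G₂, lTensor_sliceRight_G₂,
      ← LinearMap.rTensor_comp_apply]
    exact congrArg (fun f : Module.End ℂ A => f.rTensor A (H.E.right t))
      (LinearMap.ext fun v => ((H.source p).right_apply_mul v a).symm)

theorem rTensor_sliceLeft_G₁_op12_target (p : A) (x : A ⊗[ℂ] (A ⊗[ℂ] A)) :
    (sliceLeft H.ε ∘ₗ H.G₁).rTensor A ((TensorProduct.assoc ℂ A A A).symm
        (leg13 H.T₁ (op12 ((H.target p).left.rTensor A) x))) =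
      (H.target p).left.lTensor A ((sliceLeft H.ε ∘ₗ H.G₁).rTensor A
        ((TensorProduct.assoc ℂ A A A).symm (leg13 H.T₁ x))) := by
  induction x with
  | zero => simp only [map_zero]
  | add x y hx hy => simp only [map_add, hx, hy]
  | tmul a t =>
    rw [op12_rTensor_tmul, rTensor_sliceLeft_G₁, rTensor_sliceLeft_G₁,
      ← LinearMap.lTensor_comp_apply]
    exact congrArg (fun f : Module.End ℂ A => f.lTensor A (H.E.left t))
      (LinearMap.ext fun v => ((H.target p).left_apply_mul a v).symm)

end SourceTarget

section AntipodeOfSource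

variable {H : WeakMultiplierHopfAlgebra A} {R₁ R₂ : Module.End ℂ (A ⊗[ℂ] A)}

theorem antipodeRight_op12_T₂_op23_E_right
    (hR₂ : IsGeneralizedInverse H.T₂ H.E.right H.G₂ R₂) (s : A ⊗[ℂ] (A ⊗[ℂ] A)) :
    (H.antipodeRight R₂).lTensor A (op12 H.T₂ (op23 H.E.right s)) =
      (H.antipodeRight R₂).lTensor A (op12 H.T₂ s) := by
  rw [← Module.End.mul_apply, H.commute_op12_T₂_op23_E_right.eq, Module.End.mul_apply,
    lTensor_op23, antipodeRight_comp_E_right hR₂]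

theorem antipodeRight_op12_T₂_op23_T₂
    (hR₂ : IsGeneralizedInverse H.T₂ H.E.right H.G₂ R₂) (s : A ⊗[ℂ] (A ⊗[ℂ] A)) :
    (H.antipodeRight R₂).lTensor A (op12 H.T₂ (op23 H.T₂ s)) =
      (sliceRight H.ε ∘ₗ H.G₂).lTensor A (leg13 H.T₂ (op12 H.T₂ s)) := by
  rw [← Module.End.mul_apply, pentagon_T₂, Module.End.mul_apply, Module.End.mul_apply,
    lTensor_op23, antipodeRight_comp_T₂ hR₂]

/-- `((r ⊗ 1)Δ(q))(y ⊗ S(a)) = ((r ⊗ 1)Δ(q))(1 ⊗ S(ay))` for `y = ε_s(p)`. -/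
theorem rTensor_source_right_antipodeRight
    (hR₂ : IsGeneralizedInverse H.T₂ H.E.right H.G₂ R₂) (p : A) (s : A ⊗[ℂ] (A ⊗[ℂ] A)) :
    (H.source p).right.rTensor A ((H.antipodeRight R₂).lTensor A (op12 H.T₂ s)) =
      (H.antipodeRight R₂).lTensor A
        (op12 H.T₂ (op23 ((H.source p).right.lTensor A) s)) := by
  set Y := (H.source p).right.lTensor A
  have E_right_mul_Y : H.E.right * Y = H.T₂ * Y * R₂ := by
    rw [(H.commute_lTensor_source_right H.commute_op12_E_right_op23_E_right p).eq,
      (H.commute_lTensor_source_right H.commute_op12_T₂_op23_E_right p).eq, mul_assoc, hR₂.1]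
  symm
  calc (H.antipodeRight R₂).lTensor A (op12 H.T₂ (op23 Y s))
      = (H.antipodeRight R₂).lTensor A (op12 H.T₂ (op23 H.T₂ (op23 Y (op23 R₂ s)))) := by
        rw [← antipodeRight_op12_T₂_op23_E_right hR₂, ← Module.End.mul_apply (op23 _), ← map_mul,
          E_right_mul_Y, map_mul, map_mul]
        rfl
    _ = (sliceRight H.ε ∘ₗ H.G₂).lTensor A (leg13 H.T₂ (op23 Y (op12 H.T₂ (op23 R₂ s)))) := by
        rw [antipodeRight_op12_T₂_op23_T₂ hR₂, ← Module.End.mul_apply (op12 _),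
          (commute_op12_op23_lTensor H.T₂ _).eq, Module.End.mul_apply]
    _ = (H.source p).right.rTensor A
          ((H.antipodeRight R₂).lTensor A (op12 H.T₂ (op23 (H.T₂ * R₂) s))) := by
        rw [lTensor_sliceRight_G₂_op23_source, ← antipodeRight_op12_T₂_op23_T₂ hR₂, map_mul,
          Module.End.mul_apply]
    _ = _ := by rw [hR₂.1, antipodeRight_op12_T₂_op23_E_right hR₂]

theorem antipodeLeft_op23_T₁_op12_E_left
    (hR₁ : IsGeneralizedInverse H.T₁ H.E.left H.G₁ R₁) (s : A ⊗[ℂ] (A ⊗[ℂ] A)) :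
    (H.antipodeLeft R₁).rTensor A
        ((TensorProduct.assoc ℂ A A A).symm (op23 H.T₁ (op12 H.E.left s))) =
      (H.antipodeLeft R₁).rTensor A ((TensorProduct.assoc ℂ A A A).symm (op23 H.T₁ s)) := by
  rw [← Module.End.mul_apply, ← H.commute_op12_E_left_op23_T₁.eq, Module.End.mul_apply,
    rTensor_assoc_symm_op12, antipodeLeft_comp_E_left hR₁]

theorem antipodeLeft_op23_T₁_op12_T₁
    (hR₁ : IsGeneralizedInverse H.T₁ H.E.left H.G₁ R₁) (s : A ⊗[ℂ] (A ⊗[ℂ] A)) :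
    (H.antipodeLeft R₁).rTensor A
        ((TensorProduct.assoc ℂ A A A).symm (op23 H.T₁ (op12 H.T₁ s))) =
      (sliceLeft H.ε ∘ₗ H.G₁).rTensor A
        ((TensorProduct.assoc ℂ A A A).symm (leg13 H.T₁ (op23 H.T₁ s))) := by
  rw [← Module.End.mul_apply, pentagon_T₁, Module.End.mul_apply, Module.End.mul_apply,
    rTensor_assoc_symm_op12, antipodeLeft_comp_T₁ hR₁]

/-- `(S(a) ⊗ x)(Δ(q)(1 ⊗ r)) = (S(xa) ⊗ 1)(Δ(q)(1 ⊗ r))` for `x = ε_t(p)`. -/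
theorem lTensor_target_left_antipodeLeft
    (hR₁ : IsGeneralizedInverse H.T₁ H.E.left H.G₁ R₁) (p : A) (s : A ⊗[ℂ] (A ⊗[ℂ] A)) :
    (H.target p).left.lTensor A ((H.antipodeLeft R₁).rTensor A
        ((TensorProduct.assoc ℂ A A A).symm (op23 H.T₁ s))) =
      (H.antipodeLeft R₁).rTensor A ((TensorProduct.assoc ℂ A A A).symm
        (op23 H.T₁ (op12 ((H.target p).left.rTensor A) s))) := by
  set X := (H.target p).left.rTensor A
  have E_left_mul_X : H.E.left * X = H.T₁ * X * R₁ := by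
    rw [(H.commute_rTensor_target_left H.commute_op12_E_left_op23_E_left p).eq,
      (H.commute_rTensor_target_left H.commute_op12_E_left_op23_T₁ p).eq, mul_assoc, hR₁.1]
  symm
  calc (H.antipodeLeft R₁).rTensor A
        ((TensorProduct.assoc ℂ A A A).symm (op23 H.T₁ (op12 X s)))
      = (H.antipodeLeft R₁).rTensor A ((TensorProduct.assoc ℂ A A A).symm
          (op23 H.T₁ (op12 H.T₁ (op12 X (op12 R₁ s))))) := by
        rw [← antipodeLeft_op23_T₁_op12_E_left hR₁, ← Module.End.mul_apply (op12 _), ← map_mul,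
          E_left_mul_X, map_mul, map_mul, Module.End.mul_apply, Module.End.mul_apply]
    _ = (sliceLeft H.ε ∘ₗ H.G₁).rTensor A ((TensorProduct.assoc ℂ A A A).symm
          (leg13 H.T₁ (op12 X (op23 H.T₁ (op12 R₁ s))))) := by
        rw [antipodeLeft_op23_T₁_op12_T₁ hR₁, ← Module.End.mul_apply (op23 _),
          ← (commute_op12_rTensor_op23 H.T₁ _).eq, Module.End.mul_apply]
    _ = (H.target p).left.lTensor A ((H.antipodeLeft R₁).rTensor A
          ((TensorProduct.assoc ℂ A A A).symm (op23 H.T₁ (op12 (H.T₁ * R₁) s)))) := by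
        rw [rTensor_sliceLeft_G₁_op12_target, ← antipodeLeft_op23_T₁_op12_T₁ hR₁, map_mul,
          Module.End.mul_apply]
    _ = _ := by rw [hR₁.1, antipodeLeft_op23_T₁_op12_E_left hR₁]

theorem mul_tmul_antipodeLeft (hR₁ : IsGeneralizedInverse H.T₁ H.E.left H.G₁ R₁)
    (hR₂ : IsGeneralizedInverse H.T₂ H.E.right H.G₂ R₂) (a b c : A) (t : A ⊗[ℂ] A) :
    t * (b ⊗ₜ H.antipodeLeft R₁ (a ⊗ₜ c)) =
      (H.antipodeRight R₂ ∘ₗ (TensorProduct.mk ℂ A A).flip a).lTensor A t * (b ⊗ₜ c) := by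
  induction t with
  | zero => simp
  | add x y hx hy => simp only [map_add, add_mul, hx, hy]
  | tmul u v => simp [Algebra.TensorProduct.tmul_mul_tmul, antipode_compat hR₁ hR₂]

/-- `E(yb ⊗ S(a)c) = E(b ⊗ S(ay)c)` for `y = ε_s(p)`. -/
theorem E_left_source_tmul_antipodeLeft_tmul
    (hR₁ : IsGeneralizedInverse H.T₁ H.E.left H.G₁ R₁)
    (hR₂ : IsGeneralizedInverse H.T₂ H.E.right H.G₂ R₂) (p a b c : A) :
    H.E.left ((H.source p).left b ⊗ₜ H.antipodeLeft R₁ (a ⊗ₜ c)) =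
      H.E.left (b ⊗ₜ H.antipodeLeft R₁ ((H.source p).right a ⊗ₜ c)) := by
  have mul_source_left_tmul (d : A) (t : A ⊗[ℂ] A) :
      t * ((H.source p).left b ⊗ₜ d) = (H.source p).right.rTensor A t * (b ⊗ₜ d) := by
    have := Multiplier.right_mul_eq_mul_left (Multiplier.tmul (H.source p) 1) t (b ⊗ₜ d)
    exact this.symm
  have mul_E_left_T₂ (s : A ⊗[ℂ] A) :
      H.T₂ s * ((H.source p).left b ⊗ₜ H.antipodeLeft R₁ (a ⊗ₜ c)) =
        H.T₂ s * (b ⊗ₜ H.antipodeLeft R₁ ((H.source p).right a ⊗ₜ c)) := by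
    induction s with
    | zero => simp only [map_zero, zero_mul]
    | add x y hx hy => simp only [map_add, add_mul, hx, hy]
    | tmul r q =>
      have key := rTensor_source_right_antipodeRight hR₂ p (r ⊗ₜ (q ⊗ₜ a))
      rw [op23_tmul, LinearMap.lTensor_tmul, op12_tmul, op12_tmul, lTensor_assoc_tmul,
        lTensor_assoc_tmul] at key
      rw [mul_source_left_tmul, mul_tmul_antipodeLeft hR₁ hR₂, mul_tmul_antipodeLeft hR₁ hR₂,
        ← key, lTensor_rTensor_comm]
  refine H.nondeg₂.eq_of_forall_mul_left fun w => ?_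
  obtain ⟨f, hf⟩ := H.exists_T₂_mul_eq_E_right
  rw [← Multiplier.right_mul_eq_mul_left, ← Multiplier.right_mul_eq_mul_left, ← hf,
    Module.End.mul_apply, mul_E_left_T₂]

theorem E_left_source_tmul_antipodeLeft (hR₁ : IsGeneralizedInverse H.T₁ H.E.left H.G₁ R₁)
    (hR₂ : IsGeneralizedInverse H.T₂ H.E.right H.G₂ R₂) (p b : A) (v : A ⊗[ℂ] A) :
    H.E.left ((H.source p).left b ⊗ₜ H.antipodeLeft R₁ v) =
      H.E.left (b ⊗ₜ H.antipodeLeft R₁ ((H.source p).right.rTensor A v)) := by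
  induction v with
  | zero => simp only [map_zero, TensorProduct.tmul_zero]
  | add x y hx hy => simp only [map_add, TensorProduct.tmul_add, hx, hy]
  | tmul a c => rw [E_left_source_tmul_antipodeLeft_tmul hR₁ hR₂, LinearMap.rTensor_tmul]

theorem eq_zero_of_forall_E_left_tmul {x : A} (h : ∀ b : A, H.E.left (b ⊗ₜ x) = 0) : x = 0 := by
  have mulRight_eq_zero : LinearMap.mulRight ℂ x = 0 := by
    refine H.eq_of_forall_lTensor_T₂ fun r q => ?_
    rw [LinearMap.lTensor_zero, LinearMap.zero_apply]
    refine eq_zero_of_forall_rTensor_eq_zero (g := fun b : A => LinearMap.mulRight ℂ b)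
      H.left_nondeg fun b => ?_
    rw [← lTensor_rTensor_comm, lTensor_mulRight_rTensor_mulRight, ← H.E_right_mul_T₂,
      Module.End.mul_apply, Multiplier.right_mul_eq_mul_left, h, mul_zero]
  exact H.right_nondeg x fun b => LinearMap.congr_fun mulRight_eq_zero b

theorem antipodeRight_source_mul_antipodeLeft
    (hR₁ : IsGeneralizedInverse H.T₁ H.E.left H.G₁ R₁)
    (hR₂ : IsGeneralizedInverse H.T₂ H.E.right H.G₂ R₂) (p : A) (t v : A ⊗[ℂ] A) :
    H.antipodeRight R₂ ((H.source p).left.lTensor A t) * H.antipodeLeft R₁ v =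
      H.antipodeRight R₂ t * H.antipodeLeft R₁ ((H.source p).right.rTensor A v) := by
  have antipodeLeft_E_left (t : A ⊗[ℂ] A) :
      H.antipodeLeft R₁ (H.E.left t) = H.antipodeLeft R₁ t :=
    LinearMap.congr_fun (antipodeLeft_comp_E_left hR₁) t
  induction t with
  | zero => simp only [map_zero, zero_mul]
  | add x y hx hy => simp only [map_add, add_mul, hx, hy]
  | tmul u b =>
    rw [LinearMap.lTensor_tmul, antipode_compat hR₁ hR₂, antipode_compat hR₁ hR₂,
      ← antipodeLeft_E_left, E_left_source_tmul_antipodeLeft hR₁ hR₂, antipodeLeft_E_left]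

theorem exists_antipodeM_source (hR₁ : IsGeneralizedInverse H.T₁ H.E.left H.G₁ R₁)
    (hR₂ : IsGeneralizedInverse H.T₂ H.E.right H.G₂ R₂) (p : A) :
    ∃ z : Multiplier A,
      z.left ∘ₗ H.antipodeLeft R₁ = H.antipodeLeft R₁ ∘ₗ (H.source p).right.rTensor A ∧
      z.right ∘ₗ H.antipodeRight R₂ = H.antipodeRight R₂ ∘ₗ (H.source p).left.lTensor A := by
  obtain ⟨f, hf⟩ : ∃ f : Module.End ℂ A, f ∘ₗ H.antipodeLeft R₁ =
      H.antipodeLeft R₁ ∘ₗ (H.source p).right.rTensor A :=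
    exists_comp_eq_of_ker_le (antipodeLeft_surjective hR₁) fun v hv =>
      eq_zero_of_forall_E_left_tmul (H := H) fun b => by
        rw [LinearMap.comp_apply, ← E_left_source_tmul_antipodeLeft hR₁ hR₂,
          LinearMap.mem_ker.mp hv, TensorProduct.tmul_zero, map_zero]
  have compat (t : A ⊗[ℂ] A) (x : A) :
      H.antipodeRight R₂ ((H.source p).left.lTensor A t) * x = H.antipodeRight R₂ t * f x := by
    obtain ⟨v, rfl⟩ := antipodeLeft_surjective hR₁ x
    rw [antipodeRight_source_mul_antipodeLeft hR₁ hR₂, ← LinearMap.comp_apply f, hf,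
      LinearMap.comp_apply]
  obtain ⟨g, hg⟩ : ∃ g : Module.End ℂ A, g ∘ₗ H.antipodeRight R₂ =
      H.antipodeRight R₂ ∘ₗ (H.source p).left.lTensor A :=
    exists_comp_eq_of_ker_le (antipodeRight_surjective hR₂) fun t ht =>
      H.left_nondeg _ fun x => by
        rw [LinearMap.comp_apply, compat, LinearMap.mem_ker.mp ht, zero_mul]
  refine ⟨H.nondeg.multiplier f g fun a b => ?_, hf, hg⟩
  obtain ⟨t, rfl⟩ := antipodeRight_surjective hR₂ a
  rw [← LinearMap.comp_apply g, hg, LinearMap.comp_apply, compat]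

variable (H)

theorem isAntipode_antipode : H.IsAntipode H.antipode :=
  Classical.epsilon_spec H.exists_isAntipode

theorem antipodeM_source_spec (p a : A) :
    H.antipodeM (H.source p) * H.antipode a = H.antipode ((H.source p).right a) ∧
      H.antipode a * H.antipodeM (H.source p) = H.antipode ((H.source p).left a) := by
  obtain ⟨R₁, R₂, hR₁, hR₂, left_antipode, right_antipode⟩ := H.isAntipode_antipode
  obtain ⟨z, hz₁, hz₂⟩ := exists_antipodeM_source hR₁ hR₂ p
  refine Classical.epsilon_spec (p := fun z : Multiplier A => ∀ a : A,
    z * H.antipode a = H.antipode ((H.source p).right a) ∧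
      H.antipode a * z = H.antipode ((H.source p).left a)) ⟨z, fun a => ⟨?_, ?_⟩⟩ a
  · refine H.nondeg.multiplier_ext_left (LinearMap.ext fun b => ?_)
    rw [Multiplier.left_mul, Module.End.mul_apply, left_antipode, left_antipode]
    exact LinearMap.congr_fun hz₁ (a ⊗ₜ b)
  · refine H.nondeg.multiplier_ext_right (LinearMap.ext fun b => ?_)
    rw [Multiplier.right_mul, Module.End.mul_apply, right_antipode, right_antipode]
    exact LinearMap.congr_fun hz₂ (b ⊗ₜ a)

theorem E_left_source_tmul (p b x : A) :
    H.E.left ((H.source p).left b ⊗ₜ x) =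
      H.E.left (b ⊗ₜ (H.antipodeM (H.source p)).left x) := by
  obtain ⟨R₁, R₂, hR₁, hR₂, left_antipode, -⟩ := H.isAntipode_antipode
  have antipodeM_comp : (H.antipodeM (H.source p)).left ∘ₗ H.antipodeLeft R₁ =
      H.antipodeLeft R₁ ∘ₗ (H.source p).right.rTensor A :=
    TensorProduct.ext' fun a c => by
      have := congrArg (fun m : Multiplier A => m.left c) (H.antipodeM_source_spec p a).1
      rw [Multiplier.left_mul, Module.End.mul_apply, left_antipode, left_antipode] at this
      exact this
  obtain ⟨v, rfl⟩ := antipodeLeft_surjective hR₁ x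
  rw [E_left_source_tmul_antipodeLeft hR₁ hR₂, ← LinearMap.comp_apply _ (H.antipodeLeft R₁),
    antipodeM_comp, LinearMap.comp_apply]

theorem eq_zero_of_forall_antipode_left {v : A} (h : ∀ a, (H.antipode a).left v = 0) :
    v = 0 := by
  obtain ⟨R₁, R₂, hR₁, hR₂, left_antipode, -⟩ := H.isAntipode_antipode
  have mulRight_comp_antipodeRight : LinearMap.mulRight ℂ v ∘ₗ H.antipodeRight R₂ = 0 :=
    TensorProduct.ext' fun u a => by
      have antipodeLeft_eq_zero : H.antipodeLeft R₁ (a ⊗ₜ v) = 0 := (left_antipode a v) ▸ h a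
      rw [LinearMap.comp_apply, LinearMap.mulRight_apply, antipode_compat hR₁ hR₂,
        antipodeLeft_eq_zero, mul_zero, LinearMap.zero_apply]
  refine H.right_nondeg v fun b => ?_
  obtain ⟨t, rfl⟩ := antipodeRight_surjective hR₂ b
  exact LinearMap.congr_fun mulRight_comp_antipodeRight t

end AntipodeOfSource

end WeakMultiplierHopfAlgebra

section TensorSubmodule

variable {K V V' W : Type*} [CommRing K] [AddCommGroup V] [Module K V] [AddCommGroup V']
  [Module K V'] [AddCommGroup W] [Module K W]

/-- The image of `V ⊗ Q` in `V ⊗ W`, for a submodule `Q` of `W`. -/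
def tensorSubmodule (V : Type*) [AddCommGroup V] [Module K V] (Q : Submodule K W) :
    Submodule K (V ⊗[K] W) :=
  LinearMap.range (Q.subtype.lTensor V)

theorem mem_tensorSubmodule_iff {Q : Submodule K W} {t : V ⊗[K] W} :
    t ∈ tensorSubmodule V Q ↔ Q.mkQ.lTensor V t = 0 := by
  rw [tensorSubmodule, ← lTensor_mkQ, LinearMap.mem_ker]

theorem lTensor_mem_tensorSubmodule {f : V' →ₗ[K] W} {Q : Submodule K W} (hf : ∀ x, f x ∈ Q)
    (t : V ⊗[K] V') : f.lTensor V t ∈ tensorSubmodule V Q :=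
  ⟨(f.codRestrict Q hf).lTensor V t, by
    rw [← LinearMap.lTensor_comp_apply, LinearMap.subtype_comp_codRestrict]⟩

theorem tensorSubmodule_induction {Q : Submodule K W} {S : Submodule K (V ⊗[K] W)}
    (hS : ∀ v, ∀ w ∈ Q, v ⊗ₜ w ∈ S) : tensorSubmodule V Q ≤ S := by
  rintro _ ⟨u, rfl⟩
  induction u with
  | zero => exact map_zero (Q.subtype.lTensor V) ▸ S.zero_mem
  | add x y hx hy => exact map_add (Q.subtype.lTensor V) x y ▸ S.add_mem hx hy
  | tmul v w => exact hS v w w.2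

theorem mem_tensorSubmodule_of_forall_rTensor_mem {Q : Submodule K W} [Module.Free K (W ⧸ Q)]
    {ι : Type*} {g : ι → V →ₗ[K] V'} (hg : ∀ v, (∀ i, g i v = 0) → v = 0) {t : V ⊗[K] W}
    (ht : ∀ i, (g i).rTensor W t ∈ tensorSubmodule V' Q) : t ∈ tensorSubmodule V Q := by
  rw [mem_tensorSubmodule_iff]
  refine eq_zero_of_forall_rTensor_eq_zero hg fun i => ?_
  rw [← lTensor_rTensor_comm]
  exact mem_tensorSubmodule_iff.mp (ht i)

end TensorSubmodule

section DualBasis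

variable {K V : Type*} [Field K] [AddCommGroup V] [Module K V]

theorem exists_dual_basis (F : Submodule K V) [FiniteDimensional K F]
    (W : Submodule K (Module.Dual K V)) (hW : ∀ v ∈ F, (∀ φ ∈ W, φ v = 0) → v = 0) :
    ∃ (n : ℕ) (b : Fin n → V) (φ : Fin n → Module.Dual K V),
      (∀ i, b i ∈ F) ∧ (∀ i, φ i ∈ W) ∧ ∀ v ∈ F, v = ∑ i, φ i v • b i := by
  have map_eq_top : W.map F.subtype.dualMap = ⊤ := by
    have dualCoannihilator_eq_bot : (W.map F.subtype.dualMap).dualCoannihilator = ⊥ := by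
      refine (Submodule.eq_bot_iff _).mpr fun v hv => Subtype.ext (hW v v.2 fun φ hφ => ?_)
      exact (Submodule.mem_dualCoannihilator _).mp hv _ (Submodule.mem_map_of_mem hφ)
    rw [← Subspace.dualCoannihilator_dualAnnihilator_eq (W := W.map F.subtype.dualMap),
      dualCoannihilator_eq_bot, Submodule.dualAnnihilator_bot]
  let b := Module.finBasis K F
  have exists_extension (i) : b.coord i ∈ W.map F.subtype.dualMap := map_eq_top ▸ trivial
  choose φ hφW hφ using exists_extension
  refine ⟨_, fun i => b i, φ, fun i => (b i).2, hφW, fun v hv => ?_⟩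
  have repr_eq (i) : b.repr ⟨v, hv⟩ i = φ i v := (LinearMap.congr_fun (hφ i) ⟨v, hv⟩).symm
  have expansion := congrArg Subtype.val (b.sum_repr ⟨v, hv⟩)
  simp only [Submodule.coe_sum, Submodule.coe_smul, repr_eq] at expansion
  exact expansion.symm

end DualBasis

section SliceTensorSubmodule

variable {A : Type*} [NonUnitalRing A] [Module ℂ A]

theorem sliceLeft_mem {Q : Submodule ℂ A} (φ : A →ₗ[ℂ] ℂ) {t : A ⊗[ℂ] A}
    (ht : t ∈ tensorSubmodule A Q) : sliceLeft φ t ∈ Q := by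
  refine tensorSubmodule_induction (S := Q.comap (sliceLeft φ)) (fun a q hq => ?_) ht
  rw [Submodule.mem_comap, sliceLeft_tmul]
  exact Q.smul_mem _ hq

theorem sliceRight_add (φ ψ : A →ₗ[ℂ] ℂ) (t : A ⊗[ℂ] A) :
    sliceRight (φ + ψ) t = sliceRight φ t + sliceRight ψ t := by
  simp [sliceRight, LinearMap.lTensor_add]

theorem sliceRight_smul (c : ℂ) (φ : A →ₗ[ℂ] ℂ) (t : A ⊗[ℂ] A) :
    sliceRight (c • φ) t = c • sliceRight φ t := by
  simp [sliceRight, LinearMap.lTensor_smul]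

theorem sliceRight_comp (φ : A →ₗ[ℂ] ℂ) (f : A →ₗ[ℂ] A) (t : A ⊗[ℂ] A) :
    sliceRight (φ ∘ₗ f) t = sliceRight φ (f.lTensor A t) := by
  simp [sliceRight, LinearMap.lTensor_comp_apply]

theorem eq_sum_sliceRight_tmul {n : ℕ} {F : Submodule ℂ A} {b : Fin n → A}
    {φ : Fin n → A →ₗ[ℂ] ℂ} (h : ∀ v ∈ F, v = ∑ i, φ i v • b i) {t : A ⊗[ℂ] A}
    (ht : t ∈ tensorSubmodule A F) : t = ∑ i, sliceRight (φ i) t ⊗ₜ b i := by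
  obtain ⟨u, rfl⟩ := ht
  induction u with
  | zero => simp
  | add x y hx hy =>
    simp only [map_add, TensorProduct.add_tmul, Finset.sum_add_distrib, ← hx, ← hy]
  | tmul a v =>
    simp only [LinearMap.lTensor_tmul, Submodule.subtype_apply, sliceRight_tmul,
      TensorProduct.smul_tmul]
    rw [← TensorProduct.tmul_sum, ← h v v.2]

end SliceTensorSubmodule

namespace WeakMultiplierHopfAlgebra

variable {A : Type*} [NonUnitalRing A] [Module ℂ A] [IsScalarTower ℂ A A] [SMulCommClass ℂ A A]
variable (H : WeakMultiplierHopfAlgebra A)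

section LocalUnits

theorem lTensor_target_left_T₁_mem {a b : A} {Q : Submodule ℂ A}
    (hQ : H.T₁ (a ⊗ₜ b) ∈ tensorSubmodule A Q) (p : A) :
    (H.target p).left.lTensor A (H.T₁ (a ⊗ₜ b)) ∈ tensorSubmodule A Q := by
  obtain ⟨R₁, R₂, hR₁, -, left_antipode, -⟩ := H.isAntipode_antipode
  have antipodeLeft_comp_mk (c : A) :
      H.antipodeLeft R₁ ∘ₗ TensorProduct.mk ℂ A A c = (H.antipode c).left :=
    LinearMap.ext fun b => (left_antipode c b).symm
  have rTensor_antipode (c : A) :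
      (H.antipode c).left.rTensor A ((H.target p).left.lTensor A (H.T₁ (a ⊗ₜ b))) =
        (H.antipode ((H.target p).left c)).left.rTensor A (H.T₁ (a ⊗ₜ b)) := by
    have := lTensor_target_left_antipodeLeft hR₁ p (c ⊗ₜ (a ⊗ₜ b))
    rwa [op12_rTensor_tmul, op23_tmul, op23_tmul, rTensor_assoc_symm_tmul,
      rTensor_assoc_symm_tmul, antipodeLeft_comp_mk, antipodeLeft_comp_mk,
      lTensor_rTensor_comm] at this
  refine mem_tensorSubmodule_of_forall_rTensor_mem (g := fun c : A => (H.antipode c).left)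
    (fun v hv => H.eq_zero_of_forall_antipode_left hv) fun c => ?_
  obtain ⟨u, hu⟩ := hQ
  rw [rTensor_antipode, ← hu, ← lTensor_rTensor_comm]
  exact LinearMap.mem_range_self _ _

theorem exists_finiteDimensional_target_left_mem (q : A) :
    ∃ Q : Submodule ℂ A, FiniteDimensional ℂ Q ∧ ∀ p, (H.target p).left q ∈ Q := by
  have hq : q ∈ Submodule.span ℂ {x : A | ∃ a b, x = a * b} := H.idempotent ▸ trivial
  induction hq using Submodule.span_induction with
  | mem x hx =>
    obtain ⟨a, b, rfl⟩ := hx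
    obtain ⟨Q, hQ, mem⟩ := TensorProduct.exists_finite_submodule_right_of_setFinite
      {H.T₁ (a ⊗ₜ b)} (Set.finite_singleton _)
    refine ⟨Q, hQ, fun p => ?_⟩
    rw [← H.counit_left, ← LinearMap.comp_apply, ← sliceLeft_comp_lTensor]
    exact sliceLeft_mem _ (H.lTensor_target_left_T₁_mem (mem rfl) p)
  | zero => exact ⟨⊥, inferInstance, fun p => (map_zero (H.target p).left).symm ▸ zero_mem _⟩
  | add x y _ _ hx hy =>
    obtain ⟨Q, hQ, hx⟩ := hx
    obtain ⟨Q', hQ', hy⟩ := hy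
    exact ⟨Q ⊔ Q', inferInstance, fun p => map_add (H.target p).left x y ▸
      Submodule.add_mem_sup (hx p) (hy p)⟩
  | smul c x _ hx =>
    obtain ⟨Q, hQ, hx⟩ := hx
    exact ⟨Q, hQ, fun p => map_smul (H.target p).left c x ▸ Q.smul_mem c (hx p)⟩

/-- The map `p ↦ ε_t(p)q`. -/
def targetAt (q : A) : Module.End ℂ A :=
  sliceLeft H.ε ∘ₗ H.E.left ∘ₗ (TensorProduct.mk ℂ A A).flip q

instance finiteDimensional_range_targetAt (q : A) :
    FiniteDimensional ℂ (LinearMap.range (H.targetAt q)) := by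
  obtain ⟨Q, hQ, hq⟩ := H.exists_finiteDimensional_target_left_mem q
  exact Submodule.finiteDimensional_of_le (LinearMap.range_le_iff_comap.mpr
    (Submodule.eq_top_iff'.mpr hq))

theorem rTensor_mulLeft_of_commute {X : Module.End ℂ (A ⊗[ℂ] A)}
    (hX : Commute (op12 H.T₂) (op23 X)) (r p q : A) :
    (LinearMap.mulLeft ℂ r).rTensor A (X (p ⊗ₜ q)) =
      (sliceLeft H.ε ∘ₗ X ∘ₗ (TensorProduct.mk ℂ A A).flip q).lTensor A (H.T₂ (r ⊗ₜ p)) := by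
  rw [← lTensor_sliceLeft_op12_T₂, ← op23_tmul, ← Module.End.mul_apply, hX.eq,
    Module.End.mul_apply, lTensor_op23, op12_tmul, lTensor_assoc_tmul]
  rfl

theorem mem_tensorSubmodule_of_commute {X : Module.End ℂ (A ⊗[ℂ] A)}
    (hX : Commute (op12 H.T₂) (op23 X)) {Q : Submodule ℂ A} {q : A}
    (hQ : ∀ p, sliceLeft H.ε (X (p ⊗ₜ q)) ∈ Q) (p : A) :
    X (p ⊗ₜ q) ∈ tensorSubmodule A Q :=
  mem_tensorSubmodule_of_forall_rTensor_mem (g := fun r : A => LinearMap.mulLeft ℂ r)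
    H.right_nondeg fun r =>
      (H.rTensor_mulLeft_of_commute hX r p q).symm ▸ lTensor_mem_tensorSubmodule hQ _

theorem E_left_tmul_mem (p q : A) :
    H.E.left (p ⊗ₜ q) ∈ tensorSubmodule A (LinearMap.range (H.targetAt q)) :=
  H.mem_tensorSubmodule_of_commute H.commute_op12_T₂_op23_E_left
    (fun p => LinearMap.mem_range_self (H.targetAt q) p) p

/-- `(1 ⊗ d)E(a ⊗ q) = ∑ ε_s(d₍₁₎)a ⊗ d₍₂₎q`. -/
theorem lTensor_mulLeft_E_left (a d q : A) :
    (LinearMap.mulLeft ℂ d).lTensor A (H.E.left (a ⊗ₜ q)) =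
      (sliceLeft H.ε ∘ₗ H.G₁ ∘ₗ (TensorProduct.mk ℂ A A).flip a).rTensor A (H.T₁ (d ⊗ₜ q)) := by
  rw [← H.rTensor_sliceLeft_G₁, leg13_tmul, rTensor_assoc_symm_leftComm_tmul, LinearMap.comp_assoc]

theorem exists_sliceRight_E_left_eq_source {q : A} {φ : Module.Dual ℂ A}
    (hφ : φ ∈ Submodule.span ℂ {φ | ∃ (g : Module.Dual ℂ A) (d : A),
      φ = g ∘ₗ LinearMap.mulLeft ℂ d}) :
    ∃ p, ∀ a, sliceRight φ (H.E.left (a ⊗ₜ q)) = (H.source p).left a := by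
  have left_source (p a : A) : (H.source p).left a = sliceLeft H.ε (H.G₁ (p ⊗ₜ a)) := rfl
  induction hφ using Submodule.span_induction with
  | mem φ hφ =>
    obtain ⟨g, d, rfl⟩ := hφ
    refine ⟨sliceRight g (H.T₁ (d ⊗ₜ q)), fun a => ?_⟩
    rw [sliceRight_comp, lTensor_mulLeft_E_left, ← LinearMap.comp_apply,
      sliceRight_comp_rTensor]
    rfl
  | zero => exact ⟨0, fun a => by simp [sliceRight, left_source]⟩
  | add φ ψ _ _ hφ hψ =>
    obtain ⟨p, hp⟩ := hφ
    obtain ⟨r, hr⟩ := hψ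
    exact ⟨p + r, fun a => by
      simp only [sliceRight_add, hp, hr, left_source, TensorProduct.add_tmul, map_add]⟩
  | smul c φ _ hφ =>
    obtain ⟨p, hp⟩ := hφ
    exact ⟨c • p, fun a => by
      rw [sliceRight_smul, hp, left_source, left_source, ← TensorProduct.smul_tmul', map_smul,
        map_smul]⟩

/-- A form of `∑ S(E₁)E₂ = 1`: with `E(1 ⊗ q) = ∑ yᵢ ⊗ vᵢ`, one gets `q = ∑ S(yᵢ)vᵢ`. -/
theorem exists_eq_sum_antipodeM (q : A) :
    ∃ (n : ℕ) (p v : Fin n → A), (∀ i, v i ∈ LinearMap.range (H.targetAt q)) ∧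
      q = ∑ i, (H.antipodeM (H.source (p i))).left (v i) := by
  obtain ⟨n, v, φ, hv, hφ, expansion⟩ := exists_dual_basis (LinearMap.range (H.targetAt q))
    (Submodule.span ℂ {φ | ∃ (g : Module.Dual ℂ A) (d : A), φ = g ∘ₗ LinearMap.mulLeft ℂ d})
    fun x _ hx => H.right_nondeg x fun d => (Module.forall_dual_apply_eq_zero_iff ℂ _).mp
      fun g => hx _ (Submodule.subset_span ⟨g, d, rfl⟩)
  choose p hp using fun i => H.exists_sliceRight_E_left_eq_source (q := q) (hφ i)
  refine ⟨n, p, v, hv, sub_eq_zero.mp (H.eq_zero_of_forall_antipode_left fun a => ?_)⟩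
  obtain ⟨R₁, R₂, hR₁, -, left_antipode, -⟩ := H.isAntipode_antipode
  have E_left_tmul : H.E.left (a ⊗ₜ q) = ∑ i, (H.source (p i)).left a ⊗ₜ v i := by
    simp only [← hp]
    exact eq_sum_sliceRight_tmul expansion (H.E_left_tmul_mem a q)
  rw [map_sub, map_sum, sub_eq_zero]
  calc (H.antipode a).left q
      = H.antipodeLeft R₁ (H.E.left (a ⊗ₜ q)) := (left_antipode a q).trans
        (LinearMap.congr_fun (antipodeLeft_comp_E_left hR₁) (a ⊗ₜ q)).symm
    _ = ∑ i, (H.antipode ((H.source (p i)).left a)).left (v i) := by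
        rw [E_left_tmul, map_sum]
        exact Finset.sum_congr rfl fun i _ => (left_antipode _ _).symm
    _ = ∑ i, (H.antipode a).left ((H.antipodeM (H.source (p i))).left (v i)) :=
        Finset.sum_congr rfl fun i _ => by
          rw [← (H.antipodeM_source_spec (p i) a).2, Multiplier.left_mul, Module.End.mul_apply]

variable {H} in
/-- `R₁(p ⊗ q)` is in `A ⊗ N` for the space `N` of the elements `s` with `As ⊆ Aq`. -/
theorem R₁_tmul_mem {R₁ R₂ : Module.End ℂ (A ⊗[ℂ] A)}
    (hR₁ : IsGeneralizedInverse H.T₁ H.E.left H.G₁ R₁)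
    (hR₂ : IsGeneralizedInverse H.T₂ H.E.right H.G₂ R₂) (p q : A) :
    R₁ (p ⊗ₜ q) ∈ tensorSubmodule A (⨅ a : A,
      (LinearMap.range (LinearMap.mulRight ℂ q)).comap (LinearMap.mulLeft ℂ a)) := by
  refine H.mem_tensorSubmodule_of_commute (commute_op12_T₂_op23_R₁ hR₁) (fun v => ?_) p
  refine (Submodule.mem_iInf _).mpr fun a => ?_
  exact ⟨H.antipodeRight R₂ (a ⊗ₜ v), antipode_compat hR₁ hR₂ v q a⟩

theorem T₁_tmul_mem {Q : Submodule ℂ A} {s : A} (hs : ∀ a, a * s ∈ Q) (a : A) :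
    H.T₁ (a ⊗ₜ s) ∈ tensorSubmodule A Q :=
  mem_tensorSubmodule_of_forall_rTensor_mem (g := fun r : A => LinearMap.mulLeft ℂ r)
    H.right_nondeg fun r =>
      (H.rTensor_mulLeft_T₁ a s r).symm ▸ lTensor_mem_tensorSubmodule hs _

theorem targetAt_mem (p q : A) : H.targetAt q p ∈ LinearMap.range (LinearMap.mulRight ℂ q) := by
  obtain ⟨R₁, R₂, hR₁, hR₂, -, -⟩ := H.isAntipode_antipode
  have T₁_R₁ : H.T₁ (R₁ (p ⊗ₜ q)) = H.E.left (p ⊗ₜ q) := LinearMap.congr_fun hR₁.1 _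
  refine sliceLeft_mem H.ε (t := H.E.left (p ⊗ₜ q)) ?_
  rw [← T₁_R₁]
  refine tensorSubmodule_induction (S := (tensorSubmodule A _).comap H.T₁) (fun a s hs => ?_)
    (R₁_tmul_mem hR₁ hR₂ p q)
  exact H.T₁_tmul_mem ((Submodule.mem_iInf _).mp hs) a

theorem exists_mul_eq_self (H : WeakMultiplierHopfAlgebra A) (q : A) : ∃ e, e * q = q := by
  obtain ⟨n, p, v, hv, hq⟩ := H.exists_eq_sum_antipodeM q
  suffices q ∈ LinearMap.range (LinearMap.mulRight ℂ q) from this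
  refine Set.mem_of_eq_of_mem hq (Submodule.sum_mem _ fun i _ => ?_)
  obtain ⟨r, hr⟩ := hv i
  obtain ⟨a, ha⟩ := H.targetAt_mem r q
  refine ⟨(H.antipodeM (H.source (p i))).left a, ?_⟩
  rw [← hr, ← ha, LinearMap.mulRight_apply, LinearMap.mulRight_apply, Multiplier.left_apply_mul]

theorem exists_left_unit (H : WeakMultiplierHopfAlgebra A) (s : Finset A) :
    ∃ e, ∀ q ∈ s, e * q = q := by
  classical
  induction s using Finset.induction_on with
  | empty => exact ⟨0, by simp⟩
  | insert q s _ ih =>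
    obtain ⟨e, he⟩ := ih
    obtain ⟨e', he'⟩ := H.exists_mul_eq_self (q - e * q)
    refine ⟨e + e' - e' * e, fun x hx => ?_⟩
    rw [sub_mul, add_mul, mul_assoc]
    rcases Finset.mem_insert.mp hx with rfl | hx
    · rw [mul_sub] at he'
      rw [add_sub_assoc, he', add_sub_cancel]
    · rw [he x hx, add_sub_cancel_right]

end LocalUnits

end WeakMultiplierHopfAlgebra

section UnitalModules

variable {B : Type*} [NonUnitalRing B] [Module ℂ B] [IsScalarTower ℂ B B] [SMulCommClass ℂ B B]
  {V : Type*} [AddCommGroup V] [Module ℂ V] {act : B →ₗ[ℂ] V →ₗ[ℂ] V}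

theorem exists_multiplierAct (mul_act : ∀ a b x, act (a * b) x = act a (act b x))
    (exists_unit : ∀ x, ∃ e, act e x = x) (m : Multiplier B) :
    ∃ f : V →ₗ[ℂ] V, ∀ b x, f (act b x) = act (m.left b) x := by
  have lift_surjective : Function.Surjective (TensorProduct.lift act) := fun x => by
    obtain ⟨e, he⟩ := exists_unit x
    exact ⟨e ⊗ₜ x, by rw [TensorProduct.lift.tmul, he]⟩
  have act_lift_left (e : B) : act e ∘ₗ TensorProduct.lift (act ∘ₗ m.left) =
      act (m.right e) ∘ₗ TensorProduct.lift act :=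
    TensorProduct.ext' fun b x => by
      simp only [LinearMap.comp_apply, TensorProduct.lift.tmul, ← mul_act,
        Multiplier.right_mul_eq_mul_left]
  obtain ⟨f, hf⟩ := exists_comp_eq_of_ker_le lift_surjective
    (β := TensorProduct.lift (act ∘ₗ m.left)) fun v hv => by
      obtain ⟨e, he⟩ := exists_unit (TensorProduct.lift (act ∘ₗ m.left) v)
      rw [LinearMap.mem_ker, ← he, ← LinearMap.comp_apply, act_lift_left, LinearMap.comp_apply,
        LinearMap.mem_ker.mp hv, map_zero]
  exact ⟨f, fun b x => LinearMap.congr_fun hf (b ⊗ₜ x)⟩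

theorem multiplierAct_act (mul_act : ∀ a b x, act (a * b) x = act a (act b x))
    (exists_unit : ∀ x, ∃ e, act e x = x) (m : Multiplier B) (b : B) (x : V) :
    multiplierAct act m (act b x) = act (m.left b) x :=
  Classical.epsilon_spec (exists_multiplierAct mul_act exists_unit m) b x

theorem multiplierAct_mul (mul_act : ∀ a b x, act (a * b) x = act a (act b x))
    (exists_unit : ∀ x, ∃ e, act e x = x) (m n : Multiplier B) (x : V) :
    multiplierAct act (m * n) x = multiplierAct act m (multiplierAct act n x) := by
  obtain ⟨e, he⟩ := exists_unit x
  rw [← he, multiplierAct_act mul_act exists_unit, multiplierAct_act mul_act exists_unit,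
    multiplierAct_act mul_act exists_unit, Multiplier.left_mul, Module.End.mul_apply]

end UnitalModules

section TensorAct

variable {A : Type*} [NonUnitalRing A] [Module ℂ A] {R : Type*} [AddCommGroup R] [Module ℂ R]
  {act : A →ₗ[ℂ] R →ₗ[ℂ] R}

@[simp] theorem tensorAct_tmul (act : A →ₗ[ℂ] R →ₗ[ℂ] R) (a b : A) (r s : R) :
    tensorAct act (a ⊗ₜ b) (r ⊗ₜ s) = act a r ⊗ₜ act b s := by
  simp [tensorAct]

theorem tensorAct_mul [IsScalarTower ℂ A A] [SMulCommClass ℂ A A]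
    (mul_act : ∀ a b x, act (a * b) x = act a (act b x)) (s t : A ⊗[ℂ] A) (x : R ⊗[ℂ] R) :
    tensorAct act (s * t) x = tensorAct act s (tensorAct act t x) := by
  induction x with
  | zero => simp
  | add x y hx hy => simp only [map_add, hx, hy]
  | tmul x y =>
    induction s with
    | zero => simp
    | add s s' hs hs' => simp only [add_mul, map_add, LinearMap.add_apply, hs, hs']
    | tmul a b =>
      induction t with
      | zero => simp
      | add t t' ht ht' => simp only [mul_add, map_add, LinearMap.add_apply, ht, ht']
      | tmul c d => simp [mul_act]

end TensorAct

namespace IsModuleAlgebra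

variable {A : Type*} [NonUnitalRing A] [Module ℂ A] [IsScalarTower ℂ A A] [SMulCommClass ℂ A A]
  {R : Type*} [NonUnitalRing R] [Module ℂ R] [IsScalarTower ℂ R R] [SMulCommClass ℂ R R]
  {H : WeakMultiplierHopfAlgebra A} {act : A →ₗ[ℂ] R →ₗ[ℂ] R}

theorem exists_finset_act_eq_self (hR : IsModuleAlgebra H act) (x : R) :
    ∃ s : Finset A, ∀ e, (∀ q ∈ s, e * q = q) → act e x = x := by
  classical
  have hx : x ∈ Submodule.span ℂ {x : R | ∃ a r, x = act a r} := hR.unital ▸ trivial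
  induction hx using Submodule.span_induction with
  | mem x hx =>
    obtain ⟨a, r, rfl⟩ := hx
    exact ⟨{a}, fun e he => by rw [← hR.mul_act, he a (Finset.mem_singleton_self a)]⟩
  | zero => exact ⟨∅, fun e _ => map_zero _⟩
  | add x y _ _ hx hy =>
    obtain ⟨s, hs⟩ := hx
    obtain ⟨t, ht⟩ := hy
    exact ⟨s ∪ t, fun e he => by
      rw [map_add, hs e fun q hq => he q (Finset.mem_union_left t hq),
        ht e fun q hq => he q (Finset.mem_union_right s hq)]⟩
  | smul c x _ hx =>
    obtain ⟨s, hs⟩ := hx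
    exact ⟨s, fun e he => by rw [map_smul, hs e he]⟩

theorem exists_finset_tensorAct_eq_self (hR : IsModuleAlgebra H act) (x : R ⊗[ℂ] R) :
    ∃ s : Finset A, ∀ e, (∀ q ∈ s, e * q = q) → tensorAct act (e ⊗ₜ e) x = x := by
  classical
  induction x with
  | zero => exact ⟨∅, fun e _ => map_zero _⟩
  | tmul x y =>
    obtain ⟨s, hs⟩ := hR.exists_finset_act_eq_self x
    obtain ⟨t, ht⟩ := hR.exists_finset_act_eq_self y
    exact ⟨s ∪ t, fun e he => by
      rw [tensorAct_tmul, hs e fun q hq => he q (Finset.mem_union_left t hq),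
        ht e fun q hq => he q (Finset.mem_union_right s hq)]⟩
  | add x y hx hy =>
    obtain ⟨s, hs⟩ := hx
    obtain ⟨t, ht⟩ := hy
    exact ⟨s ∪ t, fun e he => by
      rw [map_add, hs e fun q hq => he q (Finset.mem_union_left t hq),
        ht e fun q hq => he q (Finset.mem_union_right s hq)]⟩

theorem exists_act_eq_self (hR : IsModuleAlgebra H act) (x : R) : ∃ e, act e x = x := by
  obtain ⟨s, hs⟩ := hR.exists_finset_act_eq_self x
  obtain ⟨e, he⟩ := H.exists_left_unit s
  exact ⟨e, hs e he⟩

theorem exists_tensorAct_eq_self (hR : IsModuleAlgebra H act) (x : R ⊗[ℂ] R) :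
    ∃ e, tensorAct act e x = x := by
  obtain ⟨s, hs⟩ := hR.exists_finset_tensorAct_eq_self x
  obtain ⟨e, he⟩ := H.exists_left_unit s
  exact ⟨e ⊗ₜ e, hs e he⟩

theorem act_mul'_apply (hR : IsModuleAlgebra H act) (a : A) (t : R ⊗[ℂ] R) :
    act a (LinearMap.mul' ℂ R t) =
      LinearMap.mul' ℂ R (multiplierAct (tensorAct act) (H.Δ a) t) :=
  LinearMap.congr_fun (f := act a ∘ₗ LinearMap.mul' ℂ R)
    (g := LinearMap.mul' ℂ R ∘ₗ multiplierAct (tensorAct act) (H.Δ a))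
    (TensorProduct.ext' fun x y => hR.act_mul a x y) t

theorem mul'_E_act (hR : IsModuleAlgebra H act) (r r' : R) :
    LinearMap.mul' ℂ R (multiplierAct (tensorAct act) H.E (r ⊗ₜ r')) = r * r' := by
  have act_mul'_E_act (a : A) :
      act a (LinearMap.mul' ℂ R (multiplierAct (tensorAct act) H.E (r ⊗ₜ r'))) =
        act a (r * r') := by
    rw [hR.act_mul'_apply, hR.act_mul,
      ← multiplierAct_mul (tensorAct_mul hR.mul_act) hR.exists_tensorAct_eq_self, H.Δ_mul_E]
  obtain ⟨e, he⟩ := hR.exists_act_eq_self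
    (LinearMap.mul' ℂ R (multiplierAct (tensorAct act) H.E (r ⊗ₜ r')) - r * r')
  rw [← sub_eq_zero, ← he, map_sub, act_mul'_E_act, sub_self]

theorem source_act_mul (hR : IsModuleAlgebra H act) (p : A) (r r' : R) :
    multiplierAct act (H.source p) r * r' =
      r * multiplierAct act (H.antipodeM (H.source p)) r' := by
  have E_act : multiplierAct (tensorAct act) H.E (multiplierAct act (H.source p) r ⊗ₜ r') =
      multiplierAct (tensorAct act) H.E
        (r ⊗ₜ multiplierAct act (H.antipodeM (H.source p)) r') := by
    obtain ⟨b, hb⟩ := hR.exists_act_eq_self r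
    obtain ⟨c, hc⟩ := hR.exists_act_eq_self r'
    rw [← hb, ← hc, multiplierAct_act hR.mul_act hR.exists_act_eq_self,
      multiplierAct_act hR.mul_act hR.exists_act_eq_self, ← tensorAct_tmul, ← tensorAct_tmul,
      multiplierAct_act (tensorAct_mul hR.mul_act) hR.exists_tensorAct_eq_self,
      multiplierAct_act (tensorAct_mul hR.mul_act) hR.exists_tensorAct_eq_self,
      H.E_left_source_tmul]
  rw [← hR.mul'_E_act, E_act, hR.mul'_E_act]

end IsModuleAlgebra

end WMHA

end

theorem proposition3p3 {A : Type*} [NonUnitalRing A] [Module ℂ A] [IsScalarTower ℂ A A]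
    [SMulCommClass ℂ A A] {R : Type*} [NonUnitalRing R] [Module ℂ R] [IsScalarTower ℂ R R]
    [SMulCommClass ℂ R R] (H : WMHA.WeakMultiplierHopfAlgebra A) (act : A →ₗ[ℂ] R →ₗ[ℂ] R)
    (hR : WMHA.IsModuleAlgebra H act) :
    (∀ r r' : R, LinearMap.mul' ℂ R
      (WMHA.multiplierAct (WMHA.tensorAct act) H.E (r ⊗ₜ[ℂ] r')) = r * r') ∧
    ∀ y ∈ H.sourceAlgebra, ∀ r r' : R,
      WMHA.multiplierAct act y r * r' =
        r * WMHA.multiplierAct act (H.antipodeM y) r' := by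
  refine ⟨hR.mul'_E_act, ?_⟩
  rintro _ ⟨p, rfl⟩ r r'
  rw [H.sourceMap_eq]
  exact hR.source_act_mul p r r'
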